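/- All graphs are finite, simple and undirected. A greyscale of a graph $G=(V,E)$ is a map $f:V\to[0,1]$ that takes both values $0$ and $1$. Its gradation vector $\mathrm{grad}(G,f)$ is the list of the numbers $|f(u)-f(v)|$, $\{u,v\}\in E$ (with multiplicity), sorted in decreasing order; gradation vectors are compared lexicographically. A minimum gradation greyscale is a greyscale whose gradation vector, the minimum gradation vector of $G$, is minimum among those of all greyscales of $G$. Compatible-complete-mapping procedure: given a connected graph $G$ and prescribed colours on a set $V_c$ of vertices, put $H:=G$ and repeat the following until all vertices are coloured. (i) If some component of $H$ contains two distinct coloured vertices, let $M$ be the maximum of $F(u,v)=|f(u)-f(v)|/d_H(u,v)$ over all pairs of distinct coloured vertices $u,v$ in a common component of $H$. For every pair with $F(u,v)=M$ and, say, $f(u)\le f(v)$, give every vertex $w$ on a $u$–$v$ geodesic of $H$ the colour $f(u)+d_H(w,u)M$. Then delete from $H$, for each such pair, all edges joining two vertices that lie on $u$–$v$ geodesics, and remove the resulting isolated vertices. (ii) Otherwise every component of $H$ contains exactly one coloured vertex, and all its vertices receive the colour of that vertex. Theorem. (a) Let $G=(V,E)$ be a connected graph with at least two vertices. For every ordered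 pair $(u,v)$ of distinct vertices, the procedure started with $V_c=\{u,v\}$, $f(u)=0$, $f(v)=1$ is well defined, halts, and outputs a greyscale $f_{uv}$ of $G$ with $f_{uv}(u)=0$ and $f_{uv}(v)=1$. The minimum gradation vector of $G$ exists and equals $\min_{u\neq v}\mathrm{grad}(G,f_{uv})$, and the minimum gradation greyscales of $G$ are exactly those $f_{uv}$ that attain this minimum. (b) The minimum gradation problem can be solved in polynomial time: there are a program and a polynomial $T$ such that, for every $n\ge 2$ and every connected graph $G$ on $\{0,\dots,n-1\}$ given by its adjacency matrix, the program halts after at most $T(n)$ steps and outputs the minimum gradation vector of $G$, a list containing exactly the minimum gradation greyscales of $G$, and the greyscales $f_{uv}$ for all ordered pairs of distinct vertices, all numbers being given as fractions of natural numbers. Here a program is a structured program for a random access machine with natural-number memory cells whose only arithmetic operations are addition and truncated subtraction, each operation, test and memory access costing a constant number of steps. -/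

import Mathlib

/-! # Greyscales, gradation vectors, the compatible-complete-mapping procedure,
and a random access machine with a step count -/

namespace Gradation

/-! ## Greyscales and gradation vectors -/

/-- A greyscale: a colouring of the vertices by `[0, 1]` that reaches both `0` and `1`. -/
structure IsGreyscale {V : Type*} (f : V → ℝ) : Prop where
  mem_Icc : ∀ v, f v ∈ Set.Icc (0 : ℝ) 1
  exists_zero : ∃ v, f v = 0
  exists_one : ∃ v, f v = 1

/-- The grey tone `|f u - f v|` that `f` induces on the edge `{u, v}`. -/
def edgeTone {V : Type*} (f : V → ℝ) : Sym2 V → ℝ :=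
  Sym2.lift ⟨fun u v => |f u - f v|, fun u v => abs_sub_comm (f u) (f v)⟩

open Classical in
/-- The gradation vector: the grey tones of all edges (with multiplicity), in decreasing order.
Lists carry the lexicographic order. -/
noncomputable def gradVector {V : Type*} [Fintype V] (G : SimpleGraph V) (f : V → ℝ) : List ℝ :=
  (G.edgeFinset.val.map (edgeTone f)).sort (fun x y => y ≤ x)

/-- `γ` is the minimum gradation vector of `G`. -/
def IsMinGradationVector {V : Type*} [Fintype V] (G : SimpleGraph V) (γ : List ℝ) : Prop :=
  IsLeast {x : List ℝ | ∃ f : V → ℝ, IsGreyscale f ∧ x = gradVector G f} γ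

/-- `f` is a minimum gradation greyscale of `G`. -/
def IsMinGradationGreyscale {V : Type*} [Fintype V] (G : SimpleGraph V) (f : V → ℝ) : Prop :=
  IsGreyscale f ∧ ∀ h : V → ℝ, IsGreyscale h → gradVector G f ≤ gradVector G h

/-! ## The compatible-complete-mapping procedure -/

/-- The data kept by the procedure: the current subgraph (its vertex set is `graph.support`, so
isolated vertices count as removed), the set of vertices coloured so far, and their colours (the
values of `colour` outside `coloured` carry no meaning). -/
structure CCMState (V : Type*) where
  graph : SimpleGraph V
  coloured : Set V
  colour : V → ℝ

namespace CCMState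

variable {V : Type*}

/-- `u` and `v` are distinct coloured vertices in the same component of the current subgraph. -/
def IsPair (s : CCMState V) (u v : V) : Prop :=
  u ∈ s.coloured ∧ v ∈ s.coloured ∧ u ≠ v ∧ s.graph.Reachable u v

/-- The edge-colour-increase `F(u, v)`, with distances taken in the current subgraph. -/
noncomputable def increase (s : CCMState V) (u v : V) : ℝ :=
  |s.colour u - s.colour v| / (s.graph.dist u v : ℝ)

/-- `M` is the maximum of `F` over all pairs of coloured vertices in a common component. -/
def IsMaxIncrease (s : CCMState V) (M : ℝ) : Prop :=
  IsGreatest {x : ℝ | ∃ u v, s.IsPair u v ∧ x = s.increase u v} M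

/-- The vertices lying on some `u`-`v` geodesic of the current subgraph. -/
def geodesicSet (s : CCMState V) (u v : V) : Set V :=
  {w | ∃ p : s.graph.Walk u v, p.length = s.graph.dist u v ∧ w ∈ p.support}

open Classical in
/-- The colour given to a vertex `w` of a `u`-`v` geodesic when `F(u, v) = M` is the maximum. -/
noncomputable def newColour (s : CCMState V) (M : ℝ) (u v w : V) : ℝ :=
  if s.colour u ≤ s.colour v then s.colour u + (s.graph.dist w u : ℝ) * M
  else s.colour v + (s.graph.dist w v : ℝ) * M

/-- An iteration in which some pair of coloured vertices attains the maximum `M` of `F`: all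
vertices on geodesics between the pairs attaining `M` are coloured, and for each such pair all
edges between two vertices on its geodesics are deleted. -/
structure GeodesicStep (s s' : CCMState V) (M : ℝ) : Prop where
  isMax : s.IsMaxIncrease M
  coloured_eq : s'.coloured = s.coloured ∪
    {w | ∃ u v, s.IsPair u v ∧ s.increase u v = M ∧ w ∈ s.geodesicSet u v}
  colour_new : ∀ u v w, s.IsPair u v → s.increase u v = M → w ∈ s.geodesicSet u v →
    s'.colour w = s.newColour M u v w
  colour_old : ∀ w, (¬ ∃ u v, s.IsPair u v ∧ s.increase u v = M ∧ w ∈ s.geodesicSet u v) →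
    s'.colour w = s.colour w
  graph_eq : s'.graph = s.graph.deleteEdges
    {e | ∃ u v, s.IsPair u v ∧ s.increase u v = M ∧
      ∃ w₁ ∈ s.geodesicSet u v, ∃ w₂ ∈ s.geodesicSet u v, e = s(w₁, w₂)}

/-- The last iteration: no component contains two coloured vertices, and every vertex of the current
subgraph receives the colour of the coloured vertex of its component. -/
structure TerminalStep (s s' : CCMState V) : Prop where
  no_pair : ∀ u v, ¬ s.IsPair u v
  coloured_eq : s'.coloured = s.coloured ∪ s.graph.support
  colour_new : ∀ w ∈ s.graph.support,
    ∃ c ∈ s.coloured, s.graph.Reachable c w ∧ s'.colour w = s.colour c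
  colour_old : ∀ w ∉ s.graph.support, s'.colour w = s.colour w
  graph_eq : s'.graph = s.graph

/-- One iteration of the while loop, which is entered only while some vertex is uncoloured. -/
def Step (s s' : CCMState V) : Prop :=
  s.coloured ≠ Set.univ ∧ ((∃ M, GeodesicStep s s' M) ∨ TerminalStep s s')

end CCMState

/-- The compatible-complete-mapping procedure, run on `G` with the vertices of `C` precoloured by
`g` (the values of `g` outside `C` carry no meaning), halts with output `f`. -/
def CCMOutputs {V : Type*} (G : SimpleGraph V) (C : Set V) (g f : V → ℝ) : Prop :=
  ∃ s : CCMState V, Relation.ReflTransGen CCMState.Step ⟨G, C, g⟩ s ∧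
    s.coloured = Set.univ ∧ s.colour = f

open Classical in
/-- The output of the procedure when exactly `u` and `v` are precoloured, by `0` and `1`. -/
def CCMPairOutputs {V : Type*} (G : SimpleGraph V) (u v : V) (f : V → ℝ) : Prop :=
  CCMOutputs G {u, v} (fun w => if w = v then 1 else 0) f

/-! ## A random access machine

Programs are structured programs for a random access machine whose memory cells hold natural
numbers. The only arithmetic is addition and truncated subtraction, at unit cost; there is no
multiplication, so the numbers produced in `t` steps have at most `O(t)` more bits than the input
and the constants of the program, and polynomial time here is polynomial time on Turing machines. -/

/-- The memory: registers `x₀, x₁, …` and arrays `a₀, a₁, …`, each with cells `0, 1, 2, …`. -/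
structure Memory where
  reg : ℕ → ℕ
  arr : ℕ → ℕ → ℕ

/-- Arithmetic expressions. -/
inductive AExp where
  | const (c : ℕ)
  | reg (x : ℕ)
  | cell (a : ℕ) (i : AExp)
  | add (e₁ e₂ : AExp)
  | sub (e₁ e₂ : AExp)

/-- The value of an expression. -/
def AExp.eval (m : Memory) : AExp → ℕ
  | .const c => c
  | .reg x => m.reg x
  | .cell a i => m.arr a (i.eval m)
  | .add e₁ e₂ => e₁.eval m + e₂.eval m
  | .sub e₁ e₂ => e₁.eval m - e₂.eval m

/-- The number of steps for evaluating an expression: one for each operation and each access. -/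
def AExp.cost : AExp → ℕ
  | .const _ => 1
  | .reg _ => 1
  | .cell _ i => i.cost + 1
  | .add e₁ e₂ => e₁.cost + e₂.cost + 1
  | .sub e₁ e₂ => e₁.cost + e₂.cost + 1

/-- Programs. A test `e` succeeds when the value of `e` is nonzero. -/
inductive Program where
  | skip
  | assign (x : ℕ) (e : AExp)
  | store (a : ℕ) (i e : AExp)
  | seq (p q : Program)
  | branch (e : AExp) (p q : Program)
  | loop (e : AExp) (p : Program)

/-- `Runs p m t m'`: the program `p`, started in memory `m`, halts after exactly `t` steps in memory
`m'`. -/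
inductive Runs : Program → Memory → ℕ → Memory → Prop where
  | skip (m : Memory) : Runs .skip m 1 m
  | assign (x : ℕ) (e : AExp) (m : Memory) :
      Runs (.assign x e) m (e.cost + 1) ⟨Function.update m.reg x (e.eval m), m.arr⟩
  | store (a : ℕ) (i e : AExp) (m : Memory) :
      Runs (.store a i e) m (i.cost + e.cost + 1)
        ⟨m.reg, Function.update m.arr a (Function.update (m.arr a) (i.eval m) (e.eval m))⟩
  | seq {p q : Program} {m₁ m₂ m₃ : Memory} {t₁ t₂ : ℕ} :
      Runs p m₁ t₁ m₂ → Runs q m₂ t₂ m₃ → Runs (.seq p q) m₁ (t₁ + t₂) m₃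
  | branch_true {e : AExp} {p q : Program} {m m' : Memory} {t : ℕ} :
      e.eval m ≠ 0 → Runs p m t m' → Runs (.branch e p q) m (e.cost + 1 + t) m'
  | branch_false {e : AExp} {p q : Program} {m m' : Memory} {t : ℕ} :
      e.eval m = 0 → Runs q m t m' → Runs (.branch e p q) m (e.cost + 1 + t) m'
  | loop_done {e : AExp} {p : Program} {m : Memory} :
      e.eval m = 0 → Runs (.loop e p) m (e.cost + 1) m
  | loop_next {e : AExp} {p : Program} {m₁ m₂ m₃ : Memory} {t₁ t₂ : ℕ} :
      e.eval m₁ ≠ 0 → Runs p m₁ t₁ m₂ → Runs (.loop e p) m₂ t₂ m₃ →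
        Runs (.loop e p) m₁ (e.cost + 1 + t₁ + t₂) m₃

/-! ## Input and output of the minimum gradation problem -/

open Classical in
/-- The input memory for a graph on `{0, …, n - 1}`: register `0` holds `n`, array `0` holds the
adjacency matrix row by row, and everything else is `0`. -/
noncomputable def inputMemory {n : ℕ} (G : SimpleGraph (Fin n)) : Memory where
  reg x := if x = 0 then n else 0
  arr a i := if a = 0 ∧ ∃ u v : Fin n, i = u * n + v ∧ G.Adj u v then 1 else 0

/-- Cell `i` of the arrays `a` and `b` holds numerator and denominator of the number `x`. -/
def Memory.HoldsFrac (m : Memory) (a b i : ℕ) (x : ℝ) : Prop :=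
  0 < m.arr b i ∧ x = (m.arr a i : ℝ) / (m.arr b i : ℝ)

/-- The memory `m` holds a complete solution for the graph `G`. -/
structure HoldsSolution {n : ℕ} (G : SimpleGraph (Fin n)) (m : Memory) : Prop where
  /-- The minimum gradation vector: register `1` holds its length, arrays `1`, `2` its entries. -/
  vector : ∃ γ : List ℝ, IsMinGradationVector G γ ∧ γ.length = m.reg 1 ∧
    ∀ (i : ℕ) (hi : i < γ.length), m.HoldsFrac 1 2 i γ[i]
  /-- The minimum gradation greyscales: register `2` holds the length `K` of a list, arrays
  `3`, `4` hold the values of the listed colourings, vertex by vertex. Every listed colouring is a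
  minimum gradation greyscale, and every minimum gradation greyscale is listed. -/
  listed_isMin : ∀ k < m.reg 2, ∃ f : Fin n → ℝ, IsMinGradationGreyscale G f ∧
    ∀ w : Fin n, m.HoldsFrac 3 4 (k * n + w) (f w)
  isMin_listed : ∀ f : Fin n → ℝ, IsMinGradationGreyscale G f →
    ∃ k < m.reg 2, ∀ w : Fin n, m.HoldsFrac 3 4 (k * n + w) (f w)
  /-- The mappings which the procedure produces from all ordered pairs of distinct vertices,
  in arrays `5`, `6`. -/
  pairs : ∀ u v : Fin n, u ≠ v → ∃ f : Fin n → ℝ, CCMPairOutputs G u v f ∧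
    ∀ w : Fin n, m.HoldsFrac 5 6 ((u * n + v) * n + w) (f w)

end Gradation

namespace Gradation

/-! ## Sorted lists in lexicographic order -/

/-! The core is a rigidity statement, `SlopeSteps.eq_or_gradVector_lt`. In a step of slope M the
current colours grow by at most M per edge along every walk of the remaining graph. Every newly
coloured vertex w lies on a walk u → w → v between coloured vertices along which the colour grows by
exactly M per edge, and only edges between coloured vertices are deleted (`SlopeStep`). Suppose f
agrees with a run up to such a step and then differs at w. Having the same values at u and v, f must
jump by more than M on some edge of the walk. The final colouring of the run stays within M on all
remaining edges (`SlopeSteps.abs_sub_le`), and on the edges deleted earlier the two agree, since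
both ends were coloured. Common entries do not affect the strict lexicographic order of sorted lists
(`sort_add_lt_sort_add`), so f loses strictly. Hence a complete run yields the unique extension with
least gradation vector, whichever slope steps it consists of.

Each iteration of the procedure is a slope step: the slope is the maximum increase, or 0 in the last
iteration. Geodesics of two maximising pairs that cross prescribe the same colour, each geodesic
iteration removes an edge, and connectedness lets the last iteration reach every vertex, so complete
runs exist. Every greyscale is 0 at some u and 1 at some v, so it either equals the outcome for (u,
v) or is strictly worse. This gives part (a).

For part (b) the geodesic sets need not be simulated, because any complete sequence of slope steps
has the same outcome. The machine colours one vertex per round, the first vertex of a steepest walk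
leaving the coloured set (`slopeStep_fracState`). Walks of slope 0 are admitted, so the last
iteration needs no special treatment. Colours are integers over a denominator that is multiplied by
n! in each round, which makes division by a walk length of at most n exact. All outcomes then share
the denominator n! ^ n, and gradation vectors are compared as integer lists. Commands whose loops
are bounded by unchanged registers compile to programs of polynomial cost (`Cmd.runs_compile`). -/

theorem orderedInsert_lt_orderedInsert {α : Type*} [LinearOrder α] (x : α) :
    ∀ {l₁ l₂ : List α}, l₁ < l₂ →
      l₁.orderedInsert (fun a b => b ≤ a) x < l₂.orderedInsert (fun a b => b ≤ a) x
  | [], [], h => absurd h (lt_irrefl _)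
  | [], b :: l, _ => by
    rw [List.orderedInsert_nil, List.orderedInsert_cons]
    split_ifs with hb
    · exact List.cons_lt_cons_iff.2 (Or.inr ⟨rfl, List.nil_lt_cons _ _⟩)
    · exact List.cons_lt_cons_iff.2 (Or.inl (not_le.1 hb))
  | a :: l, [], h => absurd h (List.not_lt_nil _)
  | a :: l, b :: l', h => by
    rw [List.orderedInsert_cons, List.orderedInsert_cons]
    rcases List.cons_lt_cons_iff.1 h with hab | ⟨rfl, hl⟩
    · split_ifs with h₁ h₂ h₂
      · exact List.cons_lt_cons_iff.2 (Or.inr ⟨rfl, h⟩)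
      · exact List.cons_lt_cons_iff.2 (Or.inl (not_le.1 h₂))
      · exact absurd (hab.le.trans h₂) h₁
      · exact List.cons_lt_cons_iff.2 (Or.inl hab)
    · split_ifs with h₁
      · exact List.cons_lt_cons_iff.2 (Or.inr ⟨rfl, h⟩)
      · exact List.cons_lt_cons_iff.2 (Or.inr ⟨rfl, orderedInsert_lt_orderedInsert x hl⟩)

theorem sort_eq_of_perm {α : Type*} [LinearOrder α] {s : Multiset α} {l : List α}
    (hl : l.Pairwise fun a b => b ≤ a) (hs : (l : Multiset α) = s) :
    s.sort (fun a b => b ≤ a) = l := by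
  subst hs
  refine List.Perm.eq_of_pairwise (le := fun a b => b ≤ a) (fun a b _ _ h h' => le_antisymm h' h)
    (Multiset.pairwise_sort _ _) hl ?_
  exact Multiset.coe_eq_coe.1 (Multiset.sort_eq _ _)

theorem sort_cons_eq_orderedInsert {α : Type*} [LinearOrder α] (x : α) (s : Multiset α) :
    (x ::ₘ s).sort (fun a b => b ≤ a) =
      (s.sort (fun a b => b ≤ a)).orderedInsert (fun a b => b ≤ a) x := by
  refine sort_eq_of_perm ((Multiset.pairwise_sort s _).orderedInsert _ _) ?_
  rw [Multiset.coe_eq_coe.2 (List.perm_orderedInsert _ _ _), ← Multiset.cons_coe,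
    Multiset.sort_eq]

/-- Adding the elements of `X` one by one is ordered insertion, which preserves strict inequality.
For empty `X` the first entries already decide. -/
theorem sort_add_lt_sort_add {α : Type*} [LinearOrder α] {M z : α} (X : Multiset α)
    {Y Z : Multiset α} (hY : ∀ y ∈ Y, y ≤ M) (hz : z ∈ Z) (hM : M < z) :
    (X + Y).sort (fun a b => b ≤ a) < (X + Z).sort (fun a b => b ≤ a) := by
  induction X using Multiset.induction_on with
  | empty =>
    rw [zero_add, zero_add]
    have hsY : ∀ y ∈ Y.sort (fun a b => b ≤ a), y ≤ M := fun y hy => hY y ((Multiset.mem_sort _).1 hy)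
    have hsZ := (Multiset.mem_sort (fun a b : α => b ≤ a)).2 hz
    have hpZ := Multiset.pairwise_sort Z (fun a b => b ≤ a)
    revert hsY hsZ hpZ
    generalize Y.sort (fun a b => b ≤ a) = l
    generalize Z.sort (fun a b => b ≤ a) = l'
    intro hl hz' hp
    rcases l' with _ | ⟨b, l'⟩
    · simp at hz'
    · have hb : M < b := by
        rcases List.mem_cons.1 hz' with rfl | h
        · exact hM
        · exact hM.trans_le ((List.pairwise_cons.1 hp).1 _ h)
      rcases l with _ | ⟨a, l⟩
      · exact List.nil_lt_cons _ _
      · exact List.cons_lt_cons_iff.2 (Or.inl ((hl a (by simp)).trans_lt hb))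
  | cons x X ih =>
    rw [Multiset.cons_add, Multiset.cons_add, sort_cons_eq_orderedInsert,
      sort_cons_eq_orderedInsert]
    exact orderedInsert_lt_orderedInsert x ih

/-- The edges of `G` are split by membership in `H`: those outside contribute the same multiset to
both vectors, and those inside satisfy the threshold comparison of `sort_add_lt_sort_add`. -/
theorem gradVector_lt_gradVector {V : Type*} [Fintype V] {G H : SimpleGraph V} (hHG : H ≤ G)
    {f h : V → ℝ} {M : ℝ} (heq : ∀ x y, G.Adj x y → ¬ H.Adj x y → |f x - f y| = |h x - h y|)
    (hle : ∀ x y, H.Adj x y → |f x - f y| ≤ M) {x y : V} (hxy : H.Adj x y)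
    (hM : M < |h x - h y|) : gradVector G f < gradVector G h := by
  classical
  have key : ∀ g : V → ℝ, (G.edgeFinset.val.map (edgeTone g)) =
      ((G.edgeFinset.val.filter (· ∉ H.edgeSet)).map (edgeTone g)) +
      ((G.edgeFinset.val.filter (· ∈ H.edgeSet)).map (edgeTone g)) := fun g => by
    rw [← Multiset.map_add, add_comm, Multiset.filter_add_not]
  have hX : (G.edgeFinset.val.filter (· ∉ H.edgeSet)).map (edgeTone f) =
      (G.edgeFinset.val.filter (· ∉ H.edgeSet)).map (edgeTone h) := by
    refine Multiset.map_congr rfl fun e he => ?_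
    rw [Multiset.mem_filter] at he
    obtain ⟨he, he'⟩ := he
    induction e using Sym2.ind with
    | h a b => exact heq a b (by simpa using he) (by simpa using he')
  have := sort_add_lt_sort_add
    ((G.edgeFinset.val.filter (· ∉ H.edgeSet)).map (edgeTone h))
    (Y := (G.edgeFinset.val.filter (· ∈ H.edgeSet)).map (edgeTone f))
    (Z := (G.edgeFinset.val.filter (· ∈ H.edgeSet)).map (edgeTone h)) (M := M)
    (z := |h x - h y|) ?_ ?_ hM
  · unfold gradVector
    convert this using 2
    · rw [← hX, ← key]
    · rw [← key]
  · intro t ht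
    obtain ⟨e, he, rfl⟩ := Multiset.mem_map.1 ht
    rw [Multiset.mem_filter] at he
    induction e using Sym2.ind with
    | h a b => exact hle a b (by simpa using he.2)
  · refine Multiset.mem_map.2 ⟨s(x, y), ?_, rfl⟩
    rw [Multiset.mem_filter]
    exact ⟨by simpa using hHG hxy, by simpa using hxy⟩

/-! ## Steps that colour along steepest walks -/

/-- Along every walk of `H` between vertices of `C`, the colour `c` increases by at most `M` per
edge. -/
def WalkLipschitz {V : Type*} (H : SimpleGraph V) (C : Set V) (c : V → ℝ) (M : ℝ) : Prop :=
  ∀ x ∈ C, ∀ y ∈ C, ∀ p : H.Walk x y, c y - c x ≤ M * p.length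

/-- A step that extends an `M`-Lipschitz partial colouring along walks of constant slope `M`, and
deletes only edges between coloured vertices. -/
structure SlopeStep {V : Type*} (s s' : CCMState V) (M : ℝ) : Prop where
  nonneg : 0 ≤ M
  lipschitz : WalkLipschitz s.graph s.coloured s.colour M
  subset : s.coloured ⊆ s'.coloured
  exists_walks : ∀ w ∈ s'.coloured, ∃ u ∈ s.coloured, ∃ v ∈ s.coloured,
    ∃ (p : s.graph.Walk u w) (q : s.graph.Walk w v),
      s'.colour w = s.colour u + M * p.length ∧ s'.colour w + M * q.length = s.colour v
  graph_le : s'.graph ≤ s.graph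
  mem_of_deleted : ∀ x y, s.graph.Adj x y → ¬ s'.graph.Adj x y →
    x ∈ s'.coloured ∧ y ∈ s'.coloured

namespace SlopeStep

variable {V : Type*} {s s' : CCMState V} {M : ℝ}

/-- The Lipschitz bound along u → w keeps the old colour from exceeding the new one, and the bound
along w → v keeps it from falling below. So preservation of old colours need not be a field of
`SlopeStep`. -/
theorem colour_eq (h : SlopeStep s s' M) {w : V} (hw : w ∈ s.coloured) :
    s'.colour w = s.colour w := by
  obtain ⟨u, hu, v, hv, p, q, h₁, h₂⟩ := h.exists_walks w (h.subset hw)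
  have := h.lipschitz u hu w hw p
  have := h.lipschitz w hw v hv q
  linarith

/-- The new colouring is still Lipschitz with respect to the old graph, for every slope for which
the old one was. -/
theorem lipschitz_next (h : SlopeStep s s' M) {L : ℝ} (hML : M ≤ L) :
    WalkLipschitz s.graph s'.coloured s'.colour L := by
  intro x hx y hy p
  obtain ⟨u, hu, -, -, p₁, -, h₁, -⟩ := h.exists_walks x hx
  obtain ⟨-, -, v, hv, -, q₂, -, h₂⟩ := h.exists_walks y hy
  -- The walk is prolonged to vertices coloured before the step. On the added ends the colour has
  -- slope exactly `M`, so they cancel from the bound.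
  have := h.lipschitz u hu v hv ((p₁.append p).append q₂)
  simp only [SimpleGraph.Walk.length_append] at this
  push_cast at this
  have h3 : M * p.length ≤ L * p.length := by gcongr
  nlinarith

theorem mem_Icc (h : SlopeStep s s' M) (hs : ∀ w ∈ s.coloured, s.colour w ∈ Set.Icc (0 : ℝ) 1)
    {w : V} (hw : w ∈ s'.coloured) : s'.colour w ∈ Set.Icc (0 : ℝ) 1 := by
  obtain ⟨u, hu, v, hv, p, q, h₁, h₂⟩ := h.exists_walks w hw
  have h3 : 0 ≤ M * p.length := mul_nonneg h.nonneg (Nat.cast_nonneg _)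
  have h4 : 0 ≤ M * q.length := mul_nonneg h.nonneg (Nat.cast_nonneg _)
  exact ⟨by linarith [(hs u hu).1], by linarith [(hs v hv).2]⟩

end SlopeStep

/-- A sequence of slope steps. -/
abbrev SlopeSteps {V : Type*} : CCMState V → CCMState V → Prop :=
  Relation.ReflTransGen fun s s' => ∃ M, SlopeStep s s' M

/-! ### Complete sequences of slope steps: tone bounds, minimality and uniqueness -/

namespace SlopeSteps

variable {V : Type*} {s t : CCMState V}

theorem subset (h : SlopeSteps s t) : s.coloured ⊆ t.coloured := by
  induction h with
  | refl => exact subset_rfl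
  | tail _ h ih => obtain ⟨M, h⟩ := h; exact ih.trans h.subset

theorem colour_eq (h : SlopeSteps s t) {w : V} (hw : w ∈ s.coloured) :
    t.colour w = s.colour w := by
  induction h with
  | refl => rfl
  | tail h₀ h ih => obtain ⟨M, h⟩ := h; rw [h.colour_eq (subset h₀ hw), ih]

theorem mem_Icc (h : SlopeSteps s t) (hs : ∀ w ∈ s.coloured, s.colour w ∈ Set.Icc (0 : ℝ) 1) :
    ∀ w ∈ t.coloured, t.colour w ∈ Set.Icc (0 : ℝ) 1 := by
  induction h with
  | refl => exact hs
  | tail _ h ih => obtain ⟨M, h⟩ := h; exact fun w hw => h.mem_Icc ih hw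

/-- The bound `M` passes from each state to the next whatever the slopes of the later steps are, so
no monotonicity of slopes is needed. When an edge is deleted, its ends already have their final
colours. -/
theorem abs_sub_le (h : SlopeSteps s t) (ht : t.coloured = Set.univ) {M : ℝ}
    (hs : WalkLipschitz s.graph s.coloured s.colour M) {x y : V} (hxy : s.graph.Adj x y) :
    |t.colour x - t.colour y| ≤ M := by
  have edge : ∀ (H : SimpleGraph V) (C : Set V) (c : V → ℝ), WalkLipschitz H C c M →
      x ∈ C → y ∈ C → H.Adj x y → |c x - c y| ≤ M := by
    intro H C c hL hx hy hH
    have h₁ := hL x hx y hy hH.toWalk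
    have h₂ := hL y hy x hx hH.symm.toWalk
    simp at h₁ h₂
    rw [abs_le]
    constructor <;> linarith
  induction h using Relation.ReflTransGen.head_induction_on with
  | refl => exact edge _ _ _ hs (ht ▸ Set.mem_univ _) (ht ▸ Set.mem_univ _) hxy
  | @head a b h₀ h₁ ih =>
    obtain ⟨N, h₀⟩ := h₀
    have hb : WalkLipschitz a.graph b.coloured b.colour M := by
      intro z hz w hw p
      obtain ⟨u, hu, v', hv', p₁, q₁, e₁, e₁'⟩ := h₀.exists_walks z hz
      obtain ⟨u', hu', v, hv, p₂, q₂, e₂, e₂'⟩ := h₀.exists_walks w hw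
      rcases le_total N M with hNM | hNM
      · exact h₀.lipschitz_next hNM z hz w hw p
      -- Here the step is at least as steep as `M`: the ends of the prolonged walk use up `N` per
      -- edge, while the old bound grants only `M`, so at most `M` per edge is left for `p`.
      · have := hs u hu v hv ((p₁.append p).append q₂)
        simp only [SimpleGraph.Walk.length_append] at this
        push_cast at this
        have h3 : M * p₁.length ≤ N * p₁.length := by gcongr
        have h4 : M * q₂.length ≤ N * q₂.length := by gcongr
        nlinarith
    by_cases hb' : b.graph.Adj x y
    · refine ih (fun z hz w hw p => ?_) hb'
      have := hb z hz w hw (p.mapLe h₀.graph_le)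
      simpa using this
    · obtain ⟨hx, hy⟩ := h₀.mem_of_deleted x y hxy hb'
      rw [colour_eq h₁ hx, colour_eq h₁ hy]
      exact edge _ _ _ hb hx hy hxy

/-- The outcome of a complete sequence of slope steps is the unique extension of the initial
partial colouring whose gradation vector is minimum. -/
theorem eq_or_gradVector_lt [Fintype V] {G : SimpleGraph V} (h : SlopeSteps s t)
    (ht : t.coloured = Set.univ) (hG : s.graph ≤ G)
    (hs : ∀ x y, G.Adj x y → ¬ s.graph.Adj x y → x ∈ s.coloured ∧ y ∈ s.coloured)
    {f : V → ℝ} (hf : ∀ x ∈ s.coloured, f x = s.colour x) :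
    f = t.colour ∨ gradVector G t.colour < gradVector G f := by
  induction h using Relation.ReflTransGen.head_induction_on with
  | refl => exact Or.inl (funext fun x => hf x (ht ▸ Set.mem_univ _))
  | @head a b h₀ h₁ ih =>
    obtain ⟨M, h₀⟩ := h₀
    by_cases hb : ∀ x ∈ b.coloured, f x = b.colour x
    · refine ih (h₀.graph_le.trans hG) (fun x y hxy hb' => ?_) hb
      by_cases ha : a.graph.Adj x y
      · exact h₀.mem_of_deleted x y ha hb'
      · exact (hs x y hxy ha).imp (@h₀.subset x) (@h₀.subset y)
    · right
      push Not at hb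
      obtain ⟨w, hw, hne⟩ := hb
      -- If no edge were steeper than `M`, the walk from u to w would bound f w from above and the
      -- walk from w to v would bound it from below, both by the colour that the step assigns to w.
      have hsteep : ∃ x y, a.graph.Adj x y ∧ M < |f x - f y| := by
        by_contra! hcon
        have walk_le : ∀ (x y : V) (p : a.graph.Walk x y), f y - f x ≤ M * p.length := by
          intro x y p
          induction p with
          | nil => simp
          | @cons u v w huv p ih =>
            have := (abs_le.1 (hcon u v huv)).1
            rw [SimpleGraph.Walk.length_cons]
            push_cast
            linarith
        obtain ⟨u, hu, v, hv, p, q, e₁, e₂⟩ := h₀.exists_walks w hw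
        have h1 := walk_le _ _ p
        have h2 := walk_le _ _ q
        rw [hf u hu] at h1
        rw [hf v hv] at h2
        exact hne (by linarith)
      obtain ⟨x, y, hxy, hM⟩ := hsteep
      refine gradVector_lt_gradVector hG (M := M) (fun x y hxy hn => ?_) (fun x y hxy => ?_) hxy hM
      · obtain ⟨hx, hy⟩ := hs x y hxy hn
        rw [hf x hx, hf y hy, colour_eq h₁ (h₀.subset hx), colour_eq h₁ (h₀.subset hy),
          h₀.colour_eq hx, h₀.colour_eq hy]
      · exact abs_sub_le (Relation.ReflTransGen.head ⟨M, h₀⟩ h₁) ht h₀.lipschitz hxy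

/-- Two complete sequences of slope steps that start from the same partial colouring have the same
outcome. -/
theorem colour_eq_colour [Fintype V] {G : SimpleGraph V} {s' t' : CCMState V}
    (h : SlopeSteps s t) (ht : t.coloured = Set.univ) (hG : s.graph ≤ G)
    (hs : ∀ x y, G.Adj x y → ¬ s.graph.Adj x y → x ∈ s.coloured ∧ y ∈ s.coloured)
    (h' : SlopeSteps s' t') (ht' : t'.coloured = Set.univ) (hG' : s'.graph ≤ G)
    (hs' : ∀ x y, G.Adj x y → ¬ s'.graph.Adj x y → x ∈ s'.coloured ∧ y ∈ s'.coloured)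
    (hc : s'.coloured = s.coloured) (hcol : ∀ x ∈ s.coloured, s'.colour x = s.colour x) :
    t'.colour = t.colour := by
  -- Each outcome extends the initial colouring of the other run. Were they different, each
  -- gradation vector would be strictly below the other.
  have h₁ := h.eq_or_gradVector_lt ht hG hs (f := t'.colour) fun x hx => by
    rw [colour_eq h' (hc ▸ hx), hcol x hx]
  have h₂ := h'.eq_or_gradVector_lt ht' hG' hs' (f := t.colour) fun x hx => by
    rw [colour_eq h (hc ▸ hx), hcol x (hc ▸ hx)]
  rcases h₁ with h₁ | h₁
  · exact h₁
  · rcases h₂ with h₂ | h₂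
    · exact h₂.symm
    · exact absurd (h₁.trans h₂) (lt_irrefl _)

end SlopeSteps

/-! ### Iterations of the procedure as slope steps -/

namespace CCMState

variable {V : Type*} {s s' s'' : CCMState V} {M : ℝ}

/-- A geodesic cut at one of its vertices falls into two geodesics, since a shortcut in either half
would shorten the whole. Distances are measured from w, as in `newColour`. -/
theorem mem_geodesicSet_iff {u v w : V} : w ∈ s.geodesicSet u v ↔
    ∃ (p : s.graph.Walk u w) (q : s.graph.Walk w v), p.length = s.graph.dist w u ∧
      q.length = s.graph.dist w v ∧ p.length + q.length = s.graph.dist u v := by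
  classical
  constructor
  · rintro ⟨p, hp, hw⟩
    have hl := congrArg SimpleGraph.Walk.length (p.take_spec hw)
    rw [SimpleGraph.Walk.length_append] at hl
    refine ⟨p.takeUntil w hw, p.dropUntil w hw, ?_, ?_, hl.trans hp⟩
    · obtain ⟨q, hq⟩ := (p.takeUntil w hw).reachable.symm.exists_walk_length_eq_dist
      have h₁ := SimpleGraph.dist_le (q.reverse.append (p.dropUntil w hw))
      have h₂ := SimpleGraph.dist_le (p.takeUntil w hw).reverse
      simp only [SimpleGraph.Walk.length_append, SimpleGraph.Walk.length_reverse] at h₁ h₂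
      omega
    · obtain ⟨q, hq⟩ := (p.dropUntil w hw).reachable.exists_walk_length_eq_dist
      have h₁ := SimpleGraph.dist_le ((p.takeUntil w hw).append q)
      have h₂ := SimpleGraph.dist_le (p.dropUntil w hw)
      simp only [SimpleGraph.Walk.length_append] at h₁
      omega
  · rintro ⟨p, q, -, -, h⟩
    exact ⟨p.append q, by rw [SimpleGraph.Walk.length_append, h], by simp⟩

theorem IsMaxIncrease.nonneg (h : s.IsMaxIncrease M) : 0 ≤ M := by
  obtain ⟨u, v, -, rfl⟩ := h.1
  exact div_nonneg (abs_nonneg _) (Nat.cast_nonneg _)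

/-- Maximality bounds the increase per unit of distance, and a walk is at least as long as the
distance of its ends. -/
theorem IsMaxIncrease.walkLipschitz (h : s.IsMaxIncrease M) :
    WalkLipschitz s.graph s.coloured s.colour M := by
  intro x hx y hy p
  have hM := h.nonneg
  by_cases hxy : x = y
  · subst hxy
    simpa using mul_nonneg hM (Nat.cast_nonneg _)
  · have hle : s.increase x y ≤ M := h.2 ⟨x, y, ⟨hx, hy, hxy, p.reachable⟩, rfl⟩
    have hd : (0 : ℝ) < s.graph.dist x y := by
      exact_mod_cast p.reachable.pos_dist_of_ne hxy
    rw [increase, div_le_iff₀ hd] at hle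
    have hp : (s.graph.dist x y : ℝ) ≤ p.length := by exact_mod_cast SimpleGraph.dist_le p
    have := neg_abs_le (s.colour x - s.colour y)
    nlinarith

/-- A vertex on a geodesic of maximum slope lies on walks on which the colour has that slope. -/
theorem exists_walks_newColour {u v w : V} (hp : s.IsPair u v) (hM : s.increase u v = M)
    (hw : w ∈ s.geodesicSet u v) : ∃ a ∈ s.coloured, ∃ b ∈ s.coloured,
      ∃ (p : s.graph.Walk a w) (q : s.graph.Walk w b),
        s.newColour M u v w = s.colour a + M * p.length ∧
        s.newColour M u v w + M * q.length = s.colour b := by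
  obtain ⟨p, q, h₁, h₂, h₃⟩ := mem_geodesicSet_iff.1 hw
  have hd : (0 : ℝ) < s.graph.dist u v := by
    exact_mod_cast hp.2.2.2.pos_dist_of_ne hp.2.2.1
  rw [increase, div_eq_iff hd.ne'] at hM
  have h₃' : (p.length : ℝ) + q.length = s.graph.dist u v := by exact_mod_cast h₃
  rw [newColour, ← h₁, ← h₂]
  rw [← h₃'] at hM
  split_ifs with huv
  · refine ⟨u, hp.1, v, hp.2.1, p, q, by ring, ?_⟩
    rw [abs_of_nonpos (by linarith)] at hM
    linarith
  · refine ⟨v, hp.2.1, u, hp.1, q.reverse, p.reverse, ?_, ?_⟩ <;>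
      rw [SimpleGraph.Walk.length_reverse]
    · ring
    · rw [abs_of_nonneg (by linarith)] at hM
      linarith

/-- Vertices on steepest geodesics use the two halves of such a geodesic. Vertices coloured before
and on none of them are served by empty walks. -/
theorem GeodesicStep.slopeStep (h : GeodesicStep s s' M) : SlopeStep s s' M where
  nonneg := h.isMax.nonneg
  lipschitz := h.isMax.walkLipschitz
  subset := by rw [h.coloured_eq]; exact Set.subset_union_left
  exists_walks w hw := by
    by_cases hn : ∃ u v, s.IsPair u v ∧ s.increase u v = M ∧ w ∈ s.geodesicSet u v
    · obtain ⟨u, v, hp, hM, hw⟩ := hn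
      rw [h.colour_new u v w hp hM hw]
      exact exists_walks_newColour hp hM hw
    · rw [h.coloured_eq] at hw
      have hw := hw.resolve_right hn
      exact ⟨w, hw, w, hw, .nil, .nil, by simp [h.colour_old w hn], by simp [h.colour_old w hn]⟩
  graph_le := by rw [h.graph_eq]; exact SimpleGraph.deleteEdges_le _
  mem_of_deleted x y hxy hn := by
    rw [h.graph_eq, SimpleGraph.deleteEdges_adj, not_and, not_not] at hn
    obtain ⟨u, v, hp, hM, a, ha, b, hb, he⟩ := hn hxy
    rw [h.coloured_eq]
    rcases Sym2.eq_iff.1 he with ⟨rfl, rfl⟩ | ⟨rfl, rfl⟩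
    · exact ⟨Or.inr ⟨u, v, hp, hM, ha⟩, Or.inr ⟨u, v, hp, hM, hb⟩⟩
    · exact ⟨Or.inr ⟨u, v, hp, hM, hb⟩, Or.inr ⟨u, v, hp, hM, ha⟩⟩

/-- Slope 0 fits because no walk joins distinct coloured vertices. The required walk goes from the
coloured vertex of the component to w and back. -/
theorem TerminalStep.slopeStep (h : TerminalStep s s') : SlopeStep s s' 0 where
  nonneg := le_rfl
  lipschitz x hx y hy p := by
    have : x = y := by
      by_contra hxy
      exact h.no_pair x y ⟨hx, hy, hxy, p.reachable⟩
    simp [this]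
  subset := by rw [h.coloured_eq]; exact Set.subset_union_left
  exists_walks w hw := by
    by_cases hn : w ∈ s.graph.support
    · obtain ⟨c, hc, ⟨p⟩, h₂⟩ := h.colour_new w hn
      exact ⟨c, hc, c, hc, p, p.reverse, by simp [h₂], by simp [h₂]⟩
    · rw [h.coloured_eq] at hw
      have hw := hw.resolve_right hn
      exact ⟨w, hw, w, hw, .nil, .nil, by simp [h.colour_old w hn], by simp [h.colour_old w hn]⟩
  graph_le := h.graph_eq.le
  mem_of_deleted x y hxy hn := absurd (h.graph_eq ▸ hxy) hn

theorem Step.slopeStep (h : Step s s') : ∃ M, SlopeStep s s' M := by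
  rcases h.2 with ⟨M, h⟩ | h
  · exact ⟨M, h.slopeStep⟩
  · exact ⟨0, h.slopeStep⟩

theorem slopeSteps_of_steps (h : Relation.ReflTransGen Step s s') : SlopeSteps s s' :=
  Relation.ReflTransGen.mono (fun _ _ h => h.slopeStep) _ _ h

/-! ## Existence of a complete run -/

/-- Two pairs of maximum increase give the same colour to the vertices on geodesics of both. -/
theorem newColour_eq_newColour (hmax : s.IsMaxIncrease M) {u v u' v' w : V}
    (hp : s.IsPair u v) (hM : s.increase u v = M) (hw : w ∈ s.geodesicSet u v)
    (hp' : s.IsPair u' v') (hM' : s.increase u' v' = M) (hw' : w ∈ s.geodesicSet u' v') :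
    s.newColour M u v w = s.newColour M u' v' w := by
  obtain ⟨a, ha, b, hb, p, q, h₁, h₂⟩ := exists_walks_newColour hp hM hw
  obtain ⟨a', ha', b', hb', p', q', h₁', h₂'⟩ := exists_walks_newColour hp' hM' hw'
  -- Two walks of slope `M` cross at w. Exchanging their second halves gives two walks between
  -- coloured vertices, and each yields one of the two inequalities.
  have h₃ := hmax.walkLipschitz a ha b' hb' (p.append q')
  have h₄ := hmax.walkLipschitz a' ha' b hb (p'.append q)
  simp only [SimpleGraph.Walk.length_append] at h₃ h₄
  push_cast at h₃ h₄
  apply le_antisymm <;> linarith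

theorem exists_geodesicStep [Finite V] (h : ∃ u v, s.IsPair u v) :
    ∃ s' M, GeodesicStep s s' M := by
  classical
  obtain ⟨M, hM⟩ : ∃ M, s.IsMaxIncrease M := by
    have hfin : {x : ℝ | ∃ u v, s.IsPair u v ∧ x = s.increase u v}.Finite :=
      (Set.finite_range fun p : V × V => s.increase p.1 p.2).subset
        (by rintro x ⟨u, v, -, rfl⟩; exact ⟨(u, v), rfl⟩)
    obtain ⟨u, v, huv⟩ := h
    obtain ⟨M, hM, hM'⟩ := Set.exists_max_image _ id hfin ⟨_, u, v, huv, rfl⟩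
    exact ⟨M, hM, fun x hx => hM' x hx⟩
  refine ⟨⟨s.graph.deleteEdges {e | ∃ u v, s.IsPair u v ∧ s.increase u v = M ∧
      ∃ w₁ ∈ s.geodesicSet u v, ∃ w₂ ∈ s.geodesicSet u v, e = s(w₁, w₂)},
    s.coloured ∪ {w | ∃ u v, s.IsPair u v ∧ s.increase u v = M ∧ w ∈ s.geodesicSet u v},
    fun w => if h : ∃ e : V × V, s.IsPair e.1 e.2 ∧ s.increase e.1 e.2 = M ∧
        w ∈ s.geodesicSet e.1 e.2 then s.newColour M h.choose.1 h.choose.2 w else s.colour w⟩,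
    M, hM, rfl, ?_, ?_, rfl⟩
  · intro u v w hp hpM hw
    have h : ∃ e : V × V, s.IsPair e.1 e.2 ∧ s.increase e.1 e.2 = M ∧
        w ∈ s.geodesicSet e.1 e.2 := ⟨(u, v), hp, hpM, hw⟩
    simp only [dif_pos h]
    obtain ⟨h₁, h₂, h₃⟩ := h.choose_spec
    exact newColour_eq_newColour hM h₁ h₂ h₃ hp hpM hw
  · intro w hw
    refine dif_neg ?_
    rintro ⟨⟨u, v⟩, h⟩
    exact hw ⟨u, v, h⟩

/-- The first edge of a geodesic of a maximising pair joins two vertices of its geodesic set and is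
deleted. This is the termination measure of the procedure. -/
theorem GeodesicStep.graph_lt (h : GeodesicStep s s' M) : s'.graph < s.graph := by
  refine lt_of_le_of_ne h.slopeStep.graph_le fun heq => ?_
  obtain ⟨u, v, hp, hM⟩ := h.isMax.1
  obtain ⟨p, hl⟩ := hp.2.2.2.exists_walk_length_eq_dist
  cases p with
  | nil => exact hp.2.2.1 rfl
  | @cons _ x _ hux p =>
    have hux' := hux
    rw [← heq, h.graph_eq, SimpleGraph.deleteEdges_adj] at hux'
    refine hux'.2 ⟨u, v, hp, hM.symm, u, ⟨_, hl, by simp⟩, x, ⟨_, hl, ?_⟩, rfl⟩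
    simp

theorem exists_terminalStep (h : ∀ u v, ¬ s.IsPair u v)
    (hr : ∀ w, ∃ c ∈ s.coloured, s.graph.Reachable c w) :
    ∃ s', TerminalStep s s' ∧ s'.coloured = Set.univ := by
  classical
  choose c hc hcw using hr
  refine ⟨⟨s.graph, s.coloured ∪ s.graph.support,
    fun w => if w ∈ s.graph.support then s.colour (c w) else s.colour w⟩,
    ⟨h, rfl, fun w hw => ⟨c w, hc w, hcw w, if_pos hw⟩, fun w hw => if_neg hw, rfl⟩, ?_⟩
  refine Set.eq_univ_of_forall fun w => ?_
  -- A vertex reached from a coloured vertex other than itself has an incident edge. An isolated one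
  -- therefore is coloured already, which justifies removing it.
  by_cases hw : c w = w
  · exact Or.inl (hw ▸ hc w)
  · right
    obtain ⟨p⟩ := (hcw w).symm
    generalize c w = d at hw p
    cases p with
    | nil => exact absurd rfl hw
    | cons h _ => exact ⟨_, h⟩

/-- On a walk of `G` towards a coloured vertex, no edge before the first coloured vertex is missing,
because missing edges have both ends coloured. -/
theorem exists_reachable_coloured {G : SimpleGraph V} (hG : G.Connected)
    (hC : s.coloured.Nonempty)
    (hs : ∀ x y, G.Adj x y → ¬ s.graph.Adj x y → x ∈ s.coloured ∧ y ∈ s.coloured) (w : V) :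
    ∃ c ∈ s.coloured, s.graph.Reachable c w := by
  obtain ⟨x, hx⟩ := hC
  obtain ⟨p⟩ := hG.preconnected w x
  induction p with
  | nil => exact ⟨_, hx, .refl _⟩
  | @cons a b _ hab p ih =>
    by_cases ha : a ∈ s.coloured
    · exact ⟨a, ha, .refl _⟩
    · obtain ⟨c, hc, hcb⟩ := ih hx
      have : s.graph.Adj a b := by
        by_contra hn
        exact ha (hs a b hab hn).1
      exact ⟨c, hc, hcb.trans this.symm.reachable⟩

theorem exists_steps [Finite V] {G : SimpleGraph V} (hG : G.Connected) :
    ∀ s : CCMState V, s.coloured.Nonempty →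
      (∀ x y, G.Adj x y → ¬ s.graph.Adj x y → x ∈ s.coloured ∧ y ∈ s.coloured) →
      ∃ t, Relation.ReflTransGen Step s t ∧ t.coloured = Set.univ := by
  have wf : WellFounded fun s t : CCMState V => s.graph < t.graph :=
    InvImage.wf CCMState.graph wellFounded_lt
  intro s
  induction s using wf.induction with
  | h s ih =>
  intro hC hs
  by_cases hu : s.coloured = Set.univ
  · exact ⟨s, .refl, hu⟩
  by_cases hp : ∃ u v, s.IsPair u v
  · obtain ⟨s', M, h⟩ := exists_geodesicStep hp
    obtain ⟨t, ht, ht'⟩ := ih s' h.graph_lt (hC.mono h.slopeStep.subset) fun x y hxy hn => by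
      by_cases hxy' : s.graph.Adj x y
      · exact h.slopeStep.mem_of_deleted x y hxy' hn
      · exact (hs x y hxy hxy').imp (@h.slopeStep.subset x) (@h.slopeStep.subset y)
    exact ⟨t, .head ⟨hu, Or.inl ⟨M, h⟩⟩ ht, ht'⟩
  · push Not at hp
    obtain ⟨t, h, ht⟩ := exists_terminalStep hp (exists_reachable_coloured hG hC hs)
    exact ⟨t, .single ⟨hu, Or.inr h⟩, ht⟩

end CCMState

/-! ### Outcomes for pairs of vertices and minimum gradation greyscales -/

section Outputs

variable {V : Type*} {G : SimpleGraph V} {u v : V}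

theorem exists_ccmPairOutputs [Finite V] (hG : G.Connected) (u v : V) :
    ∃ f, CCMPairOutputs G u v f := by
  classical
  obtain ⟨t, h, ht⟩ := CCMState.exists_steps hG ⟨G, {u, v}, fun w => if w = v then 1 else 0⟩
    ⟨u, by simp⟩ fun x y h hn => absurd h hn
  refine ⟨t.colour, t, ?_, ht, rfl⟩
  convert h

/-- The outcome of the procedure is the outcome of every complete sequence of slope steps that
starts from the same partial colouring. -/
theorem CCMPairOutputs.eq_colour [Fintype V] {f : V → ℝ} (hf : CCMPairOutputs G u v f)
    {s t : CCMState V} (h : SlopeSteps s t) (ht : t.coloured = Set.univ) (hG : s.graph ≤ G)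
    (hs : ∀ x y, G.Adj x y → ¬ s.graph.Adj x y → x ∈ s.coloured ∧ y ∈ s.coloured)
    (hC : s.coloured = {u, v}) (hu : u ≠ v) (hsu : s.colour u = 0) (hsv : s.colour v = 1) :
    f = t.colour := by
  obtain ⟨t', h', ht', rfl⟩ := hf
  refine h.colour_eq_colour ht hG hs (CCMState.slopeSteps_of_steps h') ht' le_rfl
    (fun x y h hn => absurd h hn) hC.symm fun x hx => ?_
  rw [hC] at hx
  rcases hx with rfl | rfl
  · simp [hu, hsu]
  · simp [hsv]

theorem CCMPairOutputs.unique [Fintype V] (hu : u ≠ v) {f g : V → ℝ}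
    (hf : CCMPairOutputs G u v f) (hg : CCMPairOutputs G u v g) : f = g := by
  obtain ⟨t, h, ht, rfl⟩ := hg
  exact hf.eq_colour (CCMState.slopeSteps_of_steps h) ht le_rfl (fun x y h hn => absurd h hn) rfl
    hu (by simp [hu]) (by simp)

theorem CCMPairOutputs.apply_left (hu : u ≠ v) {f : V → ℝ} (hf : CCMPairOutputs G u v f) :
    f u = 0 := by
  obtain ⟨t, h, ht, rfl⟩ := hf
  rw [(CCMState.slopeSteps_of_steps h).colour_eq (by simp)]
  simp [hu]

theorem CCMPairOutputs.apply_right {f : V → ℝ} (hf : CCMPairOutputs G u v f) :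
    f v = 1 := by
  obtain ⟨t, h, ht, rfl⟩ := hf
  rw [(CCMState.slopeSteps_of_steps h).colour_eq (by simp)]
  simp

theorem CCMPairOutputs.isGreyscale (hu : u ≠ v) {f : V → ℝ} (hf : CCMPairOutputs G u v f) :
    IsGreyscale f := by
  refine ⟨fun w => ?_, ⟨u, hf.apply_left hu⟩, ⟨v, hf.apply_right⟩⟩
  obtain ⟨t, h, ht, rfl⟩ := hf
  refine (CCMState.slopeSteps_of_steps h).mem_Icc (fun w _ => ?_) w (ht ▸ Set.mem_univ w)
  classical
  change (if w = v then (1 : ℝ) else 0) ∈ _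
  split_ifs <;> simp

theorem CCMPairOutputs.eq_or_gradVector_lt [Fintype V] (hu : u ≠ v) {f : V → ℝ}
    (hf : CCMPairOutputs G u v f) {h : V → ℝ} (h0 : h u = 0) (h1 : h v = 1) :
    h = f ∨ gradVector G f < gradVector G h := by
  obtain ⟨t, ht, htu, rfl⟩ := hf
  refine (CCMState.slopeSteps_of_steps ht).eq_or_gradVector_lt htu le_rfl
    (fun x y h hn => absurd h hn) fun x hx => ?_
  rcases hx with rfl | rfl
  · simp [hu, h0]
  · simp [h1]

theorem IsGreyscale.exists_pair {f : V → ℝ} (hf : IsGreyscale f) :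
    ∃ u v, u ≠ v ∧ f u = 0 ∧ f v = 1 := by
  obtain ⟨u, hu⟩ := hf.exists_zero
  obtain ⟨v, hv⟩ := hf.exists_one
  exact ⟨u, v, by rintro rfl; simp [hu] at hv, hu, hv⟩

/-- The vector `γ` is the least gradation vector of an outcome of the procedure. -/
def IsMinPairVector [Fintype V] (G : SimpleGraph V) (γ : List ℝ) : Prop :=
  IsLeast {x : List ℝ | ∃ u v : V, u ≠ v ∧ ∃ f : V → ℝ, CCMPairOutputs G u v f ∧
    x = gradVector G f} γ

/-- A greyscale competes with the outcome for a pair at which it takes the values 0 and 1, so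
minimising over the finitely many outcomes suffices. -/
theorem IsMinPairVector.isMinGradationVector [Fintype V] (hG : G.Connected) {γ : List ℝ}
    (hγ : IsMinPairVector G γ) : IsMinGradationVector G γ := by
  refine ⟨?_, ?_⟩
  · obtain ⟨u, v, hu, f, hf, rfl⟩ := hγ.1
    exact ⟨f, hf.isGreyscale hu, rfl⟩
  · rintro _ ⟨h, hh, rfl⟩
    obtain ⟨u, v, hu, h0, h1⟩ := hh.exists_pair
    obtain ⟨f, hf⟩ := exists_ccmPairOutputs hG u v
    refine (hγ.2 ⟨u, v, hu, f, hf, rfl⟩).trans ?_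
    rcases hf.eq_or_gradVector_lt hu h0 h1 with rfl | hlt
    · exact le_rfl
    · exact hlt.le

/-- The strictness in `CCMPairOutputs.eq_or_gradVector_lt` is what excludes minimum greyscales that
are not outcomes. -/
theorem IsMinPairVector.isMinGradationGreyscale_iff [Fintype V] (hG : G.Connected) {γ : List ℝ}
    (hγ : IsMinPairVector G γ) {f : V → ℝ} : IsMinGradationGreyscale G f ↔
      (∃ u v : V, u ≠ v ∧ CCMPairOutputs G u v f) ∧ gradVector G f = γ := by
  have hmin := hγ.isMinGradationVector hG
  constructor
  · rintro ⟨hf, hle⟩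
    obtain ⟨g, hg, rfl⟩ := hmin.1
    refine ⟨?_, le_antisymm (hle g hg) (hmin.2 ⟨f, hf, rfl⟩)⟩
    obtain ⟨u, v, hu, h0, h1⟩ := hf.exists_pair
    obtain ⟨f', hf'⟩ := exists_ccmPairOutputs hG u v
    rcases hf'.eq_or_gradVector_lt hu h0 h1 with rfl | hlt
    · exact ⟨u, v, hu, hf'⟩
    · exact absurd (hle f' (hf'.isGreyscale hu)) (not_le.2 hlt)
  · rintro ⟨⟨u, v, hu, hf⟩, rfl⟩
    exact ⟨hf.isGreyscale hu, fun h hh => hmin.2 ⟨h, hh, rfl⟩⟩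

theorem exists_isMinPairVector [Fintype V] [Nontrivial V] (hG : G.Connected) :
    ∃ γ, IsMinPairVector G γ := by
  choose f hf using fun u v => exists_ccmPairOutputs hG u v
  obtain ⟨a, b, hab⟩ := exists_pair_ne V
  obtain ⟨⟨u, v⟩, hu, hmin⟩ := Set.exists_min_image {e : V × V | e.1 ≠ e.2}
    (fun e => gradVector G (f e.1 e.2)) (Set.toFinite _) ⟨(a, b), hab⟩
  refine ⟨gradVector G (f u v), ⟨u, v, hu, f u v, hf u v, rfl⟩, ?_⟩
  rintro _ ⟨u', v', hu', g, hg, rfl⟩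
  rw [hg.unique hu' (hf u' v')]
  exact hmin (u', v') hu'

end Outputs

/-! ## A language with bounded loops on top of the machine -/

namespace Memory

/-- The memory after writing `v` to register `x`. -/
def setReg (m : Memory) (x v : ℕ) : Memory := ⟨Function.update m.reg x v, m.arr⟩

/-- The memory after writing `v` to cell `i` of the array `a`. -/
def setCell (m : Memory) (a i v : ℕ) : Memory :=
  ⟨m.reg, Function.update m.arr a (Function.update (m.arr a) i v)⟩

@[simp] theorem setReg_reg (m : Memory) (x v y : ℕ) :
    (m.setReg x v).reg y = if y = x then v else m.reg y := Function.update_apply _ _ _ _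

@[simp] theorem setReg_arr (m : Memory) (x v : ℕ) : (m.setReg x v).arr = m.arr := rfl

@[simp] theorem setCell_reg (m : Memory) (a i v : ℕ) : (m.setCell a i v).reg = m.reg := rfl

@[simp] theorem setCell_arr (m : Memory) (a i v b : ℕ) :
    (m.setCell a i v).arr b = if b = a then Function.update (m.arr a) i v else m.arr b :=
  Function.update_apply _ _ _ _

end Memory

namespace AExp

instance : Add AExp := ⟨AExp.add⟩
instance : Sub AExp := ⟨AExp.sub⟩
instance (c : ℕ) : OfNat AExp c := ⟨AExp.const c⟩

@[simp] theorem eval_reg (m : Memory) (x : ℕ) : (AExp.reg x).eval m = m.reg x := rfl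
@[simp] theorem eval_cell (m : Memory) (a : ℕ) (i : AExp) :
    (AExp.cell a i).eval m = m.arr a (i.eval m) := rfl
@[simp] theorem eval_add (m : Memory) (e f : AExp) : (e + f).eval m = e.eval m + f.eval m := rfl
@[simp] theorem eval_sub (m : Memory) (e f : AExp) : (e - f).eval m = e.eval m - f.eval m := rfl
@[simp] theorem eval_zero (m : Memory) : (0 : AExp).eval m = 0 := rfl
@[simp] theorem eval_one (m : Memory) : (1 : AExp).eval m = 1 := rfl
@[simp] theorem eval_two (m : Memory) : (2 : AExp).eval m = 2 := rfl

end AExp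

/-- Commands: straight-line code, tests, and loops in which a register `x` runs from `0` to the
value of a register `b`. -/
inductive Cmd where
  | skip
  | assign (x : ℕ) (e : AExp)
  | store (a : ℕ) (i e : AExp)
  | seq (c d : Cmd)
  | ite (e : AExp) (c d : Cmd)
  | loop (x b : ℕ) (c : Cmd)

namespace Cmd

infixr:60 " ;; " => Cmd.seq

/-- Run `c` if `e` is nonzero. -/
def when (e : AExp) (c : Cmd) : Cmd := .ite e c .skip

/-- The memory after running a command. -/
def run : Cmd → Memory → Memory
  | .skip, m => m
  | .assign x e, m => m.setReg x (e.eval m)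
  | .store a i e, m => m.setCell a (i.eval m) (e.eval m)
  | .seq c d, m => d.run (c.run m)
  | .ite e c d, m => if e.eval m = 0 then d.run m else c.run m
  | .loop x b c, m =>
    Nat.rec (m.setReg x 0) (fun i m' => (c.run m').setReg x (i + 1)) (m.reg b)

/-- The program that carries out a command. -/
def compile : Cmd → Program
  | .skip => .skip
  | .assign x e => .assign x e
  | .store a i e => .store a i e
  | .seq c d => .seq c.compile d.compile
  | .ite e c d => .branch e c.compile d.compile
  | .loop x b c => .seq (.assign x (.const 0)) (.loop (.sub (.reg b) (.reg x))
      (.seq c.compile (.assign x (.add (.reg x) (.const 1)))))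

/-- A bound for the running time in terms of a bound for the loop bounds. -/
noncomputable def cost : Cmd → Polynomial ℕ
  | .skip => 1
  | .assign _ e => .C (e.cost + 1)
  | .store _ i e => .C (i.cost + e.cost + 1)
  | .seq c d => c.cost + d.cost
  | .ite e c d => .C (e.cost + 1) + c.cost + d.cost
  | .loop _ _ c => .C 6 + .X * (.C 8 + c.cost)

/-- Whether the command may write to register `y`. -/
def writesReg (y : ℕ) : Cmd → Bool
  | .skip => false
  | .assign x _ => y == x
  | .store _ _ _ => false
  | .seq c d => c.writesReg y || d.writesReg y
  | .ite _ c d => c.writesReg y || d.writesReg y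
  | .loop x _ c => y == x || c.writesReg y

/-- Whether the command may write to the array `b`. -/
def writesArr (b : ℕ) : Cmd → Bool
  | .skip => false
  | .assign _ _ => false
  | .store a _ _ => b == a
  | .seq c d => c.writesArr b || d.writesArr b
  | .ite _ c d => c.writesArr b || d.writesArr b
  | .loop _ _ c => c.writesArr b

/-- All loops are bounded by registers from the list `S`, which the command does not write to, and
loop bodies do not write to the loop register. -/
def wellFormed (S : List ℕ) : Cmd → Bool
  | .skip => true
  | .assign x _ => !S.elem x
  | .store _ _ _ => true
  | .seq c d => c.wellFormed S && d.wellFormed S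
  | .ite _ c d => c.wellFormed S && d.wellFormed S
  | .loop x b c => S.elem b && !S.elem x && !c.writesReg x && c.wellFormed S

/-! ### Syntactic write sets and the cost of compiled commands -/

theorem run_reg (c : Cmd) (m : Memory) (y : ℕ) (h : c.writesReg y = false := by rfl) :
    (c.run m).reg y = m.reg y := by
  induction c generalizing m with
  | skip => rfl
  | assign x e =>
    simp only [writesReg, beq_eq_false_iff_ne] at h
    simp [run, h]
  | store => rfl
  | seq c d ihc ihd =>
    simp only [writesReg, Bool.or_eq_false_iff] at h
    rw [run, ihd _ h.2, ihc _ h.1]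
  | ite e c d ihc ihd =>
    simp only [writesReg, Bool.or_eq_false_iff] at h
    rw [run]
    split_ifs
    · exact ihd m h.2
    · exact ihc m h.1
  | loop x b c ih =>
    simp only [writesReg, Bool.or_eq_false_iff, beq_eq_false_iff_ne] at h
    rw [run]
    generalize m.reg b = N
    induction N with
    | zero => simp [h.1]
    | succ N ihN => simp [h.1, ih _ h.2, ihN]

theorem run_arr (c : Cmd) (m : Memory) (a : ℕ) (h : c.writesArr a = false := by rfl) :
    (c.run m).arr a = m.arr a := by
  induction c generalizing m with
  | skip => rfl
  | assign => rfl
  | store b i e =>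
    simp only [writesArr, beq_eq_false_iff_ne] at h
    simp [run, h]
  | seq c d ihc ihd =>
    simp only [writesArr, Bool.or_eq_false_iff] at h
    rw [run, ihd _ h.2, ihc _ h.1]
  | ite e c d ihc ihd =>
    simp only [writesArr, Bool.or_eq_false_iff] at h
    rw [run]
    split_ifs
    · exact ihd m h.2
    · exact ihc m h.1
  | loop x b c ih =>
    simp only [writesArr] at h
    rw [run]
    generalize m.reg b = N
    induction N with
    | zero => rfl
    | succ N ihN => simp [ih _ h, ihN]

theorem wellFormed.writesReg {S : List ℕ} {c : Cmd} (h : c.wellFormed S = true) {b : ℕ}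
    (hb : b ∈ S) : c.writesReg b = false := by
  induction c with
  | skip => rfl
  | assign x e =>
    simp only [wellFormed, Bool.not_eq_true', List.elem_eq_mem, decide_eq_false_iff_not] at h
    simp only [Cmd.writesReg, beq_eq_false_iff_ne]
    rintro rfl
    exact h hb
  | store => rfl
  | seq c d ihc ihd =>
    simp only [wellFormed, Bool.and_eq_true] at h
    simp [Cmd.writesReg, ihc h.1, ihd h.2]
  | ite e c d ihc ihd =>
    simp only [wellFormed, Bool.and_eq_true] at h
    simp [Cmd.writesReg, ihc h.1, ihd h.2]
  | loop x b c ih =>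
    simp only [wellFormed, Bool.and_eq_true, Bool.not_eq_true', List.elem_eq_mem,
      decide_eq_false_iff_not] at h
    simp only [Cmd.writesReg, ih h.2, Bool.or_false, beq_eq_false_iff_ne]
    rintro rfl
    exact h.1.1.2 hb

/-- The loop bounds lie in `S` and no command writes to `S`, so the bound `B` on the initial
registers controls every loop, however deeply nested. -/
theorem runs_compile {S : List ℕ} {B : ℕ} (c : Cmd) (hc : c.wellFormed S = true) (m : Memory)
    (hm : ∀ b ∈ S, m.reg b ≤ B) :
    ∃ t ≤ c.cost.eval B, Runs c.compile m t (c.run m) := by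
  induction c generalizing m with
  | skip => exact ⟨1, by simp [cost], .skip m⟩
  | assign x e => exact ⟨_, by simp [cost], .assign x e m⟩
  | store a i e => exact ⟨_, by simp [cost], .store a i e m⟩
  | seq c d ihc ihd =>
    simp only [wellFormed, Bool.and_eq_true] at hc
    obtain ⟨t, ht, h⟩ := ihc hc.1 m hm
    obtain ⟨t', ht', h'⟩ := ihd hc.2 (c.run m) fun b hb => by
      rw [run_reg c m b (wellFormed.writesReg hc.1 hb)]
      exact hm b hb
    exact ⟨t + t', by simpa [cost] using add_le_add ht ht', .seq h h'⟩
  | ite e c d ihc ihd =>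
    simp only [wellFormed, Bool.and_eq_true] at hc
    by_cases he : e.eval m = 0
    · obtain ⟨t, ht, h⟩ := ihd hc.2 m hm
      refine ⟨_, ?_, by rw [run, if_pos he]; exact .branch_false he h⟩
      simp only [cost, Polynomial.eval_add, Polynomial.eval_C]
      omega
    · obtain ⟨t, ht, h⟩ := ihc hc.1 m hm
      refine ⟨_, ?_, by rw [run, if_neg he]; exact .branch_true he h⟩
      simp only [cost, Polynomial.eval_add, Polynomial.eval_C]
      omega
  | loop x b c ih =>
    simp only [wellFormed, Bool.and_eq_true, Bool.not_eq_true', List.elem_eq_mem,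
      decide_eq_true_eq, decide_eq_false_iff_not] at hc
    obtain ⟨⟨⟨hb, hxS⟩, hx⟩, hc⟩ := hc
    have hS : ∀ {b}, b ∈ S → b ≠ x := fun h => ne_of_mem_of_not_mem h hxS
    set F : ℕ → Memory := fun N =>
      Nat.rec (m.setReg x 0) (fun i m' => (c.run m').setReg x (i + 1)) N with hF
    have hF0 : F 0 = m.setReg x 0 := rfl
    have hFs : ∀ i, F (i + 1) = (c.run (F i)).setReg x (i + 1) := fun i => rfl
    have hFx : ∀ i, (F i).reg x = i := by rintro (_ | i) <;> simp [hF0, hFs]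
    have hFS : ∀ i, ∀ b ∈ S, (F i).reg b = m.reg b := by
      intro i b hb
      induction i with
      | zero => simp [hF0, hS hb]
      | succ i ih' => simp [hFs, hS hb, run_reg c _ b (wellFormed.writesReg hc hb), ih']
    -- The last, failing test costs 4 steps. Each round costs 4 for the test and 4 for the
    -- increment, besides the body. With the 2 steps of the initial assignment this gives the
    -- constants 6 and 8 of `cost`.
    have key : ∀ k i, i + k = m.reg b → ∃ t ≤ 4 + k * (8 + c.cost.eval B),
        Runs (.loop (.sub (.reg b) (.reg x))
          (.seq c.compile (.assign x (.add (.reg x) (.const 1))))) (F i) t (F (m.reg b)) := by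
      intro k
      induction k with
      | zero =>
        intro i hi
        rw [add_zero] at hi
        subst hi
        refine ⟨4, by simp, ?_⟩
        refine Runs.loop_done (e := .sub (.reg b) (.reg x)) ?_
        simp [AExp.eval, hFx, hFS _ _ hb]
      | succ k ihk =>
        intro i hi
        obtain ⟨t, ht, h⟩ := ihk (i + 1) (by omega)
        obtain ⟨t', ht', h'⟩ := ih hc (F i) fun b hb => by
          rw [hFS i b hb]
          exact hm b hb
        have h₁ := Runs.assign x (.add (.reg x) (.const 1)) (c.run (F i))
        have h₂ : (⟨Function.update (c.run (F i)).reg x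
            (AExp.eval (c.run (F i)) (.add (.reg x) (.const 1))), (c.run (F i)).arr⟩ : Memory) =
            F (i + 1) := by
          rw [hFs, Memory.setReg]
          simp [AExp.eval, run_reg c _ x hx, hFx]
        rw [h₂] at h₁
        refine ⟨_, ?_, Runs.loop_next ?_ (.seq h' h₁) h⟩
        · simp only [AExp.cost]
          rw [add_mul]
          omega
        · simp only [AExp.eval, hFx, hFS _ _ hb]
          omega
    obtain ⟨t, ht, h⟩ := key (m.reg b) 0 (by omega)
    refine ⟨2 + t, ?_, ?_⟩
    · simp only [cost, Polynomial.eval_add, Polynomial.eval_mul, Polynomial.eval_X,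
        Polynomial.eval_C]
      have : m.reg b * (8 + c.cost.eval B) ≤ B * (8 + c.cost.eval B) :=
        Nat.mul_le_mul_right _ (hm b hb)
      omega
    · exact .seq (.assign x (.const 0) m) h

/-! ### Reasoning about loops -/

/-- The memory `m'` agrees with `m` except where `c` may write. -/
structure Frame (c : Cmd) (m m' : Memory) : Prop where
  reg : ∀ y, c.writesReg y = false → m'.reg y = m.reg y
  arr : ∀ a, c.writesArr a = false → m'.arr a = m.arr a

theorem frame_run (c : Cmd) (m : Memory) : c.Frame m (c.run m) :=
  ⟨fun y h => c.run_reg m y h, fun a h => c.run_arr m a h⟩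

/-- The frame condition accompanies the invariant, so `P` only has to speak of what the loop
changes. -/
theorem run_loop_induction {x b : ℕ} {c : Cmd} {m : Memory} (P : ℕ → Memory → Prop)
    (h0 : P 0 (m.setReg x 0))
    (hs : ∀ i < m.reg b, ∀ m', m'.reg x = i → (Cmd.loop x b c).Frame m m' → P i m' →
      P (i + 1) ((c.run m').setReg x (i + 1))) :
    P (m.reg b) ((Cmd.loop x b c).run m) := by
  rw [run]
  suffices ∀ N ≤ m.reg b, ∀ F, F = (Nat.rec (m.setReg x 0)
      (fun i m' => (c.run m').setReg x (i + 1)) N : Memory) →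
      F.reg x = N ∧ (Cmd.loop x b c).Frame m F ∧ P N F from (this _ le_rfl _ rfl).2.2
  intro N
  induction N with
  | zero =>
    rintro - F rfl
    refine ⟨by simp, ⟨fun y hy => ?_, fun a _ => rfl⟩, h0⟩
    simp only [writesReg, Bool.or_eq_false_iff, beq_eq_false_iff_ne] at hy
    simp [hy.1]
  | succ N ih =>
    rintro hN F rfl
    obtain ⟨h₁, h₂, h₃⟩ := ih (by omega) _ rfl
    refine ⟨by simp, ⟨fun y hy => ?_, fun a ha => ?_⟩, hs N (by omega) _ h₁ h₂ h₃⟩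
    · have hy' := hy
      simp only [writesReg, Bool.or_eq_false_iff, beq_eq_false_iff_ne] at hy
      simp only [Memory.setReg_reg, if_neg hy.1]
      rw [run_reg c _ y hy.2]
      exact h₂.reg y hy'
    · have ha' := ha
      rw [Memory.setReg_arr, run_arr c _ a ha]
      exact h₂.arr a ha'

@[simp] theorem run_assign (x : ℕ) (e : AExp) (m : Memory) :
    (Cmd.assign x e).run m = m.setReg x (e.eval m) := rfl
@[simp] theorem run_store (a : ℕ) (i e : AExp) (m : Memory) :
    (Cmd.store a i e).run m = m.setCell a (i.eval m) (e.eval m) := rfl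
@[simp] theorem run_seq (c d : Cmd) (m : Memory) : (c ;; d).run m = d.run (c.run m) := rfl
@[simp] theorem run_ite (e : AExp) (c d : Cmd) (m : Memory) :
    (Cmd.ite e c d).run m = if e.eval m = 0 then d.run m else c.run m := rfl
@[simp] theorem run_when (e : AExp) (c : Cmd) (m : Memory) :
    (when e c).run m = if e.eval m = 0 then m else c.run m := rfl

end Cmd

/-! ## Colouring one vertex at a time -/

section Greedy

variable {V : Type*}

/-- The graph `G` without the edges between two vertices of `C`. -/
def deleteInside (G : SimpleGraph V) (C : Set V) : SimpleGraph V where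
  Adj x y := G.Adj x y ∧ ¬ (x ∈ C ∧ y ∈ C)
  symm := ⟨fun _ _ h => ⟨h.1.symm, fun h' => h.2 h'.symm⟩⟩
  loopless := ⟨fun x h => G.loopless.irrefl x h.1⟩

/-- The state in which the vertices of `C` are coloured by fractions with denominator `Q`, and the
edges between them are deleted. -/
noncomputable def fracState (G : SimpleGraph V) (C : Set V) (c : V → ℕ) (Q : ℕ) : CCMState V :=
  ⟨deleteInside G C, C, fun x => (c x : ℝ) / Q⟩

theorem mem_of_not_deleteInside {G : SimpleGraph V} {C : Set V} {x y : V} (h : G.Adj x y)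
    (hn : ¬ (deleteInside G C).Adj x y) : x ∈ C ∧ y ∈ C := by
  by_contra hc
  exact hn ⟨h, hc⟩

/-- It suffices to test walks that leave `C` with their first edge and have fewer than `card V`
further edges: edges inside `C` are deleted, and replacing a walk by a path only shortens it. A walk
towards a smaller or equal colour needs no test, since the slope is nonnegative. -/
theorem walkLipschitz_fracState [Fintype V] {G : SimpleGraph V} {C : Set V} {c : V → ℕ} {Q D L : ℕ}
    (hQ : 0 < Q) (hL : 0 < L)
    (hdom : ∀ u ∈ C, ∀ v ∈ C, ∀ w ∉ C, G.Adj u w → ∀ q : (deleteInside G C).Walk w v,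
      q.length < Fintype.card V → c u ≤ c v → (c v - c u) * L ≤ D * (q.length + 1)) :
    WalkLipschitz (deleteInside G C) C (fun x => (c x : ℝ) / Q) ((D : ℝ) / (Q * L)) := by
  classical
  intro x hx y hy p
  have hQ' : (0 : ℝ) < Q := by exact_mod_cast hQ
  have hL' : (0 : ℝ) < L := by exact_mod_cast hL
  rw [← sub_div, div_mul_eq_mul_div, div_le_div_iff₀ hQ' (by positivity)]
  suffices h : ((c y : ℝ) - c x) * L ≤ D * p.length by nlinarith
  rcases le_total (c y) (c x) with hle | hle
  · have hle' : (c y : ℝ) ≤ c x := by exact_mod_cast hle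
    have h₁ : ((c y : ℝ) - c x) * L ≤ 0 :=
      mul_nonpos_of_nonpos_of_nonneg (by linarith) hL'.le
    exact h₁.trans (by positivity)
  · by_cases hxy : x = y
    · subst hxy
      rw [sub_self, zero_mul]
      positivity
    · have hp := p.bypass_isPath
      have hl := p.length_bypass_le_length
      have hc := hp.length_lt
      revert hl hc
      generalize p.bypass = q
      intro hl hc
      cases q with
      | nil => exact absurd rfl hxy
      | @cons _ w _ hxw q =>
        rw [SimpleGraph.Walk.length_cons] at hl hc
        have := hdom x hx y hy w (fun hw => hxw.2 ⟨hx, hw⟩) hxw.1 q (by omega) hle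
        have h₂ := this.trans (Nat.mul_le_mul_left D hl)
        rw [← Nat.cast_le (α := ℝ)] at h₂
        push_cast [Nat.cast_sub hle] at h₂
        exact h₂

/-- By `hdom` the walk from u through w to v is steepest, hence its slope is a Lipschitz constant.
Only its first vertex w is coloured. The factor `F` makes the increment `D` an integer. -/
theorem slopeStep_fracState [Fintype V] {G : SimpleGraph V} {C : Set V} {c c' : V → ℕ}
    {Q F D : ℕ} (hQ : 0 < Q) (hF : 0 < F) {u v w : V} (hu : u ∈ C) (hv : v ∈ C) (hw : w ∉ C)
    (huw : G.Adj u w) (q : (deleteInside G C).Walk w v) (huv : c u ≤ c v)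
    (hdom : ∀ u' ∈ C, ∀ v' ∈ C, ∀ w' ∉ C, G.Adj u' w' → ∀ q' : (deleteInside G C).Walk w' v',
      q'.length < Fintype.card V → c u' ≤ c v' →
        (c v' - c u') * (q.length + 1) ≤ (c v - c u) * (q'.length + 1))
    (hc : ∀ x ∈ C, c' x = c x * F) (hw' : c' w = c u * F + D)
    (hD : D * (q.length + 1) = (c v - c u) * F) :
    SlopeStep (fracState G C c Q) (fracState G (insert w C) c' (Q * F))
      (((c v - c u : ℕ) : ℝ) / (Q * (q.length + 1 : ℕ))) where
  nonneg := by positivity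
  lipschitz := walkLipschitz_fracState hQ (Nat.succ_pos _) hdom
  subset := Set.subset_insert _ _
  exists_walks x hx := by
    have hQ' : (Q : ℝ) ≠ 0 := by exact_mod_cast hQ.ne'
    have hF' : (F : ℝ) ≠ 0 := by exact_mod_cast hF.ne'
    by_cases hxC : x ∈ C
    · have : ((c' x : ℝ)) / ((Q * F : ℕ) : ℝ) = c x / Q := by
        rw [hc x hxC]
        push_cast
        rw [mul_div_mul_right _ _ hF']
      refine ⟨x, hxC, x, hxC, .nil, .nil, ?_, ?_⟩ <;> simpa [fracState] using this
    · obtain rfl : x = w := hx.resolve_right hxC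
      have huw' : (deleteInside G C).Adj u x := ⟨huw, fun h => hw h.2⟩
      have hl : (q.length : ℝ) + 1 ≠ 0 := by positivity
      have hD' : (D : ℝ) = (c v - c u) * F / (q.length + 1) := by
        rw [eq_div_iff hl]
        have := congrArg (Nat.cast (R := ℝ)) hD
        push_cast [Nat.cast_sub huv] at this
        exact this
      have key : (c' x : ℝ) / ((Q * F : ℕ) : ℝ) =
          c u / Q + (c v - c u) / (Q * (q.length + 1)) := by
        rw [hw']
        push_cast
        rw [hD']
        field_simp
      refine ⟨u, hu, v, hv, huw'.toWalk, q, ?_, ?_⟩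
      · simp only [fracState, key]
        push_cast [Nat.cast_sub huv]
        simp
      · simp only [fracState, key]
        push_cast [Nat.cast_sub huv]
        field_simp
        ring
  graph_le x y h := ⟨h.1, fun h' => h.2 ⟨Or.inr h'.1, Or.inr h'.2⟩⟩
  mem_of_deleted x y hxy hn := mem_of_not_deleteInside hxy.1 hn

theorem exists_adj_of_ne_univ {G : SimpleGraph V} (hG : G.Connected) {C : Set V}
    (hC : C.Nonempty) (hu : C ≠ Set.univ) : ∃ u ∈ C, ∃ w ∉ C, G.Adj u w := by
  obtain ⟨x, hx⟩ := hC
  obtain ⟨y, hy⟩ := (Set.ne_univ_iff_exists_notMem C).1 hu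
  obtain ⟨p⟩ := hG.preconnected x y
  induction p with
  | nil => exact absurd hx hy
  | @cons a b _ hab p ih =>
    by_cases hb : b ∈ C
    · exact ih hb hy
    · exact ⟨a, hx, b, hb, hab⟩

end Greedy

open Cmd

/-! ## Multiplication -/

/-- Register `43` becomes the product of the registers `40` and `41`. -/
def mulCmd : Cmd :=
  .assign 43 0 ;; .loop 42 0 (when (.reg 41 - .reg 42) (.assign 43 (.reg 43 + .reg 40)))

/-- The loop always runs as often as register `0` says and adds only in the first rounds. Hence the
second factor must be at most n, whereas the first may be huge. -/
theorem run_mulCmd (m : Memory) (h : m.reg 41 ≤ m.reg 0) :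
    (mulCmd.run m).reg 43 = m.reg 40 * m.reg 41 := by
  have key := run_loop_induction (x := 42) (b := 0)
    (c := when (.reg 41 - .reg 42) (.assign 43 (.reg 43 + .reg 40))) (m := m.setReg 43 0)
    (P := fun i m' => m'.reg 43 = m.reg 40 * min i (m.reg 41)) (by simp) ?_
  · simpa [mulCmd, h] using key
  · intro i hi m' hx hf hP
    have h40 : m'.reg 40 = m.reg 40 := by simpa using hf.reg 40 rfl
    have h41 : m'.reg 41 = m.reg 41 := by simpa using hf.reg 41 rfl
    by_cases hi' : m.reg 41 ≤ i
    · have : m.reg 41 - i = 0 := by omega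
      simp [hx, h41, this, hP, min_eq_right hi', min_eq_right (Nat.le_succ_of_le hi')]
    · have : m.reg 41 - i ≠ 0 := by omega
      have h₁ : min i (m.reg 41) = i := by omega
      have h₂ : min (i + 1) (m.reg 41) = i + 1 := by omega
      simp [hx, h41, this, hP, h40, h₁, h₂, mul_add]

/-- Register `44` is multiplied by `n!`. -/
def factCmd : Cmd :=
  .loop 25 0 (.assign 40 (.reg 44) ;; .assign 41 (.reg 25 + 1) ;; mulCmd ;;
    .assign 44 (.reg 43))

theorem run_factCmd (m : Memory) :
    (factCmd.run m).reg 44 = m.reg 44 * (m.reg 0).factorial := by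
  refine run_loop_induction (P := fun i m' => m'.reg 44 = m.reg 44 * i.factorial) (by simp) ?_
  intro i hi m' hx hf hP
  have h0 : m'.reg 0 = m.reg 0 := hf.reg 0 rfl
  simp only [run_seq, run_assign, Memory.setReg_reg]
  rw [AExp.eval_reg, run_mulCmd]
  · simp [hx, hP, Nat.factorial_succ]
    ring
  · simpa [hx, h0] using hi

/-- Register `44` is multiplied by `n!` and divided by register `33`. -/
def factSkipCmd : Cmd :=
  .loop 25 0 (when ((.reg 25 + 1 - .reg 33) + (.reg 33 - (.reg 25 + 1)))
    (.assign 40 (.reg 44) ;; .assign 41 (.reg 25 + 1) ;; mulCmd ;; .assign 44 (.reg 43)))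

theorem run_factSkipCmd (m : Memory) (h0 : 0 < m.reg 33) (h : m.reg 33 ≤ m.reg 0) :
    (factSkipCmd.run m).reg 44 * m.reg 33 = m.reg 44 * (m.reg 0).factorial := by
  have := run_loop_induction (x := 25) (b := 0) (m := m)
    (c := when ((.reg 25 + 1 - .reg 33) + (.reg 33 - (.reg 25 + 1)))
      (.assign 40 (.reg 44) ;; .assign 41 (.reg 25 + 1) ;; mulCmd ;; .assign 44 (.reg 43)))
    -- Division is avoided by an invariant in which the omitted factor is put back once the loop has
    -- passed it.
    (P := fun i m' => m'.reg 44 * (if m.reg 33 ≤ i then m.reg 33 else 1) =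
      m.reg 44 * i.factorial) (by simp [h0.ne']) ?_
  · simpa [h, factSkipCmd] using this
  intro i hi m' hx hf hP
  have h0 : m'.reg 0 = m.reg 0 := hf.reg 0 rfl
  have h33 : m'.reg 33 = m.reg 33 := hf.reg 33 rfl
  by_cases hi' : i + 1 = m.reg 33
  · have h₁ : ¬ m.reg 33 ≤ i := by omega
    rw [if_neg h₁, mul_one] at hP
    simp [hx, h33, ← hi', hP, Nat.factorial_succ]
    ring
  · have h₁ : (i + 1 - m.reg 33) + (m.reg 33 - (i + 1)) ≠ 0 := by omega
    have h₂ : m.reg 33 ≤ i + 1 ↔ m.reg 33 ≤ i := by omega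
    have h₃ := run_mulCmd ((m'.setReg 40 (m'.reg 44)).setReg 41 (i + 1))
      (by simpa [h0] using hi)
    simp only [Memory.setReg_reg, if_pos, if_neg (show (40 : ℕ) ≠ 41 by decide)] at h₃
    have h₄ : ¬ (i + 1 - m.reg 33 = 0 ∧ m.reg 33 - (i + 1) = 0) := by omega
    simp [hx, h33, h₂, h₃, h₄, Nat.factorial_succ, -mul_ite]
    calc _ = (m'.reg 44 * (if m.reg 33 ≤ i then m.reg 33 else 1)) * (i + 1) := by ring
      _ = _ := by rw [hP]; ring

/-! ## The preamble -/

section Preamble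

/-- Register `3` becomes `n * n`. -/
def squareCmd : Cmd := .loop 4 0 (.assign 3 (.reg 3 + .reg 0))

/-- Array `9` becomes the table of the products `i * n` for `i < n * n`, and register `50` becomes
the common denominator `n! ^ n` of all colours. -/
def preambleCmd : Cmd :=
  .assign 5 0 ;; .loop 4 3 (.store 9 (.reg 4) (.reg 5) ;; .assign 5 (.reg 5 + .reg 0)) ;;
  .assign 44 1 ;; .loop 13 0 factCmd ;; .assign 50 (.reg 44)

open Classical in
/-- The memory holds the graph `G` and the data computed by the preamble. -/
structure Ready {n : ℕ} (G : SimpleGraph (Fin n)) (m : Memory) : Prop where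
  reg_zero : m.reg 0 = n
  reg_three : m.reg 3 = n * n
  adj : ∀ u v : Fin n, m.arr 0 (u * n + v) = if G.Adj u v then 1 else 0
  table : ∀ i < n * n, m.arr 9 i = i * n
  denom : m.reg 50 = n.factorial ^ n

variable {n : ℕ} {G : SimpleGraph (Fin n)}

theorem Ready.of_eq {m m' : Memory} (h : Ready G m) (h0 : m'.reg 0 = m.reg 0)
    (h3 : m'.reg 3 = m.reg 3) (h50 : m'.reg 50 = m.reg 50) (ha : m'.arr 0 = m.arr 0)
    (hb : m'.arr 9 = m.arr 9) : Ready G m' :=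
  ⟨h0 ▸ h.reg_zero, h3 ▸ h.reg_three, ha ▸ h.adj, hb ▸ h.table, h50 ▸ h.denom⟩

theorem Ready.frame {m m' : Memory} (h : Ready G m) {c : Cmd} (hf : c.Frame m m')
    (h0 : c.writesReg 0 = false := by rfl) (h3 : c.writesReg 3 = false := by rfl)
    (h50 : c.writesReg 50 = false := by rfl) (ha : c.writesArr 0 = false := by rfl)
    (hb : c.writesArr 9 = false := by rfl) : Ready G m' :=
  h.of_eq (hf.reg _ h0) (hf.reg _ h3) (hf.reg _ h50) (hf.arr _ ha) (hf.arr _ hb)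

theorem mul_add_lt {a b x y : ℕ} (hx : x < a) (hy : y < b) : x * b + y < a * b :=
  calc x * b + y < x * b + b := Nat.add_lt_add_left hy _
    _ = (x + 1) * b := by ring
    _ ≤ a * b := Nat.mul_le_mul_right _ hx

theorem mul_add_inj {b x y x' y' : ℕ} (hy : y < b) (hy' : y' < b)
    (h : x * b + y = x' * b + y') : x = x' ∧ y = y' := by
  have h₁ := congrArg (· / b) h
  have h₂ := congrArg (· % b) h
  have hb : 0 < b := by omega
  simp only [mul_comm _ b, Nat.mul_add_div hb, Nat.div_eq_of_lt hy, Nat.div_eq_of_lt hy',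
    Nat.mul_add_mod, Nat.mod_eq_of_lt hy, Nat.mod_eq_of_lt hy'] at h₁ h₂
  exact ⟨by simpa using h₁, h₂⟩

theorem run_squareCmd (m : Memory) : (squareCmd.run m).reg 3 = m.reg 3 + m.reg 0 * m.reg 0 := by
  refine run_loop_induction (P := fun i m' => m'.reg 3 = m.reg 3 + i * m.reg 0) (by simp) ?_
  intro i hi m' hx hf hP
  have h0 : m'.reg 0 = m.reg 0 := hf.reg 0 rfl
  simp [hP, h0]
  ring

theorem ready_preamble :
    Ready G (preambleCmd.run (squareCmd.run (inputMemory G))) := by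
  set m := squareCmd.run (inputMemory G) with hm
  have h0 : m.reg 0 = n := by
    rw [hm, run_reg _ _ 0]
    simp [inputMemory]
  have h3 : m.reg 3 = n * n := by
    rw [hm, run_squareCmd]
    simp [inputMemory]
  have ha : m.arr = (inputMemory G).arr := by
    funext a
    rw [hm, run_arr _ _ a]
  have htab := run_loop_induction (x := 4) (b := 3) (m := m.setReg 5 0)
    (c := .store 9 (.reg 4) (.reg 5) ;; .assign 5 (.reg 5 + .reg 0))
    (P := fun i m' => m'.reg 5 = i * n ∧ ∀ j < i, m'.arr 9 j = j * n) (by simp) ?_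
  · refine ⟨?_, ?_, fun u v => ?_, fun i hi => ?_, ?_⟩
    · rw [run_reg _ _ 0, h0]
    · rw [run_reg _ _ 3, h3]
    · rw [run_arr _ _ 0, ha]
      simp only [inputMemory, true_and]
      congr 1
      rw [eq_iff_iff]
      constructor
      · rintro ⟨-, u', v', h, h'⟩
        obtain ⟨h₁, h₂⟩ := mul_add_inj v.2 v'.2 h
        rwa [Fin.ext h₁, Fin.ext h₂]
      · exact fun h => ⟨rfl, u, v, rfl, h⟩
    · simp only [preambleCmd, run_seq, run_assign]
      rw [Memory.setReg_arr, run_arr _ _ 9, Memory.setReg_arr]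
      exact htab.2 i (by simpa [h3] using hi)
    · simp only [preambleCmd, run_seq, run_assign, Memory.setReg_reg, if_pos, AExp.eval_reg]
      set m₁ := Memory.setReg _ 44 _ with hm₁
      have h₁ : m₁.reg 0 = n := by
        rw [hm₁]
        simp only [Memory.setReg_reg]
        rw [if_neg (by decide), run_reg _ _ 0]
        simp [h0]
      have := run_loop_induction (x := 13) (b := 0) (m := m₁) (c := factCmd)
        (P := fun i m' => m'.reg 44 = n.factorial ^ i) (by simp [hm₁]) ?_
      · rwa [h₁] at this
      · intro i hi m' hx hf hP
        have h0 : m'.reg 0 = n := by rw [← h₁]; exact hf.reg 0 rfl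
        simp only [Memory.setReg_reg]
        rw [if_neg (by decide), run_factCmd, hP, h0, pow_succ]
  · rintro i hi m' hx hf ⟨h₁, h₂⟩
    have h0 : m'.reg 0 = n := by simpa [h0] using hf.reg 0 rfl
    refine ⟨by simp [h₁, h0]; ring, fun j hj => ?_⟩
    simp only [run_seq, run_store, run_assign, Memory.setReg_arr, Memory.setCell_arr, if_pos,
      AExp.eval_reg, hx, h₁, Function.update_apply]
    split_ifs with hji
    · rw [hji]
    · exact h₂ j (by omega)

end Preamble

/-! ## The table of walk lengths -/

section WalkTable

variable {n : ℕ} {G : SimpleGraph (Fin n)}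

/-- There is a walk of length `k` from `x` to `y` in `G` without the edges inside `C`. -/
def HasWalk (G : SimpleGraph (Fin n)) (C : Set (Fin n)) (k : ℕ) (x y : Fin n) : Prop :=
  ∃ p : (deleteInside G C).Walk x y, p.length = k

theorem hasWalk_zero {C : Set (Fin n)} {x y : Fin n} : HasWalk G C 0 x y ↔ x = y := by
  constructor
  · rintro ⟨p, hp⟩
    exact p.eq_of_length_eq_zero hp
  · rintro rfl
    exact ⟨.nil, rfl⟩

theorem hasWalk_succ {C : Set (Fin n)} {k : ℕ} {x y : Fin n} : HasWalk G C (k + 1) x y ↔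
    ∃ z, (G.Adj x z ∧ ¬ (x ∈ C ∧ z ∈ C)) ∧ HasWalk G C k z y := by
  constructor
  · rintro ⟨p, hp⟩
    cases p with
    | nil => simp at hp
    | @cons _ z _ h p => exact ⟨z, h, p, by simpa using hp⟩
  · rintro ⟨z, h, p, rfl⟩
    exact ⟨.cons h p, rfl⟩

open Classical in
/-- Array `11` holds the indicator function of `C`. -/
def HoldsSet (C : Set (Fin n)) (m : Memory) : Prop :=
  ∀ x : Fin n, m.arr 11 x = if x ∈ C then 1 else 0

/-- Register `20` becomes nonzero if there is a walk of length `k` from `x` to `y`, where `k`, `x`,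
`y` are in registers `14`, `15`, `16`. -/
def walkValueCmd : Cmd :=
  .assign 20 0 ;;
  .ite (.reg 14)
    (.loop 17 0
      (when (.cell 0 (.cell 9 (.reg 15) + .reg 17))
        (when (2 - (.cell 11 (.reg 15) + .cell 11 (.reg 17)))
          (when (.cell 12 (.cell 9 (.cell 9 (.reg 14 - 1) + .reg 17) + .reg 16))
            (.assign 20 1)))))
    (when (1 - ((.reg 15 - .reg 16) + (.reg 16 - .reg 15))) (.assign 20 1))

/-- Array `12` becomes the table of the lengths `k < n` of walks. -/
def walkTableCmd : Cmd :=
  .loop 14 0 (.loop 15 0 (.loop 16 0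
    (walkValueCmd ;; .store 12 (.cell 9 (.cell 9 (.reg 14) + .reg 15) + .reg 16) (.reg 20))))

/-- The entries of the walk table with index below `N` are correct. -/
def WalkTableBelow (G : SimpleGraph (Fin n)) (C : Set (Fin n)) (N : ℕ) (m : Memory) : Prop :=
  ∀ k x y : Fin n, (k * n + x) * n + y < N →
    (m.arr 12 ((k * n + x) * n + y) ≠ 0 ↔ HasWalk G C k x y)

/-- An entry for length k + 1 depends only on entries for length k, all of which have smaller index.
So correctness below the current index is enough, and the table can be filled in place. -/
theorem run_walkValueCmd {C : Set (Fin n)} {m : Memory} (hm : Ready G m) (hC : HoldsSet C m)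
    (k x y : Fin n) (hk : m.reg 14 = k) (hx : m.reg 15 = x) (hy : m.reg 16 = y)
    (hW : WalkTableBelow G C ((k * n + x) * n + y) m) :
    (walkValueCmd.run m).reg 20 ≠ 0 ↔ HasWalk G C k x y := by
  have hxt : m.arr 9 x = x * n := hm.table x (x.2.trans_le (Nat.le_mul_self n))
  obtain ⟨k, hkn⟩ := k
  rcases k with _ | k
  · rw [hasWalk_zero]
    simp only at hk
    simp only [walkValueCmd, run_seq, run_ite, run_assign, run_when, AExp.eval_reg, Memory.setReg_reg,
      hk, AExp.eval_sub, AExp.eval_add, AExp.eval_zero, AExp.eval_one]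
    simp only [hx, hy]
    by_cases hxy : x = y
    · simp [hxy]
    · have : (x : ℕ) ≠ y := fun h => hxy (Fin.ext h)
      have : 1 - ((x : ℕ) - y + (y - x)) = 0 := by omega
      simp [hxy, this]
  · rw [hasWalk_succ]
    have key := run_loop_induction (x := 17) (b := 0) (m := m.setReg 20 0)
      (c := when (.cell 0 (.cell 9 (.reg 15) + .reg 17))
        (when (2 - (.cell 11 (.reg 15) + .cell 11 (.reg 17)))
          (when (.cell 12 (.cell 9 (.cell 9 (.reg 14 - 1) + .reg 17) + .reg 16))
            (.assign 20 1))))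
      (P := fun i m' => m'.reg 20 ≠ 0 ↔ ∃ z : Fin n, z < i ∧
        (G.Adj x z ∧ ¬ (x ∈ C ∧ z ∈ C)) ∧ HasWalk G C k z y) (by simp) ?_
    · have h₁ : walkValueCmd.run m = (Cmd.loop 17 0 (when (.cell 0 (.cell 9 (.reg 15) + .reg 17))
          (when (2 - (.cell 11 (.reg 15) + .cell 11 (.reg 17)))
          (when (.cell 12 (.cell 9 (.cell 9 (.reg 14 - 1) + .reg 17) + .reg 16))
            (.assign 20 1))))).run (m.setReg 20 0) := by
        simp [walkValueCmd, hk]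
      rw [h₁, key]
      simp [hm.reg_zero]
    · intro i hi m' hi' hf hP
      have hin : i < n := by simpa [hm.reg_zero] using hi
      have e14 : m'.reg 14 = k + 1 := by simpa [hk] using hf.reg 14 rfl
      have e15 : m'.reg 15 = x := by simpa [hx] using hf.reg 15 rfl
      have e16 : m'.reg 16 = y := by simpa [hy] using hf.reg 16 rfl
      have a0 := (congrFun (hf.arr 0 rfl) (x * n + i)).trans (hm.adj x ⟨i, hin⟩)
      have a9 : m'.arr 9 = m.arr 9 := hf.arr 9 rfl
      have a11 : m'.arr 11 = m.arr 11 := hf.arr 11 rfl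
      have a12 : m'.arr 12 = m.arr 12 := hf.arr 12 rfl
      have hCx := hC x
      have hCi := hC ⟨i, hin⟩
      simp only at hCi
      have hki : k * n + i < n * n := mul_add_lt (by omega) hin
      -- The entry used lies in the layer of length k, which ends before the layer of length k + 1
      -- begins.
      have hWk := hW ⟨k, by omega⟩ ⟨i, hin⟩ y (by
        refine mul_add_lt (b := n) (a := (k + 1) * n) ?_ y.2 |>.trans_le ?_
        · exact mul_add_lt (Nat.lt_succ_self k) hin
        · simp only [add_mul]
          omega)
      have hkt : m.arr 9 k = k * n :=
        hm.table k (lt_of_lt_of_le (by omega : k < n) (Nat.le_mul_self n))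
      simp only at hWk
      have hiff : (∃ z : Fin n, z < i + 1 ∧ (G.Adj x z ∧ ¬ (x ∈ C ∧ z ∈ C)) ∧ HasWalk G C k z y) ↔
          (∃ z : Fin n, z < i ∧ (G.Adj x z ∧ ¬ (x ∈ C ∧ z ∈ C)) ∧ HasWalk G C k z y) ∨
          ((G.Adj x ⟨i, hin⟩ ∧ ¬ (x ∈ C ∧ ⟨i, hin⟩ ∈ C)) ∧ HasWalk G C k ⟨i, hin⟩ y) := by
        constructor
        · rintro ⟨z, hz, h⟩
          rcases Nat.lt_succ_iff_lt_or_eq.1 hz with hz | hz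
          · exact Or.inl ⟨z, hz, h⟩
          · obtain rfl : z = ⟨i, hin⟩ := Fin.ext hz
            exact Or.inr h
        · rintro (⟨z, hz, h⟩ | h)
          · exact ⟨z, hz.trans (Nat.lt_succ_self i), h⟩
          · exact ⟨_, Nat.lt_succ_self i, h⟩
      rw [hiff, ← hP, ← hWk]
      simp only [run_when, AExp.eval_cell, AExp.eval_add, AExp.eval_sub, AExp.eval_reg,
        AExp.eval_one, AExp.eval_two, e14, e15, e16, hi', a9, a11, a12, hxt, a0, hCx, hCi, hkt,
        Nat.add_sub_cancel, hm.table _ hki, run_assign]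
      by_cases h₁ : G.Adj x ⟨i, hin⟩ <;> by_cases h₂ : x ∈ C <;> by_cases h₃ : ⟨i, hin⟩ ∈ C <;>
        by_cases h₄ : m.arr 12 ((k * n + i) * n + y) = 0 <;> simp [h₁, h₂, h₃, h₄]

theorem run_walkTableCmd {C : Set (Fin n)} {m : Memory} (hm : Ready G m) (hC : HoldsSet C m)
    (k x y : Fin n) : (walkTableCmd.run m).arr 12 ((k * n + x) * n + y) ≠ 0 ↔
      HasWalk G C k x y := by
  suffices h : WalkTableBelow G C (n * n * n) (walkTableCmd.run m) from
    h k x y (mul_add_lt (mul_add_lt k.2 x.2) y.2)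
  have h := run_loop_induction (x := 14) (b := 0) (m := m)
    (c := .loop 15 0 (.loop 16 0 (walkValueCmd ;;
      .store 12 (.cell 9 (.cell 9 (.reg 14) + .reg 15) + .reg 16) (.reg 20))))
    (P := fun k m' => WalkTableBelow G C (k * n * n) m') (by simp [WalkTableBelow]) ?_
  · rwa [hm.reg_zero] at h
  intro k hk m₁ hk₁ hf₁ hP₁
  have hm₁ := hm.frame hf₁
  have h := run_loop_induction (x := 15) (b := 0) (m := m₁)
    (c := .loop 16 0 (walkValueCmd ;;
      .store 12 (.cell 9 (.cell 9 (.reg 14) + .reg 15) + .reg 16) (.reg 20)))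
    (P := fun x m' => WalkTableBelow G C ((k * n + x) * n) m') (by rw [add_zero]; exact hP₁) ?_
  · rw [hm₁.reg_zero] at h
    rw [add_mul, one_mul]
    exact h
  intro x hx m₂ hx₂ hf₂ hP₂
  have hm₂ := hm₁.frame hf₂
  have hk₂ : m₂.reg 14 = k := by rw [← hk₁]; exact hf₂.reg 14 rfl
  have h := run_loop_induction (x := 16) (b := 0) (m := m₂)
    (c := walkValueCmd ;;
      .store 12 (.cell 9 (.cell 9 (.reg 14) + .reg 15) + .reg 16) (.reg 20))
    (P := fun y m' => WalkTableBelow G C ((k * n + x) * n + y) m') (by rw [add_zero]; exact hP₂) ?_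
  · rw [hm₂.reg_zero] at h
    rw [← add_assoc, add_mul, one_mul]
    exact h
  intro y hy m₃ hy₃ hf₃ hP₃
  have hm₃ := hm₂.frame hf₃
  have hk₃ : m₃.reg 14 = k := by rw [← hk₂]; exact hf₃.reg 14 rfl
  have hx₃ : m₃.reg 15 = x := by rw [← hx₂]; exact hf₃.reg 15 rfl
  have hC₃ : HoldsSet C m₃ := by
    have h₁ : m₁.arr 11 = m.arr 11 := hf₁.arr 11 rfl
    have h₂ : m₂.arr 11 = m₁.arr 11 := hf₂.arr 11 rfl
    have h₃ : m₃.arr 11 = m₂.arr 11 := hf₃.arr 11 rfl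
    rw [HoldsSet, h₃, h₂, h₁]
    exact hC
  rw [hm.reg_zero] at hk
  rw [hm₁.reg_zero] at hx
  rw [hm₂.reg_zero] at hy
  have hval := run_walkValueCmd hm₃ hC₃ ⟨k, hk⟩ ⟨x, hx⟩ ⟨y, hy⟩ hk₃ hx₃ hy₃ hP₃
  have e9 := run_arr walkValueCmd m₃ 9
  have e12 := run_arr walkValueCmd m₃ 12
  have e14 := run_reg walkValueCmd m₃ 14
  have e15 := run_reg walkValueCmd m₃ 15
  have e16 := run_reg walkValueCmd m₃ 16
  have t₁ : m₃.arr 9 k = k * n := hm₃.table k (hk.trans_le (Nat.le_mul_self n))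
  have t₂ : m₃.arr 9 (k * n + x) = (k * n + x) * n := hm₃.table _ (mul_add_lt hk hx)
  intro k' x' y' hlt
  simp only [run_seq, run_store, Memory.setReg_arr, Memory.setCell_arr, if_pos, AExp.eval_add,
    AExp.eval_cell, AExp.eval_reg, e9, e12, e14, e15, e16, hk₃, hx₃, hy₃, t₁, t₂,
    Function.update_apply]
  split_ifs with heq
  · obtain ⟨h₁, h₂⟩ := mul_add_inj y'.2 hy heq
    obtain ⟨h₃, h₄⟩ := mul_add_inj x'.2 hx h₁
    obtain rfl : k' = ⟨k, hk⟩ := Fin.ext h₃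
    obtain rfl : x' = ⟨x, hx⟩ := Fin.ext h₄
    obtain rfl : y' = ⟨y, hy⟩ := Fin.ext h₂
    exact hval
  · exact hP₃ k' x' y' (by omega)

end WalkTable

/-! ## The search for a steepest walk -/

section Search

variable {n : ℕ} {G : SimpleGraph (Fin n)} {C : Set (Fin n)} {c : Fin n → ℕ} {u₀ : Fin n}

/-- A coloured vertex `u` with an uncoloured neighbour `w`, from which a walk of length `k` leads to
a coloured vertex `v` of at least the colour of `u`. -/
structure Candidate (G : SimpleGraph (Fin n)) (C : Set (Fin n)) (c : Fin n → ℕ)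
    (k u w v : Fin n) : Prop where
  left_mem : u ∈ C
  right_mem : v ∈ C
  notMem : w ∉ C
  adj : G.Adj u w
  walk : HasWalk G C k w v
  le : c u ≤ c v

/-- The partial colouring `c` of `C` is held by the arrays `10` and `11`. -/
structure HoldsColouring (G : SimpleGraph (Fin n)) (C : Set (Fin n)) (c : Fin n → ℕ)
    (m : Memory) : Prop where
  ready : Ready G m
  set : HoldsSet C m
  colour : ∀ x : Fin n, m.arr 10 x = c x

/-- In addition, array `12` holds the walk table. -/
structure HoldsTable (G : SimpleGraph (Fin n)) (C : Set (Fin n)) (c : Fin n → ℕ)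
    (m : Memory) : Prop extends HoldsColouring G C c m where
  walks : ∀ k x y : Fin n, m.arr 12 ((k * n + x) * n + y) ≠ 0 ↔ HasWalk G C k x y

theorem HoldsColouring.frame {m m' : Memory} (h : HoldsColouring G C c m) {d : Cmd}
    (hf : d.Frame m m') (h0 : d.writesReg 0 = false := by rfl)
    (h3 : d.writesReg 3 = false := by rfl) (h50 : d.writesReg 50 = false := by rfl)
    (ha : d.writesArr 0 = false := by rfl) (hb : d.writesArr 9 = false := by rfl)
    (hc : d.writesArr 10 = false := by rfl) (hd : d.writesArr 11 = false := by rfl) :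
    HoldsColouring G C c m' :=
  ⟨h.ready.frame hf h0 h3 h50 ha hb, fun x => by rw [hf.arr 11 hd]; exact h.set x,
    fun x => by rw [hf.arr 10 hc]; exact h.colour x⟩

theorem HoldsTable.frame {m m' : Memory} (h : HoldsTable G C c m) {d : Cmd}
    (hf : d.Frame m m') (h0 : d.writesReg 0 = false := by rfl)
    (h3 : d.writesReg 3 = false := by rfl) (h50 : d.writesReg 50 = false := by rfl)
    (ha : d.writesArr 0 = false := by rfl) (hb : d.writesArr 9 = false := by rfl)
    (hc : d.writesArr 10 = false := by rfl) (hd : d.writesArr 11 = false := by rfl)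
    (he : d.writesArr 12 = false := by rfl) : HoldsTable G C c m' :=
  ⟨h.toHoldsColouring.frame hf h0 h3 h50 ha hb hc hd, fun k x y => by
    rw [hf.arr 12 he]; exact h.walks k x y⟩

/-- The registers `30` to `33` describe a candidate: vertices, difference of colours, length. -/
def BestIsCandidate (G : SimpleGraph (Fin n)) (C : Set (Fin n)) (c : Fin n → ℕ)
    (m : Memory) : Prop :=
  ∃ k u w v : Fin n, Candidate G C c k u w v ∧ m.reg 30 = u ∧ m.reg 31 = w ∧
    m.reg 32 = c v - c u ∧ m.reg 33 = k + 1

/-- The registers `30` to `33` describe a candidate or have their initial values. -/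
def BestValid (G : SimpleGraph (Fin n)) (C : Set (Fin n)) (c : Fin n → ℕ) (u₀ : Fin n)
    (m : Memory) : Prop :=
  (m.reg 30 = u₀ ∧ m.reg 31 = u₀ ∧ m.reg 32 = 0 ∧ m.reg 33 = 1) ∨ BestIsCandidate G C c m

/-- The candidate described by the registers is at least as steep as the one given. -/
def Dominates (G : SimpleGraph (Fin n)) (C : Set (Fin n)) (c : Fin n → ℕ) (k u w v : Fin n)
    (m : Memory) : Prop :=
  Candidate G C c k u w v →
    BestIsCandidate G C c m ∧ (c v - c u) * m.reg 33 ≤ m.reg 32 * (k + 1)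

/-- The registers of `m'` describe a candidate at least as good as those of `m`. -/
def Improves (G : SimpleGraph (Fin n)) (C : Set (Fin n)) (c : Fin n → ℕ) (u₀ : Fin n)
    (m m' : Memory) : Prop :=
  BestValid G C c u₀ m' ∧
    ∀ k u w v, Dominates G C c k u w v m → Dominates G C c k u w v m'

/-- Register `43` becomes the product of the values of `e` and `f`. -/
def mulOf (e f : AExp) : Cmd := .assign 40 e ;; .assign 41 f ;; mulCmd

theorem run_mulOf {m : Memory} {e f : AExp} (hf : ∀ v, f.eval (m.setReg 40 v) = f.eval m)
    (h : f.eval m ≤ m.reg 0) : ((mulOf e f).run m).reg 43 = e.eval m * f.eval m := by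
  rw [mulOf, run_seq, run_seq, run_assign, run_assign, run_mulCmd]
  · simp [hf]
  · simpa [hf] using h

/-- Compute the products by which the candidate in the registers `21` to `24` is compared with the
best one so far. -/
def productsCmd : Cmd :=
  .assign 34 (.cell 10 (.reg 21) - .cell 10 (.reg 23)) ;; mulOf (.reg 34) (.reg 33) ;;
  .assign 35 (.reg 43) ;; mulOf (.reg 32) (.reg 22 + 1)

theorem run_productsCmd {m : Memory} (h33 : m.reg 33 ≤ m.reg 0) (h22 : m.reg 22 + 1 ≤ m.reg 0) :
    let a := m.arr 10 (m.reg 21) - m.arr 10 (m.reg 23)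
    (productsCmd.run m).reg 34 = a ∧ (productsCmd.run m).reg 35 = a * m.reg 33 ∧
      (productsCmd.run m).reg 43 = m.reg 32 * (m.reg 22 + 1) := by
  intro a
  simp only [productsCmd, run_seq, run_assign]
  set m₁ := m.setReg 34 _ with hm₁
  set m₂ := (mulOf (.reg 34) (.reg 33)).run m₁ with hm₂
  have h₁ : m₂.reg 43 = a * m.reg 33 := by
    rw [hm₂, run_mulOf (by simp) (by simpa [hm₁] using h33)]
    simp [hm₁, a]
  have e : ∀ y, (mulOf (.reg 34) (.reg 33)).writesReg y = false → y ≠ 34 →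
      m₂.reg y = m.reg y := fun y hy h34 => by
    rw [hm₂, run_reg _ _ y hy, hm₁]
    simp [h34]
  have e34 : m₂.reg 34 = a := by
    rw [hm₂, run_reg _ _ 34, hm₁]
    simp [a]
  have e0 := e 0 rfl (by decide)
  have e22 := e 22 rfl (by decide)
  have e32 := e 32 rfl (by decide)
  clear_value m₂
  refine ⟨?_, ?_, ?_⟩
  · rw [run_reg _ _ 34]
    simpa using e34
  · rw [run_reg _ _ 35]
    simpa using h₁
  · rw [run_mulOf (by simp) (by simpa [e22, e0] using h22)]
    simp [e22, e32]

/-- Compare the candidate in the registers `21` to `24` with the best one so far. -/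
def compareCmd : Cmd :=
  when (.cell 11 (.reg 21)) (when (.cell 11 (.reg 23)) (when (1 - .cell 11 (.reg 24))
    (when (.cell 0 (.cell 9 (.reg 23) + .reg 24))
      (when (.cell 12 (.cell 9 (.cell 9 (.reg 22) + .reg 24) + .reg 21))
        (when (.cell 10 (.reg 21) + 1 - .cell 10 (.reg 23))
          (productsCmd ;; when (.reg 35 + 1 - .reg 43)
              (.assign 30 (.reg 23) ;; .assign 31 (.reg 24) ;; .assign 32 (.reg 34) ;;
                .assign 33 (.reg 22 + 1))))))))

/-- Find a steepest candidate. -/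
def searchCmd : Cmd :=
  .assign 30 (.reg 10) ;; .assign 31 (.reg 10) ;; .assign 32 0 ;; .assign 33 1 ;;
  .loop 21 0 (.loop 22 0 (.loop 23 0 (.loop 24 0 compareCmd)))

theorem BestValid.pos {m : Memory} (h : BestValid G C c u₀ m) : 0 < m.reg 33 ∧ m.reg 33 ≤ n := by
  rcases h with ⟨-, -, -, h⟩ | ⟨k, -, -, -, -, -, -, -, h⟩
  · have := u₀.2
    omega
  · have := k.2
    omega

/-- Slopes are compared by cross-multiplication, with lengths of at most n as second factors. A tie
replaces the stored values, so even a candidate of slope 0 displaces the initial ones. -/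
theorem run_compareCmd {m : Memory} (hm : HoldsTable G C c m) (k u w v : Fin n)
    (hv : m.reg 21 = v) (hk : m.reg 22 = k) (hu : m.reg 23 = u) (hw : m.reg 24 = w)
    (hb : m.reg 33 ≤ n) :
    let m' := compareCmd.run m
    (Candidate G C c k u w v ∧ m.reg 32 * (k + 1) ≤ (c v - c u) * m.reg 33 ∧
      m'.reg 30 = u ∧ m'.reg 31 = w ∧ m'.reg 32 = c v - c u ∧ m'.reg 33 = k + 1) ∨
    ((Candidate G C c k u w v → (c v - c u) * m.reg 33 < m.reg 32 * (k + 1)) ∧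
      m'.reg 30 = m.reg 30 ∧ m'.reg 31 = m.reg 31 ∧ m'.reg 32 = m.reg 32 ∧
      m'.reg 33 = m.reg 33) := by
  have ht : m.arr 9 u = u * n := hm.ready.table u (u.2.trans_le (Nat.le_mul_self n))
  have ht' : m.arr 9 k = k * n := hm.ready.table k (k.2.trans_le (Nat.le_mul_self n))
  have ht'' : m.arr 9 (k * n + w) = (k * n + w) * n := hm.ready.table _ (mul_add_lt k.2 w.2)
  have hadj := hm.ready.adj u w
  have hWk := hm.walks k w v
  have hsv := hm.set v
  have hsu := hm.set u
  have hsw := hm.set w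
  intro m'
  have hm' : m' = compareCmd.run m := rfl
  simp only [compareCmd, run_when, AExp.eval_cell, AExp.eval_reg, AExp.eval_add, AExp.eval_sub,
    AExp.eval_one, hv, hk, hu, hw, ht, ht', ht'', hadj, hsu, hsv, hsw, hm.colour] at hm'
  by_cases hcand : Candidate G C c k u w v
  · have hW₀ := hWk.2 hcand.walk
    have hle : c v + 1 - c u ≠ 0 := by have := hcand.le; omega
    simp only [hcand.left_mem, hcand.right_mem, hcand.notMem, hcand.adj, hW₀, hle, if_true,
      if_false, one_ne_zero, Nat.sub_zero] at hm'
    rw [run_seq] at hm'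
    obtain ⟨h34, h35, h43⟩ := run_productsCmd (m := m) (by rwa [hm.ready.reg_zero])
      (by rw [hm.ready.reg_zero, hk]; exact k.2)
    have g : ∀ y, productsCmd.writesReg y = false → (productsCmd.run m).reg y = m.reg y :=
      fun y hy => run_reg _ _ y hy
    simp only [hv, hu, hk, hm.colour] at h34 h35 h43
    generalize productsCmd.run m = m₁ at hm' h34 h35 h43 g
    have d₁ := g 22 rfl
    have d₂ := g 23 rfl
    have d₃ := g 24 rfl
    rw [run_when] at hm'
    simp only [AExp.eval_sub, AExp.eval_add, AExp.eval_reg, AExp.eval_one, h35, h43] at hm'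
    split_ifs at hm' with hif
    · right
      refine ⟨fun _ => by omega, ?_, ?_, ?_, ?_⟩ <;> rw [hm'] <;> exact g _ rfl
    · left
      refine ⟨hcand, by omega, ?_, ?_, ?_, ?_⟩ <;>
        simp [hm', d₁, d₂, d₃, hk, hu, hw, h34]
  · right
    have : m' = m := by
      rw [hm']
      by_cases h₁ : v ∈ C
      · by_cases h₂ : u ∈ C
        · by_cases h₃ : w ∈ C
          · simp [h₁, h₂, h₃]
          · by_cases h₄ : G.Adj u w
            · by_cases h₅ : m.arr 12 ((k * n + w) * n + v) = 0
              · simp [h₁, h₂, h₃, h₄, h₅]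
              · have h₆ : c v + 1 - c u = 0 := by
                  by_contra h₆
                  exact hcand ⟨h₂, h₁, h₃, h₄, hWk.1 h₅, by omega⟩
                simp [h₁, h₂, h₃, h₄, h₅, h₆]
            · simp [h₁, h₂, h₃, h₄]
        · simp [h₁, h₂]
      · simp [h₁]
    rw [this]
    exact ⟨fun h => absurd h hcand, rfl, rfl, rfl, rfl⟩

theorem improves_compareCmd {m : Memory} (hm : HoldsTable G C c m) (hbv : BestValid G C c u₀ m)
    (k u w v : Fin n) (hv : m.reg 21 = v) (hk : m.reg 22 = k) (hu : m.reg 23 = u)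
    (hw : m.reg 24 = w) : Improves G C c u₀ m (compareCmd.run m) ∧
      Dominates G C c k u w v (compareCmd.run m) := by
  have hp := hbv.pos
  rcases run_compareCmd hm k u w v hv hk hu hw hp.2 with
    ⟨hc, hle, h₁, h₂, h₃, h₄⟩ | ⟨hlt, h₁, h₂, h₃, h₄⟩
  · have hb : BestIsCandidate G C c (compareCmd.run m) := ⟨k, u, w, v, hc, h₁, h₂, h₃, h₄⟩
    refine ⟨⟨Or.inr hb, fun k' u' w' v' hd hc' => ⟨hb, ?_⟩⟩, fun _ => ⟨hb, ?_⟩⟩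
    · rw [h₃, h₄]
      have h := (hd hc').2
      -- Transitivity of the order on fractions, in cross-multiplied form: the old length is a
      -- common factor and is cancelled.
      refine Nat.le_of_mul_le_mul_right ?_ hp.1
      calc (c v' - c u') * (k + 1) * m.reg 33 = (c v' - c u') * m.reg 33 * (k + 1) := by ring
        _ ≤ m.reg 32 * (k' + 1) * (k + 1) := Nat.mul_le_mul_right _ h
        _ = m.reg 32 * (k + 1) * (k' + 1) := by ring
        _ ≤ (c v - c u) * m.reg 33 * (k' + 1) := Nat.mul_le_mul_right _ hle
        _ = (c v - c u) * (k' + 1) * m.reg 33 := by ring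
    · rw [h₃, h₄]
  · have hb : BestIsCandidate G C c m → BestIsCandidate G C c (compareCmd.run m) := by
      rintro ⟨k', u', w', v', hc', e₁, e₂, e₃, e₄⟩
      exact ⟨k', u', w', v', hc', h₁.trans e₁, h₂.trans e₂, h₃.trans e₃, h₄.trans e₄⟩
    refine ⟨⟨?_, fun k' u' w' v' hd hc' => ⟨hb (hd hc').1, ?_⟩⟩, fun hc => ⟨hb ?_, ?_⟩⟩
    · refine hbv.imp ?_ hb
      rintro ⟨e₁, e₂, e₃, e₄⟩
      exact ⟨h₁.trans e₁, h₂.trans e₂, h₃.trans e₃, h₄.trans e₄⟩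
    · rw [h₃, h₄]
      exact (hd hc').2
    -- The initial values stand for slope 0, and no candidate lies strictly below that.
    · refine hbv.resolve_left ?_
      rintro ⟨-, -, e₃, -⟩
      have := hlt hc
      rw [e₃, zero_mul] at this
      exact Nat.not_lt_zero _ this
    · rw [h₃, h₄]
      exact (hlt hc).le

/-- `K i` describes the candidates examined in round i. Domination, once obtained, survives later
improvements, so this one rule serves all four nested loops of the search. -/
theorem run_loop_improves {x : ℕ} {d : Cmd} {m : Memory} (K : ℕ → Fin n → Fin n → Fin n → Fin n → Prop)
    (h0 : m.reg 0 = n) (hx : x ∉ [30, 31, 32, 33]) (hbv : BestValid G C c u₀ m)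
    (hs : ∀ i < n, ∀ m', m'.reg x = i → (Cmd.loop x 0 d).Frame m m' → BestValid G C c u₀ m' →
      Improves G C c u₀ m' (d.run m') ∧
        ∀ k u w v, K i k u w v → Dominates G C c k u w v (d.run m')) :
    Improves G C c u₀ m ((Cmd.loop x 0 d).run m) ∧
      ∀ k u w v, (∃ i < n, K i k u w v) → Dominates G C c k u w v ((Cmd.loop x 0 d).run m) := by
  simp only [List.mem_cons, List.not_mem_nil, or_false, not_or] at hx
  obtain ⟨h30, h31, h32, h33⟩ := hx
  have e30 : ∀ (m : Memory) i, (m.setReg x i).reg 30 = m.reg 30 := by simp [Ne.symm h30]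
  have e31 : ∀ (m : Memory) i, (m.setReg x i).reg 31 = m.reg 31 := by simp [Ne.symm h31]
  have e32 : ∀ (m : Memory) i, (m.setReg x i).reg 32 = m.reg 32 := by simp [Ne.symm h32]
  have e33 : ∀ (m : Memory) i, (m.setReg x i).reg 33 = m.reg 33 := by simp [Ne.symm h33]
  have hV : ∀ m i, BestValid G C c u₀ (m.setReg x i) ↔ BestValid G C c u₀ m := by
    intro m i
    simp only [BestValid, BestIsCandidate, e30, e31, e32, e33]
  have hD : ∀ m i k u w v, Dominates G C c k u w v (m.setReg x i) ↔
      Dominates G C c k u w v m := by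
    intro m i k u w v
    simp only [Dominates, BestIsCandidate, e30, e31, e32, e33]
  have key := run_loop_induction (x := x) (b := 0) (c := d) (m := m)
    (P := fun N m' => Improves G C c u₀ m m' ∧
      ∀ k u w v, (∃ i < N, K i k u w v) → Dominates G C c k u w v m') ?_ ?_
  · rwa [h0] at key
  · refine ⟨⟨(hV _ _).2 hbv, fun k u w v h => (hD _ _ _ _ _ _).2 h⟩, ?_⟩
    rintro k u w v ⟨i, hi, -⟩
    exact absurd hi (Nat.not_lt_zero _)
  · rintro i hi m' hxi hf ⟨⟨h₁, h₂⟩, h₃⟩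
    obtain ⟨⟨h₄, h₅⟩, h₆⟩ := hs i (h0 ▸ hi) m' hxi hf h₁
    refine ⟨⟨(hV _ _).2 h₄, fun k u w v h => (hD _ _ _ _ _ _).2 (h₅ _ _ _ _ (h₂ _ _ _ _ h))⟩, ?_⟩
    rintro k u w v ⟨j, hj, hK⟩
    rw [hD]
    rcases Nat.lt_succ_iff_lt_or_eq.1 hj with hj | rfl
    · exact h₅ _ _ _ _ (h₃ k u w v ⟨j, hj, hK⟩)
    · exact h₆ _ _ _ _ hK

theorem run_searchCmd {m : Memory} (hm : HoldsTable G C c m) (hu₀ : m.reg 10 = u₀) :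
    BestValid G C c u₀ (searchCmd.run m) ∧
      ∀ k u w v, Dominates G C c k u w v (searchCmd.run m) := by
  simp only [searchCmd, run_seq, run_assign]
  set m₀ := (((m.setReg 30 _).setReg 31 _).setReg 32 _).setReg 33 _ with hm₀
  have hmm₀ : HoldsTable G C c m₀ := by
    -- This command serves only to name the written registers; the values it assigns are irrelevant.
    refine hm.frame (d := .assign 30 0 ;; .assign 31 0 ;; .assign 32 0 ;; .assign 33 0)
      ⟨fun y hy => ?_, fun _ _ => rfl⟩
    simp only [writesReg, Bool.or_eq_false_iff, beq_eq_false_iff_ne] at hy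
    simp [hm₀, hy]
  have hb₀ : BestValid G C c u₀ m₀ := Or.inl (by simp [hm₀, hu₀])
  have h := run_loop_improves (G := G) (C := C) (c := c) (u₀ := u₀) (x := 21)
    (d := .loop 22 0 (.loop 23 0 (.loop 24 0 compareCmd))) (m := m₀)
    (fun i _ _ _ v => (v : ℕ) = i) hmm₀.ready.reg_zero (by decide) hb₀ ?_
  · exact ⟨h.1.1, fun k u w v => h.2 k u w v ⟨v, v.2, rfl⟩⟩
  intro v hv m₁ hv₁ hf₁ hb₁
  have hm₁ := hmm₀.frame hf₁
  have h := run_loop_improves (G := G) (C := C) (c := c) (u₀ := u₀) (x := 22)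
    (d := .loop 23 0 (.loop 24 0 compareCmd)) (m := m₁)
    (fun i k _ _ v' => (v' : ℕ) = v ∧ (k : ℕ) = i) hm₁.ready.reg_zero (by decide) hb₁ ?_
  · exact ⟨h.1, fun k u w v' hv' => h.2 k u w v' ⟨k, k.2, hv', rfl⟩⟩
  intro k hk m₂ hk₂ hf₂ hb₂
  have hm₂ := hm₁.frame hf₂
  have hv₂ : m₂.reg 21 = v := by rw [← hv₁]; exact hf₂.reg 21 rfl
  have h := run_loop_improves (G := G) (C := C) (c := c) (u₀ := u₀) (x := 23)
    (d := .loop 24 0 compareCmd) (m := m₂)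
    (fun i k' u _ v' => (v' : ℕ) = v ∧ (k' : ℕ) = k ∧ (u : ℕ) = i) hm₂.ready.reg_zero (by decide)
    hb₂ ?_
  · exact ⟨h.1, fun k u w v' hv' => h.2 k u w v' ⟨u, u.2, hv'.1, hv'.2, rfl⟩⟩
  intro u hu m₃ hu₃ hf₃ hb₃
  have hm₃ := hm₂.frame hf₃
  have hv₃ : m₃.reg 21 = v := by rw [← hv₂]; exact hf₃.reg 21 rfl
  have hk₃ : m₃.reg 22 = k := by rw [← hk₂]; exact hf₃.reg 22 rfl
  have h := run_loop_improves (G := G) (C := C) (c := c) (u₀ := u₀) (x := 24)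
    (d := compareCmd) (m := m₃)
    (fun i k' u' w v' => (v' : ℕ) = v ∧ (k' : ℕ) = k ∧ (u' : ℕ) = u ∧ (w : ℕ) = i)
    hm₃.ready.reg_zero (by decide) hb₃ ?_
  · exact ⟨h.1, fun k u w v' hv' => h.2 k u w v' ⟨w, w.2, hv'.1, hv'.2.1, hv'.2.2, rfl⟩⟩
  intro w hw m₄ hw₄ hf₄ hb₄
  have hm₄ := hm₃.frame hf₄
  have hv₄ : m₄.reg 21 = v := by rw [← hv₃]; exact hf₄.reg 21 rfl
  have hk₄ : m₄.reg 22 = k := by rw [← hk₃]; exact hf₄.reg 22 rfl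
  have hu₄ : m₄.reg 23 = u := by rw [← hu₃]; exact hf₄.reg 23 rfl
  obtain ⟨h₁, h₂⟩ := improves_compareCmd hm₄ hb₄ ⟨k, hk⟩ ⟨u, hu⟩ ⟨w, hw⟩ ⟨v, hv⟩ hv₄ hk₄ hu₄ hw₄
  refine ⟨h₁, ?_⟩
  rintro k' u' w' v' ⟨e₁, e₂, e₃, e₄⟩
  obtain rfl : v' = ⟨v, hv⟩ := Fin.ext e₁
  obtain rfl : k' = ⟨k, hk⟩ := Fin.ext e₂
  obtain rfl : u' = ⟨u, hu⟩ := Fin.ext e₃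
  obtain rfl : w' = ⟨w, hw⟩ := Fin.ext e₄
  exact h₂

end Search

/-! ## Colouring one more vertex -/

section Round

variable {n : ℕ} {G : SimpleGraph (Fin n)} {C : Set (Fin n)} {c : Fin n → ℕ}

/-- Multiply all colours by `n!`. -/
def rescaleCmd : Cmd :=
  .loop 12 0 (.assign 44 (.cell 10 (.reg 12)) ;; factCmd ;; .store 10 (.reg 12) (.reg 44))

theorem run_rescaleCmd (m : Memory) {x : ℕ} (hx : x < m.reg 0) :
    (rescaleCmd.run m).arr 10 x = m.arr 10 x * (m.reg 0).factorial := by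
  have key := run_loop_induction (x := 12) (b := 0) (m := m)
    (c := .assign 44 (.cell 10 (.reg 12)) ;; factCmd ;; .store 10 (.reg 12) (.reg 44))
    (P := fun i m' => ∀ x, m'.arr 10 x =
      if x < i then m.arr 10 x * (m.reg 0).factorial else m.arr 10 x) (by simp) ?_
  · rw [rescaleCmd, key x, if_pos hx]
  · intro i hi m' hi' hf hP x
    have e0 : m'.reg 0 = m.reg 0 := hf.reg 0 rfl
    simp only [run_seq, run_assign, run_store, Memory.setReg_arr, Memory.setCell_arr, if_pos,
      AExp.eval_cell, AExp.eval_reg, Function.update_apply, run_factCmd, Memory.setReg_reg]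
    rw [run_reg factCmd _ 12, run_arr factCmd _ 10]
    simp only [Memory.setReg_reg, Memory.setReg_arr, hi', hP]
    rcases lt_trichotomy x i with h | rfl | h
    · simp [h, h.ne, h.trans (Nat.lt_succ_self i)]
    · simp [e0]
    · have h₁ : ¬ x < i := by omega
      have h₂ : ¬ x < i + 1 := by omega
      simp [h₁, h₂, h.ne']

/-- Colour the vertex in register `31` according to the registers `30` to `33`, and multiply all
other colours by `n!`. -/
def extendCmd : Cmd :=
  .assign 44 (.reg 32) ;; factSkipCmd ;; .assign 36 (.reg 44) ;; rescaleCmd ;;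
  .store 10 (.reg 31) (.cell 10 (.reg 30) + .reg 36) ;; .store 11 (.reg 31) 1

/-- The increment is exact because a length of at most n divides n!. The array is rescaled before w
is written, so the colour read at u already has the new denominator. -/
theorem run_extendCmd {m : Memory} (hm : HoldsColouring G C c m) {u w : Fin n}
    (hu : m.reg 30 = u) (hw : m.reg 31 = w) (h0 : 0 < m.reg 33) (hn : m.reg 33 ≤ n) :
    ∃ D, D * m.reg 33 = m.reg 32 * n.factorial ∧
      HoldsColouring G (insert w C)
        (fun x => if x = w then c u * n.factorial + D else c x * n.factorial)
        (extendCmd.run m) := by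
  set m₁ := (Cmd.assign 44 (.reg 32) ;; factSkipCmd ;; .assign 36 (.reg 44)).run m with hm₁
  have r0 := hm.ready.reg_zero
  have f := frame_run (Cmd.assign 44 (.reg 32) ;; factSkipCmd ;; .assign 36 (.reg 44)) m
  rw [← hm₁] at f
  have e0 : m₁.reg 0 = n := by rw [← r0]; exact f.reg 0 rfl
  have e30 : m₁.reg 30 = u := by rw [← hu]; exact f.reg 30 rfl
  have e31 : m₁.reg 31 = w := by rw [← hw]; exact f.reg 31 rfl
  have e10 : m₁.arr 10 = m.arr 10 := f.arr 10 rfl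
  have e11 : m₁.arr 11 = m.arr 11 := f.arr 11 rfl
  have f₂ := frame_run rescaleCmd m₁
  have hD := run_factSkipCmd (m.setReg 44 (m.reg 32)) (by simpa using h0) (by simpa [r0] using hn)
  have h36 : m₁.reg 36 = (factSkipCmd.run (m.setReg 44 (m.reg 32))).reg 44 := by
    simp [hm₁]
  rw [← h36] at hD
  have hcol : ∀ x : Fin n, (rescaleCmd.run m₁).arr 10 x = c x * n.factorial := fun x => by
    rw [run_rescaleCmd m₁ (by rw [e0]; exact x.2), e0, e10, hm.colour]
  have hrun : extendCmd.run m = (Cmd.store 10 (.reg 31) (.cell 10 (.reg 30) + .reg 36) ;;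
      .store 11 (.reg 31) 1).run (rescaleCmd.run m₁) := rfl
  have g30 := f₂.reg 30 rfl
  have g31 := f₂.reg 31 rfl
  have g36 := f₂.reg 36 rfl
  have g11 := f₂.arr 11 rfl
  refine ⟨m₁.reg 36, by simpa [r0] using hD,
    hm.ready.frame (frame_run extendCmd m), fun x => ?_, fun x => ?_⟩
  · rw [hrun]
    have := hm.set x
    simp only [run_seq, run_store, Memory.setCell_reg, Memory.setCell_arr, if_pos,
      AExp.eval_reg, AExp.eval_one, g31, e31, g11, e11]
    by_cases hxw : x = w
    · simp [hxw]
    · have hiff : x ∈ insert w C ↔ x ∈ C := by simp [hxw]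
      by_cases hxC : x ∈ C
      · simp [Fin.val_inj, hxw, this, hxC, hiff.2 hxC]
      · simp [Fin.val_inj, hxw, this, hxC, mt hiff.1 hxC]
  · rw [hrun]
    simp only [run_seq, run_store, Memory.setCell_reg, Memory.setCell_arr, if_pos,
      AExp.eval_reg, AExp.eval_one, g31, e31, AExp.eval_add, g30, e30, AExp.eval_cell, g36, hcol]
    simp [Function.update_apply, Fin.val_inj, hcol]

/-- Colour one more vertex. -/
def roundCmd : Cmd := walkTableCmd ;; searchCmd ;; extendCmd

/-- A round either colours a new vertex by a slope step or, once all are coloured, only expands the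
fractions. In both cases the denominator gains exactly one factor n!. -/
theorem run_roundCmd {m : Memory} (hn : 2 ≤ n) (hG : G.Connected) (hm : HoldsColouring G C c m)
    {u₀ : Fin n} (hu₀ : m.reg 10 = u₀) (hmem : u₀ ∈ C) :
    ∃ C' c', HoldsColouring G C' c' (roundCmd.run m) ∧ C ⊆ C' ∧
      (C = Set.univ ∨ C.ncard < C'.ncard) ∧
      ∀ Q, 0 < Q → SlopeSteps (fracState G C c Q) (fracState G C' c' (Q * n.factorial)) := by
  have hF := n.factorial_pos
  set m₁ := walkTableCmd.run m with hm₁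
  have hT : HoldsTable G C c m₁ :=
    ⟨hm.frame (frame_run walkTableCmd m), run_walkTableCmd hm.ready hm.set⟩
  have hu₁ : m₁.reg 10 = u₀ := by rw [← hu₀]; exact run_reg walkTableCmd m 10
  obtain ⟨hbv, hdom⟩ := run_searchCmd hT hu₁
  set m₂ := searchCmd.run m₁ with hm₂
  have hH : HoldsColouring G C c m₂ := hT.toHoldsColouring.frame (frame_run searchCmd m₁)
  have hp := hbv.pos
  by_cases hC : C = Set.univ
  · have hdef : m₂.reg 30 = u₀ ∧ m₂.reg 31 = u₀ ∧ m₂.reg 32 = 0 ∧ m₂.reg 33 = 1 := by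
      refine hbv.resolve_right ?_
      rintro ⟨k, u, w, v, hc, -⟩
      exact hc.notMem (hC ▸ Set.mem_univ w)
    -- Without candidates the initial values take effect: u₀ is recoloured from itself with
    -- increment 0, which is just the rescaling.
    obtain ⟨D, hD, hE⟩ := run_extendCmd hH hdef.1 hdef.2.1 hp.1 hp.2
    rw [hdef.2.2.1, hdef.2.2.2, zero_mul, mul_one] at hD
    subst hD
    refine ⟨_, _, hE, Set.subset_insert _ _, Or.inl hC, fun Q hQ => ?_⟩
    have : fracState G C c Q = fracState G (insert u₀ C)
        (fun x => if x = u₀ then c u₀ * n.factorial + 0 else c x * n.factorial)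
        (Q * n.factorial) := by
      rw [Set.insert_eq_of_mem hmem]
      unfold fracState
      congr 1
      funext x
      have hF' : (n.factorial : ℝ) ≠ 0 := by exact_mod_cast hF.ne'
      have : (if x = u₀ then c u₀ * n.factorial + 0 else c x * n.factorial) =
          c x * n.factorial := by
        split_ifs with h
        · rw [h, add_zero]
        · rfl
      simp only [this]
      push_cast
      rw [mul_div_mul_right _ _ hF']
    rw [← this]
  · obtain ⟨u, hu, w, hw, huw⟩ := exists_adj_of_ne_univ hG ⟨u₀, hmem⟩ hC
    -- Going from u to w and back is a candidate of slope 0, so the search never fails while a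
    -- vertex is uncoloured. This case replaces the last iteration of the procedure.
    have hcand : Candidate G C c ⟨1, hn⟩ u w u :=
      ⟨hu, hu, hw, huw, ⟨.cons (v := u) ⟨huw.symm, fun h => hw h.1⟩ .nil, rfl⟩, le_rfl⟩
    obtain ⟨k, u', w', v', hc, h30, h31, h32, h33⟩ := (hdom _ _ _ _ hcand).1
    obtain ⟨D, hD, hE⟩ := run_extendCmd hH h30 h31 hp.1 hp.2
    rw [h32, h33] at hD
    refine ⟨_, _, hE, Set.subset_insert _ _, Or.inr ?_, fun Q hQ => .single ?_⟩
    · rw [Set.ncard_insert_of_notMem hc.notMem]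
      exact Nat.lt_succ_self _
    · obtain ⟨q, hq⟩ := hc.walk
      refine ⟨_, slopeStep_fracState (D := D) hQ hF hc.left_mem hc.right_mem hc.notMem hc.adj q
        hc.le (fun a ha b hb d hd had q' hq' hab => ?_) (fun x hx => ?_) (if_pos rfl)
        (by rw [hq]; exact hD)⟩
      · rw [Fintype.card_fin] at hq'
        have := (hdom ⟨q'.length, hq'⟩ a d b ⟨ha, hb, hd, had, ⟨q', rfl⟩, hab⟩).2
        rwa [h32, h33, ← hq] at this
      · refine if_neg ?_
        rintro rfl
        exact hc.notMem hx

/-! ## The complete colouring for a pair of vertices -/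

/-- The initial partial colouring for the vertices in the registers `10` and `11`. -/
def initCmd : Cmd :=
  .loop 12 0 (.store 10 (.reg 12) 0 ;; .store 11 (.reg 12) 0) ;;
  .store 11 (.reg 10) 1 ;; .store 11 (.reg 11) 1 ;; .store 10 (.reg 11) 1

theorem run_initCmd {m : Memory} (hm : Ready G m) {u v : Fin n} (hu : m.reg 10 = u)
    (hv : m.reg 11 = v) :
    HoldsColouring G {u, v} (fun x => if x = v then 1 else 0) (initCmd.run m) := by
  have key := run_loop_induction (x := 12) (b := 0) (m := m)
    (c := .store 10 (.reg 12) 0 ;; .store 11 (.reg 12) 0)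
    (P := fun i m' => ∀ x < i, m'.arr 10 x = 0 ∧ m'.arr 11 x = 0) (by simp) ?_
  · have f := frame_run (Cmd.loop 12 0 (.store 10 (.reg 12) 0 ;; .store 11 (.reg 12) 0)) m
    have e10 := f.reg 10 rfl
    have e11 := f.reg 11 rfl
    rw [hm.reg_zero] at key
    refine ⟨hm.frame (frame_run initCmd m), fun x => ?_, fun x => ?_⟩
    · have := (key x x.2).2
      simp only [initCmd, run_seq, run_store, Memory.setCell_reg, Memory.setCell_arr,
        AExp.eval_reg, AExp.eval_one, e10, e11, hu, hv]
      by_cases h₁ : x = u <;> by_cases h₂ : x = v <;>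
        simp [Function.update_apply, Fin.val_inj, h₁, h₂, this]
    · have := (key x x.2).1
      simp only [initCmd, run_seq, run_store, Memory.setCell_reg, Memory.setCell_arr,
        AExp.eval_reg, AExp.eval_one, e10, e11, hu, hv]
      by_cases h₂ : x = v <;> simp [Fin.val_inj, h₂, this]
  · intro i hi m' hi' hf hP x hx
    simp only [run_seq, run_store, Memory.setReg_arr, Memory.setCell_arr, Memory.setCell_reg,
      AExp.eval_reg, AExp.eval_zero, hi']
    rcases Nat.lt_succ_iff_lt_or_eq.1 hx with hx | rfl
    · simp [Function.update_apply, hP x hx]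
    · simp

/-- Colour all vertices, starting from the vertices in the registers `10` and `11`. -/
def colourCmd : Cmd := initCmd ;; .loop 13 0 roundCmd

theorem run_colourCmd {m : Memory} (hn : 2 ≤ n) (hG : G.Connected) (hm : Ready G m)
    {u v : Fin n} (huv : u ≠ v) (hu : m.reg 10 = u) (hv : m.reg 11 = v) {f : Fin n → ℝ}
    (hf : CCMPairOutputs G u v f) (x : Fin n) :
    f x = ((colourCmd.run m).arr 10 x : ℝ) / (n.factorial ^ n : ℕ) := by
  set c₀ : Fin n → ℕ := fun x => if x = v then 1 else 0 with hc₀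
  have h₀ := run_initCmd hm hu hv
  set m₁ := initCmd.run m with hm₁
  have hu₁ : m₁.reg 10 = u := by rw [← hu]; exact run_reg initCmd m 10
  have key := run_loop_induction (x := 13) (b := 0) (m := m₁) (c := roundCmd)
    (P := fun i m' => ∃ C c, HoldsColouring G C c m' ∧ {u, v} ⊆ C ∧
      (C = Set.univ ∨ i ≤ C.ncard) ∧
      SlopeSteps (fracState G {u, v} c₀ 1) (fracState G C c (n.factorial ^ i))) ?_ ?_
  · rw [h₀.ready.reg_zero] at key
    obtain ⟨C, c, hH, hsub, hcard, hsteps⟩ := key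
    have hC : C = Set.univ := by
      rcases hcard with h | h
      · exact h
      · refine Set.eq_of_subset_of_ncard_le (Set.subset_univ C) ?_ (Set.toFinite _)
        rwa [Set.ncard_univ, Nat.card_fin]
    -- The machine starts without the edge between u and v, if there is one, while the procedure
    -- starts with all of `G`. This is harmless, as both ends are precoloured.
    rw [hf.eq_colour hsteps hC (fun x y h => h.1) (fun x y h hn => mem_of_not_deleteInside h hn)
      rfl huv (by simp [fracState, hc₀, huv]) (by simp [fracState, hc₀])]
    simp only [fracState]
    rw [← hH.colour x]
    rfl
  · refine ⟨{u, v}, c₀, ⟨h₀.ready.of_eq rfl rfl rfl rfl rfl, h₀.set, h₀.colour⟩, subset_rfl,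
      Or.inr (Nat.zero_le _), ?_⟩
    rw [pow_zero]
  · rintro i hi m' - hfr ⟨C, c, hH, hsub, hcard, hsteps⟩
    have hu' : m'.reg 10 = u := by rw [← hu₁]; exact hfr.reg 10 rfl
    obtain ⟨C', c', hH', hsub', hcard', hsteps'⟩ :=
      run_roundCmd hn hG hH hu' (hsub (by simp))
    refine ⟨C', c', ⟨hH'.ready.of_eq rfl rfl rfl rfl rfl, hH'.set, hH'.colour⟩, hsub.trans hsub', ?_,
      hsteps.trans ?_⟩
    · rcases hcard' with h | h
      · exact Or.inl (Set.univ_subset_iff.1 (h ▸ hsub'))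
      · rcases hcard with h' | h'
        · exact Or.inl (Set.univ_subset_iff.1 (h' ▸ hsub'))
        · exact Or.inr (by omega)
    · rw [pow_succ]
      exact hsteps' _ (pow_pos n.factorial_pos i)

end Round

/-! ## Sorting by rank -/

/-- The number of indices below `N` whose value precedes that of `p` in decreasing order, ties being
broken by the index. -/
def rank (t : ℕ → ℕ) (N p : ℕ) : ℕ :=
  ((Finset.range N).filter fun q => t p < t q ∨ (t q = t p ∧ q < p)).card

theorem rank_lt {t : ℕ → ℕ} {N p : ℕ} (hp : p < N) : rank t N p < N := by
  refine (Finset.card_lt_card (t := Finset.range N) ?_).trans_eq (Finset.card_range N)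
  refine Finset.filter_ssubset.2 ⟨p, Finset.mem_range.2 hp, ?_⟩
  simp

theorem rank_lt_rank {t : ℕ → ℕ} {N p q : ℕ} (hq : q < N)
    (h : t p < t q ∨ (t q = t p ∧ q < p)) : rank t N q < rank t N p := by
  refine Finset.card_lt_card (Finset.ssubset_iff_subset_ne.2 ⟨fun a ha => ?_, fun heq => ?_⟩)
  · simp only [Finset.mem_filter, Finset.mem_range] at ha ⊢
    refine ⟨ha.1, ?_⟩
    have := ha.2
    omega
  · have : q ∈ (Finset.range N).filter fun a => t p < t a ∨ (t a = t p ∧ a < p) := by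
      simp [hq, h]
    rw [← heq] at this
    simp at this

theorem rank_injOn (t : ℕ → ℕ) (N : ℕ) : Set.InjOn (rank t N) (Finset.range N : Set ℕ) := by
  intro p hp q hq h
  simp only [Finset.coe_range, Set.mem_Iio] at hp hq
  by_contra hpq
  have : (t p < t q ∨ (t q = t p ∧ q < p)) ∨ (t q < t p ∨ (t p = t q ∧ p < q)) := by omega
  rcases this with h' | h'
  · exact (rank_lt_rank hq h').ne h.symm
  · exact (rank_lt_rank hp h').ne h

/-- Breaking ties by index makes the rank a permutation of `range N`, and a larger value always has
a smaller rank. -/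
theorem map_range_eq_sort {t S : ℕ → ℕ} {N : ℕ} (h : ∀ p < N, S (rank t N p) = t p) :
    (List.range N).map S = ((Multiset.range N).map t).sort (fun a b => b ≤ a) := by
  have himg : (Finset.range N).image (rank t N) = Finset.range N := by
    refine Finset.eq_of_subset_of_card_le (fun i hi => ?_) ?_
    · obtain ⟨p, hp, rfl⟩ := Finset.mem_image.1 hi
      exact Finset.mem_range.2 (rank_lt (Finset.mem_range.1 hp))
    · rw [Finset.card_image_of_injOn (rank_injOn t N)]
  have hsurj : ∀ i < N, ∃ p < N, rank t N p = i := fun i hi => by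
    have : i ∈ (Finset.range N).image (rank t N) := by
      rw [himg]
      exact Finset.mem_range.2 hi
    simpa using this
  refine (sort_eq_of_perm ?_ ?_).symm
  · rw [List.pairwise_map]
    refine List.pairwise_lt_range.imp_of_mem ?_
    intro i j hi hj hij
    obtain ⟨p, hp, rfl⟩ := hsurj i (List.mem_range.1 hi)
    obtain ⟨q, hq, rfl⟩ := hsurj j (List.mem_range.1 hj)
    rw [h p hp, h q hq]
    by_contra! hlt
    exact (rank_lt_rank (t := t) hq (Or.inl hlt)).not_gt hij
  · have h₁ : (((List.range N).map S : List ℕ) : Multiset ℕ) = (Finset.range N).val.map S := rfl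
    have h₂ : (Multiset.range N).map t = (Finset.range N).val.map t := rfl
    rw [h₁, h₂]
    conv_lhs => rw [← himg, Finset.image_val_of_injOn (rank_injOn t N), Multiset.map_map]
    exact Multiset.map_congr rfl fun p hp => h p (Finset.mem_range.1 hp)

/-! ## Padded gradation vectors -/

theorem map_lt_map {α β : Type*} [LinearOrder α] [LinearOrder β] {f : α → β} (hf : StrictMono f) :
    ∀ {l l' : List α}, l < l' → l.map f < l'.map f
  | [], [], h => absurd h (lt_irrefl _)
  | [], _ :: _, _ => List.nil_lt_cons _ _
  | _ :: _, [], h => absurd h (List.not_lt_nil _)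
  | a :: l, b :: l', h => by
    rw [List.map_cons, List.map_cons]
    rcases List.cons_lt_cons_iff.1 h with hab | ⟨rfl, hl⟩
    · exact List.cons_lt_cons_iff.2 (Or.inl (hf hab))
    · exact List.cons_lt_cons_iff.2 (Or.inr ⟨rfl, map_lt_map hf hl⟩)

theorem append_lt_append {α : Type*} [LinearOrder α] (z : List α) :
    ∀ {l l' : List α}, l.length = l'.length → l < l' → l ++ z < l' ++ z
  | [], [], _, h => absurd h (lt_irrefl _)
  | [], _ :: _, h, _ => by simp at h
  | _ :: _, [], h, _ => by simp at h
  | a :: l, b :: l', h, h' => by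
    rw [List.cons_append, List.cons_append]
    rcases List.cons_lt_cons_iff.1 h' with hab | ⟨rfl, hl⟩
    · exact List.cons_lt_cons_iff.2 (Or.inl hab)
    · exact List.cons_lt_cons_iff.2 (Or.inr ⟨rfl, append_lt_append z (by simpa using h) hl⟩)

section Padded

variable {n : ℕ}

open Classical in
/-- The edges of `G`, as pairs of vertices in increasing order. -/
noncomputable def edgePairs (G : SimpleGraph (Fin n)) : Finset (Fin n × Fin n) :=
  Finset.univ.filter fun p => p.1 < p.2 ∧ G.Adj p.1 p.2

/-- The distance of two natural numbers. -/
def natDist (a b : ℕ) : ℕ := (a - b) + (b - a)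

theorem cast_natDist (a b : ℕ) : (natDist a b : ℝ) = |(a : ℝ) - b| := by
  rw [natDist]
  rcases le_total a b with h | h
  · rw [Nat.sub_eq_zero_of_le h, zero_add, Nat.cast_sub h, abs_of_nonpos, neg_sub]
    rw [sub_nonpos]
    exact_mod_cast h
  · rw [Nat.sub_eq_zero_of_le h, add_zero, Nat.cast_sub h, abs_of_nonneg]
    rw [sub_nonneg]
    exact_mod_cast h

/-- The sorted list of the tones of all edges under an integral colouring. -/
noncomputable def toneVector (G : SimpleGraph (Fin n)) (c : Fin n → ℕ) : List ℕ :=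
  ((edgePairs G).val.map fun p => natDist (c p.1) (c p.2)).sort (fun a b => b ≤ a)

open Classical in
/-- The tone of an edge, given as an increasing pair, and zero for all other pairs. -/
noncomputable def pairTone (G : SimpleGraph (Fin n)) (c : Fin n → ℕ) (x y : Fin n) : ℕ :=
  if x < y ∧ G.Adj x y then natDist (c x) (c y) else 0

/-- The tones of all pairs of vertices, in decreasing order. -/
noncomputable def paddedVector (G : SimpleGraph (Fin n)) (c : Fin n → ℕ) : List ℕ :=
  ((Finset.univ : Finset (Fin n × Fin n)).val.map fun p => pairTone G c p.1 p.2).sort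
    (fun a b => b ≤ a)

variable (G : SimpleGraph (Fin n)) (c : Fin n → ℕ)

theorem length_toneVector : (toneVector G c).length = (edgePairs G).card := by
  rw [toneVector, Multiset.length_sort, Multiset.card_map, Finset.card_def]

theorem card_edgePairs_le : (edgePairs G).card ≤ n * n := by
  refine (Finset.card_le_univ _).trans_eq ?_
  rw [Fintype.card_prod, Fintype.card_fin]

/-- The zeros of the other pairs sort to the end of a decreasing list. So the padded vectors all
have length n * n and begin with the genuine tones. -/
theorem paddedVector_eq : paddedVector G c =
    toneVector G c ++ List.replicate (n * n - (edgePairs G).card) 0 := by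
  classical
  refine sort_eq_of_perm ?_ ?_
  · rw [List.pairwise_append]
    refine ⟨Multiset.pairwise_sort _ _, ?_, fun a _ b hb => ?_⟩
    · simp [List.pairwise_replicate]
    · rw [List.eq_of_mem_replicate hb]
      exact Nat.zero_le a
  · have h : (Finset.univ : Finset (Fin n × Fin n)).val =
        (edgePairs G).val + (Finset.univ.filter fun p => ¬ (p.1 < p.2 ∧ G.Adj p.1 p.2)).val := by
      rw [edgePairs, Finset.filter_val, Finset.filter_val, Multiset.filter_add_not]
    rw [h, Multiset.map_add, ← Multiset.coe_add, toneVector, Multiset.sort_eq]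
    congr 1
    · refine Multiset.map_congr rfl fun p hp => ?_
      have : p ∈ edgePairs G := hp
      rw [edgePairs, Finset.mem_filter] at this
      rw [pairTone, if_pos this.2]
    · rw [Multiset.coe_replicate]
      refine (Multiset.eq_replicate.2 ⟨?_, fun b hb => ?_⟩).symm
      · rw [Multiset.card_map, ← Finset.card_def, edgePairs]
        have := Finset.card_filter_add_card_filter_not (s := (Finset.univ : Finset (Fin n × Fin n)))
          (fun p => p.1 < p.2 ∧ G.Adj p.1 p.2)
        rw [Finset.card_univ, Fintype.card_prod, Fintype.card_fin] at this
        omega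
      · obtain ⟨p, hp, rfl⟩ := Multiset.mem_map.1 hb
        have : p ∈ Finset.univ.filter fun p : Fin n × Fin n => ¬ (p.1 < p.2 ∧ G.Adj p.1 p.2) := hp
        rw [Finset.mem_filter] at this
        rw [pairTone, if_neg this.2]

theorem gradVector_eq_map {Q : ℕ} (hQ : 0 < Q) {f : Fin n → ℝ} (hf : ∀ x, f x = (c x : ℝ) / Q) :
    gradVector G f = (toneVector G c).map fun a : ℕ => (a : ℝ) / Q := by
  classical
  have hQ' : (0 : ℝ) < Q := by exact_mod_cast hQ
  refine sort_eq_of_perm ?_ ?_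
  · rw [List.pairwise_map]
    refine (Multiset.pairwise_sort _ _).imp fun {a b} h => ?_
    have h' : (b : ℝ) ≤ a := by exact_mod_cast h
    gcongr
  · have himg : G.edgeFinset.val = (edgePairs G).val.map fun p => s(p.1, p.2) := by
      have hinj : Set.InjOn (fun p : Fin n × Fin n => s(p.1, p.2)) (edgePairs G) := by
        rintro ⟨a, b⟩ hp ⟨a', b'⟩ hp' h
        simp only [edgePairs, Finset.coe_filter, Finset.mem_univ, true_and,
          Set.mem_ofPred_eq] at hp hp'
        rcases Sym2.eq_iff.1 h with ⟨h₁, h₂⟩ | ⟨h₁, h₂⟩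
        · simp only at h₁ h₂
          rw [h₁, h₂]
        · simp only at h₁ h₂
          subst h₁ h₂
          exact absurd hp.1 hp'.1.asymm
      rw [← Finset.image_val_of_injOn hinj]
      congr 1
      ext e
      induction e using Sym2.ind with
      | h a b =>
        simp only [SimpleGraph.mem_edgeFinset, SimpleGraph.mem_edgeSet, Finset.mem_image, edgePairs,
          Finset.mem_filter, Finset.mem_univ, true_and, Prod.exists]
        constructor
        · intro h
          rcases lt_or_gt_of_ne h.ne with hab | hab
          · exact ⟨a, b, ⟨hab, h⟩, rfl⟩
          · exact ⟨b, a, ⟨hab, h.symm⟩, Sym2.eq_swap⟩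
        · rintro ⟨x, y, ⟨-, h⟩, he⟩
          rcases Sym2.eq_iff.1 he with ⟨rfl, rfl⟩ | ⟨rfl, rfl⟩
          · exact h
          · exact h.symm
    rw [← Multiset.map_coe, toneVector, Multiset.sort_eq, Multiset.map_map]
    have e : (G.edgeFinset.val.map (edgeTone f)) =
        (edgePairs G).val.map fun p => |f p.1 - f p.2| := by
      rw [himg, Multiset.map_map]
      rfl
    refine Eq.trans ?_ (Eq.trans e.symm ?_)
    · refine Multiset.map_congr rfl fun p _ => ?_
      rw [Function.comp_apply, cast_natDist, hf, hf, ← sub_div, abs_div, abs_of_pos hQ']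
    · congr!

variable {G c} {c' : Fin n → ℕ} {f f' : Fin n → ℝ} {Q : ℕ}

theorem gradVector_le_of_paddedVector_le (hQ : 0 < Q) (hf : ∀ x, f x = (c x : ℝ) / Q)
    (hf' : ∀ x, f' x = (c' x : ℝ) / Q) (h : paddedVector G c ≤ paddedVector G c') :
    gradVector G f ≤ gradVector G f' := by
  have hQ' : (0 : ℝ) < Q := by exact_mod_cast hQ
  rw [gradVector_eq_map G c hQ hf, gradVector_eq_map G c' hQ hf']
  have hle : toneVector G c ≤ toneVector G c' := by
    by_contra! hlt
    refine h.not_gt ?_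
    rw [paddedVector_eq, paddedVector_eq]
    -- Both tone vectors have one entry per edge, hence the same length and the same padding, which
    -- cannot reverse their order.
    exact append_lt_append _ ((length_toneVector G c').trans (length_toneVector G c).symm) hlt
  rcases hle.eq_or_lt with h | h
  · rw [h]
  · refine (map_lt_map (fun a b hab => ?_) h).le
    have hab' : (a : ℝ) < b := by exact_mod_cast hab
    exact div_lt_div_of_pos_right hab' hQ'

end Padded

/-! ## Nested loops -/

/-- The single counter i * n + j replaces two nested invariants. For this `P` must be insensitive to
the two loop registers. -/
theorem Cmd.run_loop_loop {x y n : ℕ} {c : Cmd} {m : Memory} (P : ℕ → Memory → Prop)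
    (hn : m.reg 0 = n) (h0 : P 0 m)
    (hs : ∀ i < n, ∀ j < n, ∀ m', m'.reg x = i → m'.reg y = j →
      (Cmd.loop x 0 (.loop y 0 c)).Frame m m' → P (i * n + j) m' → P (i * n + j + 1) (c.run m'))
    (hP : ∀ N m' k, P N m' → P N (m'.setReg x k) ∧ P N (m'.setReg y k))
    (h₁ : (Cmd.loop x 0 (.loop y 0 c)).writesReg 0 = false := by rfl)
    (h₂ : (Cmd.loop y 0 c).writesReg x = false := by rfl) :
    P (n * n) ((Cmd.loop x 0 (.loop y 0 c)).run m) := by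
  have key := run_loop_induction (x := x) (b := 0) (c := .loop y 0 c) (m := m)
    (P := fun i m' => P (i * n) m') ?_ ?_
  · rwa [hn] at key
  · rw [zero_mul]
    exact (hP 0 m 0 h0).1
  · intro i hi m₁ hi₁ hf₁ hP₁
    have hn₁ : m₁.reg 0 = n := (hf₁.reg 0 h₁).trans hn
    have key := run_loop_induction (x := y) (b := 0) (c := c) (m := m₁)
      (P := fun j m' => P (i * n + j) m') ?_ ?_
    · rw [hn₁] at key
      rw [add_mul, one_mul]
      exact (hP _ _ _ key).1
    · exact (hP _ _ _ hP₁).2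
    · intro j hj m₂ hj₂ hf₂ hP₂
      refine (hP _ _ _ (hs i (hn ▸ hi) j (hn₁ ▸ hj) m₂ ?_ hj₂ ⟨fun z hz => ?_, fun a ha => ?_⟩
        hP₂)).2
      · rw [hf₂.reg x h₂, hi₁]
      · have hz' := hz
        simp only [writesReg, Bool.or_eq_false_iff] at hz'
        rw [hf₂.reg z (by simp [writesReg, hz'.2]), hf₁.reg z hz]
      · rw [hf₂.arr a ha, hf₁.arr a ha]

section Vector

variable {n : ℕ} {G : SimpleGraph (Fin n)} {c : Fin n → ℕ}

/-! ## Computing and comparing sorted vectors -/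

/-- Array `13` becomes the table of the tones of all pairs of vertices, for the colouring that starts
in array `5` at the position in register `53`. -/
def tonesCmd : Cmd :=
  .loop 54 0 (.loop 55 0 (.assign 56 0 ;;
    when (.reg 55 - .reg 54) (when (.cell 0 (.cell 9 (.reg 54) + .reg 55))
      (.assign 56 ((.cell 5 (.reg 53 + .reg 54) - .cell 5 (.reg 53 + .reg 55)) +
        (.cell 5 (.reg 53 + .reg 55) - .cell 5 (.reg 53 + .reg 54))))) ;;
    .store 13 (.cell 9 (.reg 54) + .reg 55) (.reg 56)))

theorem run_tonesCmd {m : Memory} (hm : Ready G m) (hc : ∀ x : Fin n, m.arr 5 (m.reg 53 + x) = c x)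
    (x y : Fin n) : (tonesCmd.run m).arr 13 (x * n + y) = pairTone G c x y := by
  refine run_loop_loop (P := fun N m' => ∀ x y : Fin n, x * n + y < N →
    m'.arr 13 (x * n + y) = pairTone G c x y) hm.reg_zero (by simp) ?_
    (fun N m' k h => ⟨h, h⟩) rfl rfl x y (mul_add_lt x.2 y.2)
  intro i hi j hj m' hi' hj' hf hP x y hlt
  have hm' := hm.frame hf
  have e5 : m'.arr 5 = m.arr 5 := hf.arr 5 rfl
  have e53 : m'.reg 53 = m.reg 53 := hf.reg 53 rfl
  have hci := hc ⟨i, hi⟩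
  have hcj := hc ⟨j, hj⟩
  have hadj := hm'.adj ⟨i, hi⟩ ⟨j, hj⟩
  have ht : m'.arr 9 i = i * n := hm'.table i (hi.trans_le (Nat.le_mul_self n))
  simp only at hci hcj hadj
  have key : ∀ m'' : Memory, m'' = (Cmd.assign 56 0 ;; when (.reg 55 - .reg 54)
      (when (.cell 0 (.cell 9 (.reg 54) + .reg 55))
      (.assign 56 ((.cell 5 (.reg 53 + .reg 54) - .cell 5 (.reg 53 + .reg 55)) +
        (.cell 5 (.reg 53 + .reg 55) - .cell 5 (.reg 53 + .reg 54)))))).run m' →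
      m''.reg 56 = pairTone G c ⟨i, hi⟩ ⟨j, hj⟩ ∧ m''.reg 54 = i ∧ m''.reg 55 = j ∧
        m''.arr = m'.arr := by
    rintro _ rfl
    refine ⟨?_, ?_, ?_, ?_⟩
    · simp only [run_seq, run_assign, run_when, AExp.eval_sub, AExp.eval_reg, AExp.eval_cell,
        AExp.eval_add, AExp.eval_zero, Memory.setReg_reg, Memory.setReg_arr]
      by_cases hij : i < j
      · have : j - i ≠ 0 := by omega
        by_cases hA : G.Adj ⟨i, hi⟩ ⟨j, hj⟩ <;>
          simp [hi', hj', ht, hadj, this, hA, e5, e53, hci, hcj, pairTone, hij, natDist]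
      · have : j - i = 0 := by omega
        simp [hi', hj', this, pairTone, hij]
    · rw [run_reg _ _ 54, hi']
    · rw [run_reg _ _ 55, hj']
    · funext a
      rw [run_arr _ _ a]
  simp only [run_seq] at key ⊢
  obtain ⟨h₁, h₂, h₃, h₄⟩ := key _ rfl
  simp only [run_store, Memory.setCell_arr, if_pos, AExp.eval_add, AExp.eval_cell, AExp.eval_reg,
    h₁, h₂, h₃, h₄, ht, Function.update_apply]
  split_ifs with heq
  · obtain ⟨h₅, h₆⟩ := mul_add_inj y.2 hj heq
    obtain rfl : x = ⟨i, hi⟩ := Fin.ext h₅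
    obtain rfl : y = ⟨j, hj⟩ := Fin.ext h₆
    rfl
  · exact hP x y (by omega)

/-- Register `59` becomes the rank of the index in register `57` in array `13`. -/
def rankCmd : Cmd :=
  .assign 59 0 ;; .loop 58 3
    (.ite (.cell 13 (.reg 58) - .cell 13 (.reg 57)) (.assign 59 (.reg 59 + 1))
      (when (1 - (.cell 13 (.reg 57) - .cell 13 (.reg 58)))
        (when (.reg 57 - .reg 58) (.assign 59 (.reg 59 + 1)))))

theorem run_rankCmd (m : Memory) :
    (rankCmd.run m).reg 59 = rank (m.arr 13) (m.reg 3) (m.reg 57) := by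
  refine run_loop_induction (x := 58) (b := 3) (m := m.setReg 59 0)
    (P := fun i m' => m'.reg 59 = rank (m.arr 13) i (m.reg 57)) (by simp [rank]) ?_
  intro i hi m' hi' hf hP
  have e57 : m'.reg 57 = m.reg 57 := by simpa using hf.reg 57 rfl
  have e13 : m'.arr 13 = m.arr 13 := hf.arr 13 rfl
  generalize m.reg 57 = p at *
  have hrank : rank (m.arr 13) (i + 1) p = rank (m.arr 13) i p +
      if m.arr 13 p < m.arr 13 i ∨ (m.arr 13 i = m.arr 13 p ∧ i < p) then 1 else 0 := by
    rw [rank, Finset.range_add_one, Finset.filter_insert]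
    split_ifs with h
    · rw [Finset.card_insert_of_notMem (by simp), rank]
    · rfl
  rw [hrank, ← hP]
  simp only [run_ite, run_when, AExp.eval_sub, AExp.eval_cell, AExp.eval_reg, AExp.eval_one, e57,
    e13, hi', run_assign, Memory.setReg_reg]
  generalize m.arr 13 p = a
  generalize m.arr 13 i = b
  by_cases h₁ : b - a = 0 <;> by_cases h₂ : 1 - (a - b) = 0 <;> by_cases h₃ : p - i = 0 <;>
    simp only [h₁, h₂, h₃, if_true, if_false, Memory.setReg_reg, AExp.eval_add, AExp.eval_reg,
      AExp.eval_one] <;> simp <;> omega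

/-- Array `8` becomes the sorted list of the tones of all pairs of vertices, for the colouring that
starts in array `5` at the position in register `53`. -/
def vectorCmd : Cmd :=
  tonesCmd ;; .loop 57 3 (rankCmd ;; .store 8 (.reg 59) (.cell 13 (.reg 57)))

theorem range_map_eq {t : ℕ → ℕ} {g : Fin n → Fin n → ℕ}
    (h : ∀ x y : Fin n, t (x * n + y) = g x y) :
    (Multiset.range (n * n)).map t =
      (Finset.univ : Finset (Fin n × Fin n)).val.map fun p => g p.1 p.2 := by
  have hinj : Set.InjOn (fun p : Fin n × Fin n => (p.1 : ℕ) * n + p.2)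
      (Finset.univ : Finset (Fin n × Fin n)) := by
    rintro ⟨a, b⟩ - ⟨a', b'⟩ - hab
    obtain ⟨h₁, h₂⟩ := mul_add_inj b.2 b'.2 hab
    exact Prod.ext (Fin.ext h₁) (Fin.ext h₂)
  have himg : (Finset.univ.image fun p : Fin n × Fin n => (p.1 : ℕ) * n + p.2) =
      Finset.range (n * n) := by
    ext i
    simp only [Finset.mem_image, Finset.mem_univ, true_and, Finset.mem_range, Prod.exists]
    constructor
    · rintro ⟨a, b, rfl⟩
      exact mul_add_lt a.2 b.2
    · intro hi
      have hn : 0 < n := Nat.pos_of_ne_zero (by rintro rfl; simp at hi)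
      exact ⟨⟨i / n, Nat.div_lt_of_lt_mul hi⟩, ⟨i % n, Nat.mod_lt _ hn⟩, Nat.div_add_mod' i n⟩
  change (Finset.range (n * n)).val.map t = _
  rw [← himg, Finset.image_val_of_injOn hinj, Multiset.map_map]
  exact Multiset.map_congr rfl fun p _ => h p.1 p.2

/-- Each tone is stored at its rank. Ranks are distinct, so no stored entry is overwritten by
another. -/
theorem run_vectorCmd {m : Memory} (hm : Ready G m)
    (hc : ∀ x : Fin n, m.arr 5 (m.reg 53 + x) = c x) :
    (List.range (n * n)).map ((vectorCmd.run m).arr 8) = paddedVector G c := by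
  have htones := run_tonesCmd hm hc
  have hm₁ := hm.frame (frame_run tonesCmd m)
  rw [vectorCmd, run_seq]
  generalize tonesCmd.run m = m₁ at htones hm₁
  rw [paddedVector, ← range_map_eq htones]
  refine map_range_eq_sort ?_
  have key := run_loop_induction (x := 57) (b := 3) (m := m₁)
    (c := rankCmd ;; .store 8 (.reg 59) (.cell 13 (.reg 57)))
    (P := fun i m' => ∀ p < i, m'.arr 8 (rank (m₁.arr 13) (n * n) p) = m₁.arr 13 p) (by simp) ?_
  · rwa [hm₁.reg_three] at key
  · intro i hi m' hi' hf hP p hp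
    have e13 : m'.arr 13 = m₁.arr 13 := hf.arr 13 rfl
    have e3 : m'.reg 3 = n * n := (hf.reg 3 rfl).trans hm₁.reg_three
    rw [hm₁.reg_three] at hi
    simp only [run_seq, run_store, Memory.setReg_arr, Memory.setCell_arr, if_pos, AExp.eval_reg,
      AExp.eval_cell, run_rankCmd, Function.update_apply]
    rw [run_reg rankCmd _ 57, run_arr rankCmd _ 13, run_arr rankCmd _ 8, hi', e13, e3]
    split_ifs with heq
    · have := rank_injOn (m₁.arr 13) (n * n) (x₁ := p) (x₂ := i)
        (by simp; omega) (by simpa using hi) heq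
      rw [this]
    · refine hP p (lt_of_le_of_ne (Nat.lt_succ_iff.1 hp) ?_)
      rintro rfl
      exact heq rfl

/-- Compare the lists in the arrays `8` and `1`: register `60` becomes `0` if they are equal, `1` if
the first is greater, and `2` if it is less. -/
def lexCmd : Cmd :=
  .assign 60 0 ;; .loop 61 3 (when (1 - .reg 60)
    (.ite (.cell 8 (.reg 61) - .cell 1 (.reg 61)) (.assign 60 1)
      (when (.cell 1 (.reg 61) - .cell 8 (.reg 61)) (.assign 60 2))))

theorem map_range_lt {a b : ℕ → ℕ} {N j : ℕ} (hj : j < N) (h : ∀ k < j, a k = b k)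
    (hlt : a j < b j) : (List.range N).map a < (List.range N).map b := by
  rw [List.lt_iff_exists]
  right
  refine ⟨j, by simpa using hj, by simpa using hj, fun k hk => ?_, ?_⟩
  · simpa using h k hk
  · simpa using hlt

theorem run_lexCmd (m : Memory) :
    let a := (List.range (m.reg 3)).map (m.arr 8)
    let b := (List.range (m.reg 3)).map (m.arr 1)
    ((lexCmd.run m).reg 60 = 0 ∧ a = b) ∨ ((lexCmd.run m).reg 60 = 1 ∧ b < a) ∨
      ((lexCmd.run m).reg 60 = 2 ∧ a < b) := by
  intro a b
  have key := run_loop_induction (x := 61) (b := 3) (m := m.setReg 60 0)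
    (c := when (1 - .reg 60)
      (.ite (.cell 8 (.reg 61) - .cell 1 (.reg 61)) (.assign 60 1)
      (when (.cell 1 (.reg 61) - .cell 8 (.reg 61)) (.assign 60 2))))
    (P := fun i m' => (m'.reg 60 = 0 ∧ ∀ k < i, m.arr 8 k = m.arr 1 k) ∨
      (m'.reg 60 = 1 ∧ ∃ j < i, (∀ k < j, m.arr 1 k = m.arr 8 k) ∧ m.arr 1 j < m.arr 8 j) ∨
      (m'.reg 60 = 2 ∧ ∃ j < i, (∀ k < j, m.arr 8 k = m.arr 1 k) ∧ m.arr 8 j < m.arr 1 j))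
    (by simp) ?_
  · have h3 : (m.setReg 60 0).reg 3 = m.reg 3 := by simp
    rw [h3] at key
    change _ ∨ _ ∨ _ at key
    rw [show lexCmd.run m = _ from rfl]
    refine key.imp (fun h => ⟨h.1, ?_⟩) (Or.imp (fun h => ⟨h.1, ?_⟩) fun h => ⟨h.1, ?_⟩)
    · exact List.map_congr_left fun k hk => h.2 k (List.mem_range.1 hk)
    · obtain ⟨j, hj, h₁, h₂⟩ := h.2
      exact map_range_lt hj h₁ h₂
    · obtain ⟨j, hj, h₁, h₂⟩ := h.2
      exact map_range_lt hj h₁ h₂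
  · intro i hi m' hi' hf hP
    have e8 : m'.arr 8 = m.arr 8 := hf.arr 8 rfl
    have e1 : m'.arr 1 = m.arr 1 := hf.arr 1 rfl
    simp only [run_ite, run_when, AExp.eval_sub, AExp.eval_cell, AExp.eval_reg, AExp.eval_one, e8,
      e1, hi', run_assign, Memory.setReg_reg]
    rcases hP with ⟨h, hP⟩ | ⟨h, j, hj, hP⟩ | ⟨h, j, hj, hP⟩
    · rcases lt_trichotomy (m.arr 8 i) (m.arr 1 i) with hlt | heq | hgt
      · have h₁ : m.arr 8 i - m.arr 1 i = 0 := by omega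
        have h₂ : m.arr 1 i - m.arr 8 i ≠ 0 := by omega
        exact Or.inr (Or.inr ⟨by simp [h, h₁, h₂], i, Nat.lt_succ_self i, hP, hlt⟩)
      · refine Or.inl ⟨by simp [h, heq], fun k hk => ?_⟩
        rcases Nat.lt_succ_iff_lt_or_eq.1 hk with hk | rfl
        · exact hP k hk
        · exact heq
      · have h₁ : m.arr 8 i - m.arr 1 i ≠ 0 := by omega
        exact Or.inr (Or.inl ⟨by simp [h, h₁], i, Nat.lt_succ_self i,
          fun k hk => (hP k hk).symm, hgt⟩)
    · exact Or.inr (Or.inl ⟨by simp [h], j, hj.trans (Nat.lt_succ_self i), hP⟩)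
    · exact Or.inr (Or.inr ⟨by simp [h], j, hj.trans (Nat.lt_succ_self i), hP⟩)

end Vector

/-! ## Filling segments of arrays -/

/-- For all values of the register `x` below the bound in register `b`, store `src` in the array `a`
at the position `off + x`. -/
def fillCmd (x b a : ℕ) (off src : AExp) : Cmd := .loop x b (.store a (off + .reg x) src)

theorem run_fillCmd {x b a : ℕ} {off src : AExp} {m : Memory} {o : ℕ} {s : ℕ → ℕ}
    (hoff : ∀ m', (fillCmd x b a off src).Frame m m' → off.eval m' = o)
    (hsrc : ∀ i < m.reg b, ∀ m', m'.reg x = i → (fillCmd x b a off src).Frame m m' →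
      src.eval m' = s i) (j : ℕ) :
    ((fillCmd x b a off src).run m).arr a j =
      if o ≤ j ∧ j < o + m.reg b then s (j - o) else m.arr a j := by
  refine run_loop_induction (P := fun i m' => ∀ j, m'.arr a j =
    if o ≤ j ∧ j < o + i then s (j - o) else m.arr a j) (fun j => ?_) ?_ j
  · rw [if_neg (by omega)]
    rfl
  · intro i hi m' hi' hf hP j
    simp only [run_store, Memory.setReg_arr, Memory.setCell_arr, if_pos, AExp.eval_add,
      AExp.eval_reg, hoff m' hf, hsrc i hi m' hi' hf, hi', Function.update_apply, hP]
    by_cases h₁ : j = o + i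
    · rw [if_pos h₁, if_pos (by omega), h₁, Nat.add_sub_cancel_left]
    · rw [if_neg h₁]
      by_cases h₂ : o ≤ j ∧ j < o + i
      · rw [if_pos h₂, if_pos (by omega)]
      · rw [if_neg h₂, if_neg (by omega)]

section Passes

variable {n : ℕ} {G : SimpleGraph (Fin n)}

/-! ## The colourings for all pairs -/

/-- Compute the colourings for all pairs of vertices. -/
def pairsCmd : Cmd :=
  .loop 10 0 (.loop 11 0 (colourCmd ;;
    fillCmd 12 0 5 (.cell 9 (.cell 9 (.reg 10) + .reg 11)) (.cell 10 (.reg 12)) ;;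
    fillCmd 12 0 6 (.cell 9 (.cell 9 (.reg 10) + .reg 11)) (.reg 50)))

/-- The arrays `5` and `6` hold the outcome of the procedure for the pairs with index below `N`. -/
def HoldsPairs (G : SimpleGraph (Fin n)) (N : ℕ) (m : Memory) : Prop :=
  ∀ u v : Fin n, u * n + v < N → u ≠ v → ∀ x : Fin n,
    (∀ f : Fin n → ℝ, CCMPairOutputs G u v f →
      f x = (m.arr 5 ((u * n + v) * n + x) : ℝ) / (n.factorial ^ n : ℕ)) ∧
    m.arr 6 ((u * n + v) * n + x) = n.factorial ^ n

theorem Ready.table_pair {m : Memory} (hm : Ready G m) {i j : ℕ} (hi : i < n) (hj : j < n) :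
    m.arr 9 (m.arr 9 i + j) = (i * n + j) * n := by
  rw [hm.table i (hi.trans_le (Nat.le_mul_self n)), hm.table _ (mul_add_lt hi hj)]

theorem run_pairsCmd {m : Memory} (hn : 2 ≤ n) (hG : G.Connected) (hm : Ready G m) :
    HoldsPairs G (n * n) (pairsCmd.run m) := by
  refine run_loop_loop (P := HoldsPairs G) hm.reg_zero
    (fun u v h => absurd h (Nat.not_lt_zero _)) ?_ (fun N m' k h => ⟨h, h⟩)
  intro i hi j hj m' hi' hj' hf hP u v hlt huv x
  have hm' := hm.frame hf
  have hcol := fun h f hf => run_colourCmd (f := f) hn hG hm' (u := ⟨i, hi⟩) (v := ⟨j, hj⟩) h hi'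
    hj' hf
  have fc := frame_run colourCmd m'
  set m₁ := colourCmd.run m' with hm₁
  have hR₁ : Ready G m₁ := hm'.frame fc
  have h10 : m₁.reg 10 = i := (fc.reg 10 rfl).trans hi'
  have h11 : m₁.reg 11 = j := (fc.reg 11 rfl).trans hj'
  have e5 := fc.arr 5 rfl
  have e6 := fc.arr 6 rfl
  have f5 := run_fillCmd (x := 12) (b := 0) (a := 5)
    (off := .cell 9 (.cell 9 (.reg 10) + .reg 11)) (src := .cell 10 (.reg 12)) (m := m₁)
    (o := (i * n + j) * n) (s := m₁.arr 10)
    (fun m'' hf => by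
      simp only [AExp.eval_cell, AExp.eval_add, AExp.eval_reg]
      rw [hf.arr 9 rfl, hf.reg 10 rfl, hf.reg 11 rfl, h10, h11, hR₁.table_pair hi hj])
    (fun i _ m'' hi hf => by
      simp only [AExp.eval_cell, AExp.eval_reg]
      rw [hf.arr 10 rfl, hi])
  set m₂ := (fillCmd 12 0 5 (.cell 9 (.cell 9 (.reg 10) + .reg 11)) (.cell 10 (.reg 12))).run m₁
    with hm₂
  have ff := frame_run
    (fillCmd 12 0 5 (.cell 9 (.cell 9 (.reg 10) + .reg 11)) (.cell 10 (.reg 12))) m₁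
  rw [← hm₂] at ff
  have hR₂ : Ready G m₂ := hR₁.frame ff
  have g10 : m₂.reg 10 = i := (ff.reg 10 rfl).trans h10
  have g11 : m₂.reg 11 = j := (ff.reg 11 rfl).trans h11
  have f6 := run_fillCmd (x := 12) (b := 0) (a := 6)
    (off := .cell 9 (.cell 9 (.reg 10) + .reg 11)) (src := .reg 50) (m := m₂)
    (o := (i * n + j) * n) (s := fun _ => n.factorial ^ n)
    (fun m'' hf => by
      simp only [AExp.eval_cell, AExp.eval_add, AExp.eval_reg]
      rw [hf.arr 9 rfl, hf.reg 10 rfl, hf.reg 11 rfl, g10, g11, hR₂.table_pair hi hj])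
    (fun i _ m'' hi hf => by
      simp only [AExp.eval_reg]
      rw [hf.reg 50 rfl, hR₂.denom])
  rw [hR₁.reg_zero] at f5
  rw [hR₂.reg_zero] at f6
  simp only [run_seq]
  rw [← hm₁, ← hm₂, f6, run_arr _ _ 5, f5]
  have e6' : m₂.arr 6 = m'.arr 6 := (ff.arr 6 rfl).trans e6
  rcases Nat.lt_succ_iff_lt_or_eq.1 hlt with hlt | heq
  · have h₁ := mul_add_lt hlt x.2
    rw [if_neg (by omega), if_neg (by omega), e6', e5]
    exact hP u v hlt huv x
  · obtain ⟨h₁, h₂⟩ := mul_add_inj v.2 hj heq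
    obtain rfl : u = ⟨i, hi⟩ := Fin.ext h₁
    obtain rfl : v = ⟨j, hj⟩ := Fin.ext h₂
    have hx := x.2
    simp only
    rw [if_pos (by omega), if_pos (by omega), Nat.add_sub_cancel_left]
    exact ⟨fun f hf => hcol huv f hf x, rfl⟩

/-! ## The minimum vector -/

/-- The colouring for the pair `u`, `v` that is stored in an array. -/
def pairColour (A : ℕ → ℕ) (u v x : Fin n) : ℕ := A ((u * n + v) * n + x)

/-- The padded vector of the colouring for the pair `u`, `v`. -/
noncomputable def pairVector (G : SimpleGraph (Fin n)) (A : ℕ → ℕ) (u v : Fin n) : List ℕ :=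
  paddedVector G (pairColour A u v)

/-- Compute the vector for the pair of vertices in the registers `10` and `11`, and compare it with
the one in array `1`. -/
def evalCmd : Cmd :=
  .assign 53 (.cell 9 (.cell 9 (.reg 10) + .reg 11)) ;; vectorCmd ;; lexCmd

theorem run_evalCmd {m : Memory} (hm : Ready G m) {u v : Fin n} (hu : m.reg 10 = u)
    (hv : m.reg 11 = v) :
    let a := pairVector G (m.arr 5) u v
    let b := (List.range (n * n)).map (m.arr 1)
    let m' := evalCmd.run m
    m'.reg 53 = (u * n + v) * n ∧ (List.range (n * n)).map (m'.arr 8) = a ∧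
      ((m'.reg 60 = 0 ∧ a = b) ∨ (m'.reg 60 = 1 ∧ b < a) ∨ (m'.reg 60 = 2 ∧ a < b)) := by
  intro a b m'
  have hm' : m' = lexCmd.run (vectorCmd.run (m.setReg 53 ((u * n + v) * n))) := by
    simp only [m', evalCmd, run_seq, run_assign, AExp.eval_cell, AExp.eval_add, AExp.eval_reg, hu,
      hv, hm.table_pair u.2 v.2]
  set m₁ := m.setReg 53 ((u * n + v) * n) with hm₁
  have hR₁ : Ready G m₁ := hm.of_eq rfl rfl rfl rfl rfl
  have hvec := run_vectorCmd (c := pairColour (m.arr 5) u v) hR₁ (fun x => by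
    simp [hm₁, pairColour])
  have fv := frame_run vectorCmd m₁
  set m₂ := vectorCmd.run m₁ with hm₂
  have hlex := run_lexCmd m₂
  rw [(fv.reg 3 rfl).trans hR₁.reg_three, hvec, fv.arr 1 rfl] at hlex
  refine ⟨?_, ?_, ?_⟩
  · rw [hm', run_reg lexCmd _ 53, fv.reg 53 rfl, hm₁]
    simp
  · rw [hm', run_arr lexCmd _ 8, hvec]
    rfl
  · rw [hm']
    exact hlex

/-- Find the minimum of the vectors for all pairs of distinct vertices. -/
def minCmd : Cmd :=
  .assign 51 0 ;; .loop 10 0 (.loop 11 0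
    (when ((.reg 10 - .reg 11) + (.reg 11 - .reg 10)) (evalCmd ;;
      when ((1 - .reg 51) + (.reg 60 - 1))
        (fillCmd 61 3 1 0 (.cell 8 (.reg 61)) ;; .assign 51 1))))

/-- Array `1` holds the minimum of the vectors for the pairs with index below `N`, unless there are
none. -/
def HoldsMin (G : SimpleGraph (Fin n)) (A : ℕ → ℕ) (N : ℕ) (m : Memory) : Prop :=
  (m.reg 51 = 0 ∧ ∀ u v : Fin n, u ≠ v → ¬ u * n + v < N) ∨
  (m.reg 51 = 1 ∧ (∃ u v : Fin n, u ≠ v ∧ (List.range (n * n)).map (m.arr 1) = pairVector G A u v) ∧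
    ∀ u v : Fin n, u ≠ v → u * n + v < N → (List.range (n * n)).map (m.arr 1) ≤ pairVector G A u v)

theorem run_minCmd {m : Memory} (hm : Ready G m) :
    HoldsMin G (m.arr 5) (n * n) (minCmd.run m) := by
  have hR : Ready G (m.setReg 51 0) := hm.of_eq rfl rfl rfl rfl rfl
  refine run_loop_loop (m := m.setReg 51 0) (P := HoldsMin G (m.arr 5)) hR.reg_zero
    (Or.inl ⟨by simp, fun u v _ => Nat.not_lt_zero _⟩) ?_ (fun N m' k h => ?_)
  swap
  · simp only [HoldsMin, Memory.setReg_reg, Memory.setReg_arr]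
    exact ⟨h, h⟩
  intro i hi j hj m' hi' hj' hf hP
  have hR' := hR.frame hf
  have e5 : m'.arr 5 = m.arr 5 := hf.arr 5 rfl
  rw [run_when]
  simp only [AExp.eval_add, AExp.eval_sub, AExp.eval_reg, hi', hj']
  have hsplit : ∀ u v : Fin n, u ≠ v → u * n + v < i * n + j + 1 →
      u * n + v < i * n + j ∨ (u = ⟨i, hi⟩ ∧ v = ⟨j, hj⟩) := by
    intro u v _ h
    refine (Nat.lt_succ_iff_lt_or_eq.1 h).imp_right fun h => ?_
    obtain ⟨h₁, h₂⟩ := mul_add_inj v.2 hj h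
    exact ⟨Fin.ext h₁, Fin.ext h₂⟩
  by_cases hij : i = j
  · rw [if_pos (by omega)]
    have hne : ∀ u v : Fin n, u ≠ v → u * n + v < i * n + j + 1 → u * n + v < i * n + j := by
      intro u v huv h
      rcases hsplit u v huv h with h | ⟨rfl, rfl⟩
      · exact h
      · exact absurd (Fin.ext hij) huv
    rcases hP with ⟨h₁, h₂⟩ | ⟨h₁, h₂, h₃⟩
    · exact Or.inl ⟨h₁, fun u v huv h => h₂ u v huv (hne u v huv h)⟩
    · exact Or.inr ⟨h₁, h₂, fun u v huv h => h₃ u v huv (hne u v huv h)⟩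
  rw [if_neg (by omega), run_seq]
  have huv : (⟨i, hi⟩ : Fin n) ≠ ⟨j, hj⟩ := fun h => hij (Fin.ext_iff.1 h)
  obtain ⟨-, hvec, hcmp⟩ := run_evalCmd hR' (u := ⟨i, hi⟩) (v := ⟨j, hj⟩) hi' hj'
  rw [e5] at hvec hcmp
  have fe := frame_run evalCmd m'
  set m₁ := evalCmd.run m' with hm₁
  have e51 := fe.reg 51 rfl
  have e1 := fe.arr 1 rfl
  have e3 : m₁.reg 3 = n * n := (hR'.frame fe).reg_three
  have hfill : (List.range (n * n)).map
      (((fillCmd 61 3 1 0 (.cell 8 (.reg 61))).run m₁).arr 1) =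
        (List.range (n * n)).map (m₁.arr 8) := by
    refine List.map_congr_left fun k hk => ?_
    rw [run_fillCmd (o := 0) (s := m₁.arr 8) (fun _ _ => rfl) (fun i _ m'' hi hf => by
      simp only [AExp.eval_cell, AExp.eval_reg]
      rw [hf.arr 8 rfl, hi]), if_pos (by simpa [e3] using hk), Nat.sub_zero]
  -- The guard is zero exactly when some vector is already stored and the new one is not smaller.
  -- The flag in register `51` is needed because array `1` has no meaning before the first pair.
  rw [run_when]
  simp only [AExp.eval_add, AExp.eval_sub, AExp.eval_reg, AExp.eval_one, e51]
  split_ifs with hcond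
  · rcases hP with ⟨h₁, -⟩ | ⟨h₁, h₂, h₃⟩
    · omega
    · refine Or.inr ⟨e51.trans h₁, by rw [e1]; exact h₂, fun u v huv h => ?_⟩
      rw [e1]
      rcases hsplit u v huv h with h | ⟨rfl, rfl⟩
      · exact h₃ u v huv h
      · rcases hcmp with ⟨-, h⟩ | ⟨-, h⟩ | ⟨h, -⟩
        · exact h.ge
        · exact h.le
        · omega
  · right
    simp only [run_seq, run_assign, Memory.setReg_arr, hfill, hvec]
    refine ⟨by simp, ⟨_, _, huv, rfl⟩, fun u v huv h => ?_⟩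
    rcases hsplit u v huv h with h | ⟨rfl, rfl⟩
    · rcases hP with ⟨-, h₂⟩ | ⟨h₁, -, h₃⟩
      · exact absurd h (h₂ u v huv)
      · refine le_trans ?_ (h₃ u v huv h)
        rcases hcmp with ⟨h, -⟩ | ⟨h, -⟩ | ⟨-, h⟩
        · omega
        · omega
        · exact h.le
    · exact le_rfl

/-! ## The list of all minimum colourings -/

/-- List the colourings whose vector is the one in array `1`. -/
def listCmd : Cmd :=
  .assign 2 0 ;; .assign 52 0 ;; .loop 10 0 (.loop 11 0
    (when ((.reg 10 - .reg 11) + (.reg 11 - .reg 10)) (evalCmd ;;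
      when (1 - .reg 60)
        (fillCmd 12 0 3 (.reg 52) (.cell 5 (.reg 53 + .reg 12)) ;;
          fillCmd 12 0 4 (.reg 52) (.reg 50) ;; .assign 52 (.reg 52 + .reg 0) ;;
          .assign 2 (.reg 2 + 1)))))

/-- The `k`-th colouring of the list is the one for the pair `u`, `v`. -/
def IsListed (A : ℕ → ℕ) (m : Memory) (k : ℕ) (u v : Fin n) : Prop :=
  ∀ x : Fin n, m.arr 3 (k * n + x) = pairColour A u v x ∧ m.arr 4 (k * n + x) = n.factorial ^ n

/-- The arrays `3` and `4` hold the list of the colourings whose vector is `γ`, for the pairs with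
index below `N`. -/
structure HoldsList (G : SimpleGraph (Fin n)) (A : ℕ → ℕ) (γ : List ℕ) (N : ℕ)
    (m : Memory) : Prop where
  offset : m.reg 52 = m.reg 2 * n
  sound : ∀ k < m.reg 2, ∃ u v : Fin n, u ≠ v ∧ pairVector G A u v = γ ∧ IsListed A m k u v
  complete : ∀ u v : Fin n, u ≠ v → u * n + v < N → pairVector G A u v = γ →
    ∃ k < m.reg 2, IsListed A m k u v

theorem run_listCmd {m : Memory} (hm : Ready G m) :
    HoldsList G (m.arr 5) ((List.range (n * n)).map (m.arr 1)) (n * n) (listCmd.run m) := by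
  set γ := (List.range (n * n)).map (m.arr 1) with hγ
  have hR : Ready G ((m.setReg 2 0).setReg 52 0) := hm.of_eq rfl rfl rfl rfl rfl
  refine run_loop_loop (m := (m.setReg 2 0).setReg 52 0) (P := HoldsList G (m.arr 5) γ)
    hR.reg_zero ⟨by simp, by simp, fun u v _ h => absurd h (Nat.not_lt_zero _)⟩ ?_
    (fun N m' k h => ?_)
  swap
  · obtain ⟨h₁, h₂, h₃⟩ := h
    exact ⟨⟨h₁, h₂, h₃⟩, ⟨h₁, h₂, h₃⟩⟩
  intro i hi j hj m' hi' hj' hf hP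
  have hR' := hR.frame hf
  have e5 : m'.arr 5 = m.arr 5 := hf.arr 5 rfl
  have e1 : m'.arr 1 = m.arr 1 := hf.arr 1 rfl
  have hsplit : ∀ u v : Fin n, u ≠ v → u * n + v < i * n + j + 1 →
      u * n + v < i * n + j ∨ (u = ⟨i, hi⟩ ∧ v = ⟨j, hj⟩) := by
    intro u v _ h
    refine (Nat.lt_succ_iff_lt_or_eq.1 h).imp_right fun h => ?_
    obtain ⟨h₁, h₂⟩ := mul_add_inj v.2 hj h
    exact ⟨Fin.ext h₁, Fin.ext h₂⟩
  rw [run_when]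
  simp only [AExp.eval_add, AExp.eval_sub, AExp.eval_reg, hi', hj']
  by_cases hij : i = j
  · rw [if_pos (by omega)]
    refine ⟨hP.offset, hP.sound, fun u v huv h => ?_⟩
    rcases hsplit u v huv h with h | ⟨rfl, rfl⟩
    · exact hP.complete u v huv h
    · exact absurd (Fin.ext hij) huv
  rw [if_neg (by omega), run_seq]
  have huv : (⟨i, hi⟩ : Fin n) ≠ ⟨j, hj⟩ := fun h => hij (Fin.ext_iff.1 h)
  obtain ⟨h53, -, hcmp⟩ := run_evalCmd hR' (u := ⟨i, hi⟩) (v := ⟨j, hj⟩) hi' hj'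
  rw [e5, e1, ← hγ] at hcmp
  have fe := frame_run evalCmd m'
  set m₁ := evalCmd.run m' with hm₁
  have hR₁ : Ready G m₁ := hR'.frame fe
  have g2 := fe.reg 2 rfl
  have g52 := fe.reg 52 rfl
  have g3 := fe.arr 3 rfl
  have g4 := fe.arr 4 rfl
  have g5 : m₁.arr 5 = m.arr 5 := (fe.arr 5 rfl).trans e5
  by_cases hcond : 1 - m₁.reg 60 = 0
  · rw [run_when, if_pos (show AExp.eval m₁ (1 - .reg 60) = 0 from hcond)]
    have hne : pairVector G (m.arr 5) ⟨i, hi⟩ ⟨j, hj⟩ ≠ γ := by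
      rcases hcmp with ⟨h, -⟩ | ⟨-, h⟩ | ⟨-, h⟩
      · omega
      · exact h.ne'
      · exact h.ne
    refine ⟨by rw [g52, g2]; exact hP.offset, ?_, fun u v huv h => ?_⟩
    · simp only [IsListed, g2, g3, g4]
      exact hP.sound
    · simp only [IsListed, g2, g3, g4]
      rcases hsplit u v huv h with h | ⟨rfl, rfl⟩
      · exact hP.complete u v huv h
      · exact fun h => absurd h hne
  · rw [run_when, if_neg (show ¬ AExp.eval m₁ (1 - .reg 60) = 0 from hcond)]
    have heq : pairVector G (m.arr 5) ⟨i, hi⟩ ⟨j, hj⟩ = γ := by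
      rcases hcmp with ⟨-, h⟩ | ⟨h, -⟩ | ⟨h, -⟩
      · exact h
      · omega
      · omega
    have f3 := run_fillCmd (x := 12) (b := 0) (a := 3) (off := .reg 52)
      (src := .cell 5 (.reg 53 + .reg 12)) (m := m₁) (o := m'.reg 2 * n)
      (s := fun x => m.arr 5 ((i * n + j) * n + x))
      (fun m'' hf => by rw [AExp.eval_reg, hf.reg 52 rfl, g52, hP.offset])
      (fun x _ m'' hx hf => by
        simp only [AExp.eval_cell, AExp.eval_add, AExp.eval_reg]
        rw [hf.arr 5 rfl, hf.reg 53 rfl, hx, h53, g5])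
    set m₂ := (fillCmd 12 0 3 (.reg 52) (.cell 5 (.reg 53 + .reg 12))).run m₁ with hm₂
    have ff := frame_run (fillCmd 12 0 3 (.reg 52) (.cell 5 (.reg 53 + .reg 12))) m₁
    rw [← hm₂] at ff
    have hR₂ : Ready G m₂ := hR₁.frame ff
    have k52 := (ff.reg 52 rfl).trans g52
    have f4 := run_fillCmd (x := 12) (b := 0) (a := 4) (off := .reg 52)
      (src := .reg 50) (m := m₂) (o := m'.reg 2 * n)
      (s := fun x => n.factorial ^ n)
      (fun m'' hf => by rw [AExp.eval_reg, hf.reg 52 rfl, k52, hP.offset])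
      (fun x _ m'' hx hf => by rw [AExp.eval_reg, hf.reg 50 rfl, hR₂.denom])
    rw [hR₁.reg_zero] at f3
    rw [hR₂.reg_zero] at f4
    have ff' := frame_run (fillCmd 12 0 4 (.reg 52) (.reg 50)) m₂
    simp only [run_seq, run_assign]
    rw [← hm₂]
    set m₃ := (fillCmd 12 0 4 (.reg 52) (.reg 50)).run m₂ with hm₃
    have l2 : m₃.reg 2 = m'.reg 2 := (ff'.reg 2 rfl).trans ((ff.reg 2 rfl).trans g2)
    have l52 : m₃.reg 52 = m'.reg 2 * n := (ff'.reg 52 rfl).trans (k52.trans hP.offset)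
    have l0 : m₃.reg 0 = n := (hR₂.frame ff').reg_zero
    have a3 := ff'.arr 3 rfl
    have a4 := (ff.arr 4 rfl).trans g4
    -- Segments have length n and the new one starts at `m'.reg 2 * n`, beyond all earlier ones.
    -- Equal colourings from different pairs may be listed repeatedly.
    have hold : ∀ k < m'.reg 2, ∀ u v : Fin n, IsListed (m.arr 5) m' k u v →
        IsListed (m.arr 5)
          ((m₃.setReg 52 (m₃.reg 52 + m₃.reg 0)).setReg 2 (m₃.reg 2 + 1)) k u v := by
      intro k hk u v h x
      have := mul_add_lt hk x.2
      simp only [Memory.setReg_arr]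
      rw [a3, f3, f4, if_neg (by omega), if_neg (by omega), g3, a4]
      exact h x
    have hnew : IsListed (m.arr 5) ((m₃.setReg 52 (m₃.reg 52 + m₃.reg 0)).setReg 2 (m₃.reg 2 + 1))
        (m'.reg 2) (⟨i, hi⟩ : Fin n) ⟨j, hj⟩ := by
      intro x
      have := x.2
      simp only [Memory.setReg_arr]
      rw [a3, f3, f4, if_pos (by omega), if_pos (by omega), Nat.add_sub_cancel_left]
      exact ⟨rfl, rfl⟩
    refine ⟨?_, fun k hk => ?_, fun u v huv h hv => ?_⟩
    · simp [l52, l2, l0]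
      ring
    · have hk' : k < m'.reg 2 + 1 := by simpa [l2] using hk
      rcases Nat.lt_succ_iff_lt_or_eq.1 hk' with hk' | rfl
      · obtain ⟨u, v, h₁, h₂, h₃⟩ := hP.sound k hk'
        exact ⟨u, v, h₁, h₂, hold k hk' u v h₃⟩
      · exact ⟨_, _, huv, heq, hnew⟩
    · rcases hsplit u v huv h with h | ⟨rfl, rfl⟩
      · obtain ⟨k, hk, hk'⟩ := hP.complete u v huv h hv
        exact ⟨k, by simp [l2]; omega, hold k hk u v hk'⟩
      · exact ⟨m'.reg 2, by simp [l2], hnew⟩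

/-! ## The number of edges -/

/-- Register `1` becomes the number of edges. -/
def countCmd : Cmd :=
  .assign 1 0 ;; .loop 54 0 (.loop 55 0 (when (.reg 55 - .reg 54)
    (when (.cell 0 (.cell 9 (.reg 54) + .reg 55)) (.assign 1 (.reg 1 + 1)))))

theorem run_countCmd {m : Memory} (hm : Ready G m) :
    (countCmd.run m).reg 1 = (edgePairs G).card := by
  have hR : Ready G (m.setReg 1 0) := hm.of_eq rfl rfl rfl rfl rfl
  have key := run_loop_loop (x := 54) (y := 55) (m := m.setReg 1 0)
    (c := when (.reg 55 - .reg 54)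
      (when (.cell 0 (.cell 9 (.reg 54) + .reg 55)) (.assign 1 (.reg 1 + 1))))
    (P := fun N m' => m'.reg 1 = ((edgePairs G).filter fun p => p.1 * n + p.2 < N).card)
    hR.reg_zero (by simp) ?_ (fun N m' k h => by simpa using h)
  · rw [Finset.filter_true_of_mem] at key
    · exact key
    · exact fun p _ => mul_add_lt p.1.2 p.2.2
  intro i hi j hj m' hi' hj' hf hP
  have hR' := hR.frame hf
  have hadj := hR'.adj ⟨i, hi⟩ ⟨j, hj⟩
  have ht : m'.arr 9 i = i * n := hR'.table i (hi.trans_le (Nat.le_mul_self n))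
  simp only at hadj
  have hmem : ∀ p : Fin n × Fin n, p.1 * n + p.2 < i * n + j + 1 ↔
      p.1 * n + p.2 < i * n + j ∨ p = (⟨i, hi⟩, ⟨j, hj⟩) := by
    intro p
    rw [Nat.lt_succ_iff_lt_or_eq]
    refine or_congr_right ⟨fun h => ?_, ?_⟩
    · obtain ⟨h₁, h₂⟩ := mul_add_inj p.2.2 hj h
      exact Prod.ext (Fin.ext h₁) (Fin.ext h₂)
    · rintro rfl
      rfl
  have hcard : ((edgePairs G).filter fun p => p.1 * n + p.2 < i * n + j + 1).card =
      ((edgePairs G).filter fun p => p.1 * n + p.2 < i * n + j).card +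
      if ((⟨i, hi⟩, ⟨j, hj⟩) : Fin n × Fin n) ∈ edgePairs G then 1 else 0 := by
    simp only [hmem, Finset.filter_or, Finset.filter_eq']
    split_ifs with h
    · rw [Finset.card_union_of_disjoint, Finset.card_singleton]
      simp
    · simp
  rw [hcard, ← hP]
  simp only [run_when, AExp.eval_sub, AExp.eval_cell, AExp.eval_add, AExp.eval_reg, AExp.eval_one,
    hi', hj', ht, hadj, run_assign]
  simp only [edgePairs, Finset.mem_filter, Finset.mem_univ, true_and, Fin.mk_lt_mk]
  by_cases hij : i < j
  · have : j - i ≠ 0 := by omega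
    by_cases hA : G.Adj ⟨i, hi⟩ ⟨j, hj⟩ <;> simp [hij, hA, this]
  · have : j - i = 0 := by omega
    simp [hij, this]

end Passes

section Solution

variable {n : ℕ} {G : SimpleGraph (Fin n)}

/-! ## The whole program -/

theorem paddedVector_eq_of_gradVector_eq {c c' : Fin n → ℕ} {f f' : Fin n → ℝ} {Q : ℕ}
    (hQ : 0 < Q) (hf : ∀ x, f x = (c x : ℝ) / Q) (hf' : ∀ x, f' x = (c' x : ℝ) / Q)
    (h : gradVector G f = gradVector G f') : paddedVector G c = paddedVector G c' := by
  have hQ' : (Q : ℝ) ≠ 0 := by exact_mod_cast hQ.ne'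
  rw [gradVector_eq_map G c hQ hf, gradVector_eq_map G c' hQ hf'] at h
  have hinj : Function.Injective fun a : ℕ => (a : ℝ) / Q := fun a b hab =>
    Nat.cast_injective ((div_left_inj' hQ').1 hab)
  rw [paddedVector_eq, paddedVector_eq, List.map_injective_iff.2 hinj h]

/-- Compute the complete solution, once register `3` holds `n * n`. -/
def mainCmd : Cmd :=
  preambleCmd ;; pairsCmd ;; minCmd ;; listCmd ;; countCmd ;; fillCmd 61 3 2 0 (.reg 50)

/-- The arrays and registers read by `HoldsSolution`, in terms of the colourings in array `5`. -/
theorem holdsSolution_of {m : Memory} (hn : 2 ≤ n) (hG : G.Connected)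
    (hpairs : HoldsPairs G (n * n) m) (hmin : HoldsMin G (m.arr 5) (n * n) m)
    (hlist : HoldsList G (m.arr 5) ((List.range (n * n)).map (m.arr 1)) (n * n) m)
    (hcount : m.reg 1 = (edgePairs G).card) (hden : ∀ i < n * n, m.arr 2 i = n.factorial ^ n) :
    HoldsSolution G m := by
  have hQ : 0 < n.factorial ^ n := pow_pos n.factorial_pos n
  have hval : ∀ {u v : Fin n}, u ≠ v → ∀ {f : Fin n → ℝ}, CCMPairOutputs G u v f → ∀ x,
      f x = (pairColour (m.arr 5) u v x : ℝ) / (n.factorial ^ n : ℕ) := fun huv f hf x =>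
    (hpairs _ _ (mul_add_lt (Fin.is_lt _) (Fin.is_lt _)) huv x).1 f hf
  rcases hmin with ⟨-, h⟩ | ⟨-, ⟨u, v, huv, h₁⟩, h₂⟩
  -- Since n ≥ 2, the pair (0, 1) has been examined, so the case in which no vector was stored
  -- cannot occur.
  · exact absurd (mul_add_lt (Fin.is_lt _) (Fin.is_lt _))
      (h ⟨0, by omega⟩ ⟨1, by omega⟩ (by simp))
  rw [h₁] at h₂ hlist
  obtain ⟨f, hf⟩ := exists_ccmPairOutputs hG u v
  have hγ : IsMinPairVector G (gradVector G f) := by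
    refine ⟨⟨u, v, huv, f, hf, rfl⟩, ?_⟩
    rintro _ ⟨u', v', huv', g, hg, rfl⟩
    exact gradVector_le_of_paddedVector_le hQ (hval huv hf) (hval huv' hg)
      (h₂ u' v' huv' (mul_add_lt u'.2 v'.2))
  have hfrac : ∀ {k : ℕ} {u v : Fin n}, u ≠ v → IsListed (m.arr 5) m k u v →
      ∀ {g : Fin n → ℝ}, CCMPairOutputs G u v g → ∀ w : Fin n,
      m.HoldsFrac 3 4 (k * n + w) (g w) := by
    intro k u v huv hk g hg w
    obtain ⟨e₁, e₂⟩ := hk w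
    rw [Memory.HoldsFrac, e₁, e₂]
    exact ⟨hQ, hval huv hg w⟩
  refine ⟨⟨gradVector G f, hγ.isMinGradationVector hG, ?_, ?_⟩, ?_, ?_, ?_⟩
  · rw [gradVector_eq_map G _ hQ (hval huv hf), List.length_map, length_toneVector, hcount]
  · rw [gradVector_eq_map G _ hQ (hval huv hf)]
    intro i hi
    have hi' : i < (toneVector G (pairColour (m.arr 5) u v)).length := by simpa using hi
    have hin : i < n * n := by
      rw [length_toneVector] at hi'
      exact hi'.trans_le (card_edgePairs_le G)
    -- Array `1` holds the padded minimum. Below the number of edges its entries are those of the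
    -- tone vector.
    have e : m.arr 1 i = (toneVector G (pairColour (m.arr 5) u v))[i] := by
      have := congrArg (fun l : List ℕ => l[i]?) h₁
      simp only [pairVector, paddedVector_eq, List.getElem?_append_left hi', List.getElem?_map,
        List.getElem?_range hin, List.getElem?_eq_getElem hi', Option.map_some,
        Option.some.injEq] at this
      exact this
    rw [Memory.HoldsFrac, hden i hin, e, List.getElem_map]
    exact ⟨hQ, rfl⟩
  · intro k hk
    obtain ⟨u', v', huv', h₃, h₄⟩ := hlist.sound k hk
    obtain ⟨g, hg⟩ := exists_ccmPairOutputs hG u' v'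
    refine ⟨g, (hγ.isMinGradationGreyscale_iff hG).2 ⟨⟨u', v', huv', hg⟩, ?_⟩, hfrac huv' h₄ hg⟩
    exact le_antisymm
      (gradVector_le_of_paddedVector_le hQ (hval huv' hg) (hval huv hf) h₃.le)
      (gradVector_le_of_paddedVector_le hQ (hval huv hf) (hval huv' hg) h₃.ge)
  · intro g hg
    obtain ⟨⟨u', v', huv', hg⟩, heq⟩ := (hγ.isMinGradationGreyscale_iff hG).1 hg
    obtain ⟨k, hk, h₄⟩ := hlist.complete u' v' huv' (mul_add_lt u'.2 v'.2)
      (paddedVector_eq_of_gradVector_eq hQ (hval huv' hg) (hval huv hf) heq)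
    exact ⟨k, hk, hfrac huv' h₄ hg⟩
  · intro u' v' huv'
    obtain ⟨g, hg⟩ := exists_ccmPairOutputs hG u' v'
    refine ⟨g, hg, fun w => ?_⟩
    obtain ⟨-, e⟩ := hpairs u' v' (mul_add_lt u'.2 v'.2) huv' w
    rw [Memory.HoldsFrac, e]
    exact ⟨hQ, hval huv' hg w⟩

theorem holdsSolution_mainCmd (hn : 2 ≤ n) (hG : G.Connected) :
    HoldsSolution G (mainCmd.run (squareCmd.run (inputMemory G))) := by
  have hR := ready_preamble (G := G)
  simp only [mainCmd, run_seq]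
  set m₀ := preambleCmd.run (squareCmd.run (inputMemory G))
  have hpairs := run_pairsCmd hn hG hR
  have hR₁ := hR.frame (frame_run pairsCmd m₀)
  set m₁ := pairsCmd.run m₀
  have hmin := run_minCmd hR₁
  have f₂ := frame_run minCmd m₁
  have hR₂ := hR₁.frame f₂
  set m₂ := minCmd.run m₁
  have hlist := run_listCmd hR₂
  have f₃ := frame_run listCmd m₂
  have hR₃ := hR₂.frame f₃
  set m₃ := listCmd.run m₂
  have hcount := run_countCmd hR₃
  have f₄ := frame_run countCmd m₃
  have hR₄ := hR₃.frame f₄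
  set m₄ := countCmd.run m₃
  have hfill := run_fillCmd (x := 61) (b := 3) (a := 2) (off := 0) (src := .reg 50) (m := m₄)
    (o := 0) (s := fun _ => n.factorial ^ n) (fun _ _ => rfl)
    (fun _ _ m' _ hf => by rw [AExp.eval_reg, hf.reg 50 rfl, hR₄.denom])
  have f₅ := frame_run (fillCmd 61 3 2 0 (.reg 50)) m₄
  set m₅ := (fillCmd 61 3 2 0 (.reg 50)).run m₄
  have e5 : m₅.arr 5 = m₁.arr 5 := by
    rw [f₅.arr 5 rfl, f₄.arr 5 rfl, f₃.arr 5 rfl, f₂.arr 5 rfl]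
  have e6 : m₅.arr 6 = m₁.arr 6 := by
    rw [f₅.arr 6 rfl, f₄.arr 6 rfl, f₃.arr 6 rfl, f₂.arr 6 rfl]
  have e1 : m₅.arr 1 = m₂.arr 1 := by rw [f₅.arr 1 rfl, f₄.arr 1 rfl, f₃.arr 1 rfl]
  have e51 : m₅.reg 51 = m₂.reg 51 := by rw [f₅.reg 51 rfl, f₄.reg 51 rfl, f₃.reg 51 rfl]
  have e3 : m₅.arr 3 = m₃.arr 3 := by rw [f₅.arr 3 rfl, f₄.arr 3 rfl]
  have e4 : m₅.arr 4 = m₃.arr 4 := by rw [f₅.arr 4 rfl, f₄.arr 4 rfl]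
  have e2 : m₅.reg 2 = m₃.reg 2 := by rw [f₅.reg 2 rfl, f₄.reg 2 rfl]
  have e52 : m₅.reg 52 = m₃.reg 52 := by rw [f₅.reg 52 rfl, f₄.reg 52 rfl]
  refine holdsSolution_of hn hG ?_ ?_ ?_ ?_ fun i hi => ?_
  · simp only [HoldsPairs, e5, e6]
    exact hpairs
  · simp only [HoldsMin, e5, e1, e51]
    exact hmin
  · rw [f₂.arr 5 rfl] at hlist
    rw [e5, e1]
    obtain ⟨h₁, h₂, h₃⟩ := hlist
    simp only [IsListed, ← e2, ← e52, ← e3, ← e4] at h₁ h₂ h₃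
    exact ⟨h₁, h₂, h₃⟩
  · rw [f₅.reg 1 rfl, hcount]
  · rw [hfill, hR₄.reg_three, if_pos (by omega)]

theorem exists_polynomial_time_program :
    ∃ (P : Program) (T : Polynomial ℕ), ∀ n : ℕ, 2 ≤ n → ∀ G : SimpleGraph (Fin n), G.Connected →
      ∃ (t : ℕ) (m : Memory), t ≤ T.eval n ∧ Runs P (inputMemory G) t m ∧ HoldsSolution G m := by
  -- Computing n * n is compiled separately because register `3` later bounds loops and must then
  -- stay fixed. The remaining loops run at most n ^ 2 times, hence the substitution of `X ^ 2`.
  refine ⟨.seq squareCmd.compile mainCmd.compile,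
    squareCmd.cost + mainCmd.cost.comp (Polynomial.X ^ 2), fun n hn G hG => ?_⟩
  obtain ⟨t₁, ht₁, h₁⟩ := runs_compile (S := [0]) (B := n) squareCmd rfl (inputMemory G)
    (by simp [inputMemory])
  obtain ⟨t₂, ht₂, h₂⟩ := runs_compile (S := [0, 3]) (B := n ^ 2) mainCmd rfl
    (squareCmd.run (inputMemory G)) (by
      have h0 : (squareCmd.run (inputMemory G)).reg 0 = n := by
        rw [run_reg _ _ 0]
        simp [inputMemory]
      have h3 : (squareCmd.run (inputMemory G)).reg 3 = n ^ 2 := by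
        rw [run_squareCmd, sq]
        simp [inputMemory]
      intro b hb
      rcases List.mem_pair.1 hb with rfl | rfl
      · rw [h0]
        exact Nat.le_self_pow two_ne_zero n
      · exact h3.le)
  refine ⟨t₁ + t₂, _, ?_, .seq h₁ h₂, holdsSolution_mainCmd hn hG⟩
  rw [Polynomial.eval_add, Polynomial.eval_comp, Polynomial.eval_pow, Polynomial.eval_X]
  exact add_le_add ht₁ ht₂

end Solution

end Gradation

theorem mainTheorem2 :
    -- the method: the procedure, run on all pairs of vertices coloured `0` and `1`, yields the
    -- minimum gradation vector and all minimum gradation greyscales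
    (∀ (V : Type*) [Fintype V] [Nontrivial V] (G : SimpleGraph V), G.Connected →
      (∀ u v : V, u ≠ v →
        (∃! f : V → ℝ, Gradation.CCMPairOutputs G u v f) ∧
        ∀ f : V → ℝ, Gradation.CCMPairOutputs G u v f →
          Gradation.IsGreyscale f ∧ f u = 0 ∧ f v = 1) ∧
      ∃ γ : List ℝ, Gradation.IsMinGradationVector G γ ∧
        IsLeast {x : List ℝ | ∃ u v : V, u ≠ v ∧
          ∃ f : V → ℝ, Gradation.CCMPairOutputs G u v f ∧ x = Gradation.gradVector G f} γ ∧
        ∀ f : V → ℝ, Gradation.IsMinGradationGreyscale G f ↔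
          (∃ u v : V, u ≠ v ∧ Gradation.CCMPairOutputs G u v f) ∧
            Gradation.gradVector G f = γ) ∧
    -- the running time: one program does all of this in polynomial time
    (∃ (P : Gradation.Program) (T : Polynomial ℕ), ∀ n : ℕ, 2 ≤ n →
      ∀ G : SimpleGraph (Fin n), G.Connected →
        ∃ (t : ℕ) (m : Gradation.Memory), t ≤ T.eval n ∧
          Gradation.Runs P (Gradation.inputMemory G) t m ∧ Gradation.HoldsSolution G m) := by
  refine ⟨fun V _ _ G hG => ⟨fun u v huv => ⟨?_, fun f hf => ?_⟩, ?_⟩,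
    Gradation.exists_polynomial_time_program⟩
  · obtain ⟨f, hf⟩ := Gradation.exists_ccmPairOutputs hG u v
    exact ⟨f, hf, fun g hg => hg.unique huv hf⟩
  · exact ⟨hf.isGreyscale huv, hf.apply_left huv, hf.apply_right⟩
  · obtain ⟨γ, hγ⟩ := Gradation.exists_isMinPairVector hG
    exact ⟨γ, hγ.isMinGradationVector hG, hγ, fun f => hγ.isMinGradationGreyscale_iff hG⟩
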